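/- Let $g>1$ be an integer and let $K$ be an algebraically closed field. Suppose that one of the following conditions holds: (a) $\mathrm{char}(K)=0$; (b) $q=2g+1$ is a prime, and $p=\mathrm{char}(K)$ is an odd prime that is a primitive root modulo $q$. Let $\mathcal{C}$ be a hyperelliptic curve of genus $g$ over $K$ (smooth, irreducible and projective), let $\mathcal{O}\in\mathcal{C}(K)$ be one of its Weierstrass points (the fixed points of the hyperelliptic involution), and embed $\mathcal{C}$ into its Jacobian $J$ by sending a point $P$ to the linear equivalence class of the divisor $(P)-(\mathcal{O})$. Suppose that $\mathcal{C}(K)$ contains more than four points whose order in the group $J(K)$ is exactly $2g+1$. Then: (i) if $\mathrm{char}(K)=0$, then $\mathcal{C}$ is defined over a number field; (ii) if $\mathrm{char}(K)=p>0$, then $\mathcal{C}$ is defined over a finite field. Here $\mathcal{C}$ is said to be defined over a subfield $k$ of $K$ if it is isomorphic over $K$ to the base change to $K$ of a curve over $k$; the number field in (i) and the finite field in (ii) are subfields of $K$. -/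

import Mathlib

/-!
Curves are handled through the classical dictionary between smooth irreducible projective curves
`C` over a field `K` (perfect, in all uses below) and function fields `F` of one variable over `K`:
`F` is the field of rational functions of `C`, and over an algebraically closed `K` the points of
`C(K)` are the discrete valuation rings of `F / K`, namely the local rings of `C` at its points.
-/

namespace HyperellipticTorsion

/-- `F` is a function field of one variable over `K`: it is a finite extension of `K(x)` for some
`x` that is transcendental over `K`. -/
def IsFunctionField (K F : Type*) [Field K] [Field F] [Algebra K F] : Prop :=
  ∃ x : F, Transcendental K x ∧ FiniteDimensional (IntermediateField.adjoin K {x}) F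

/-- A point of the smooth projective curve over the algebraically closed field `K` with function
field `F`: a discrete valuation ring of `F` that contains `K` (and has fraction field `F`). -/
structure Point (K F : Type*) [Field K] [Field F] [Algebra K F] where
  /-- The local ring of the curve at the point. -/
  localRing : ValuationSubring F
  algebraMap_mem : ∀ c : K, algebraMap K F c ∈ localRing
  isDVR : IsDiscreteValuationRing localRing

namespace Point

variable {K F : Type*} [Field K] [Field F] [Algebra K F]

/-- The normalized multiplicative valuation at a point: a function that vanishes there to order `n`
has valuation `WithZero.exp (-n)`. -/
noncomputable def valuation (P : Point K F) : Valuation F (WithZero (Multiplicative ℤ)) :=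
  haveI := P.isDVR
  (IsDiscreteValuationRing.maximalIdeal P.localRing).valuation F

/-- The order of vanishing at `P` of a nonzero rational function (with the value `0` at `0`). -/
noncomputable def ord (P : Point K F) (f : F) : ℤ :=
  -WithZero.log (P.valuation f)

theorem valuation_algebraMap_le_one (P : Point K F) (c : K) :
    P.valuation (algebraMap K F c) ≤ 1 := by
  have := P.isDVR
  exact (IsDiscreteValuationRing.maximalIdeal P.localRing).valuation_le_one (K := F)
    ⟨algebraMap K F c, P.algebraMap_mem c⟩

theorem ord_one (P : Point K F) : P.ord 1 = 0 := by
  simp [ord]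

theorem ord_mul (P : Point K F) {f h : F} (hf : f ≠ 0) (hh : h ≠ 0) :
    P.ord (f * h) = P.ord f + P.ord h := by
  have h1 : P.valuation f ≠ 0 := (Valuation.ne_zero_iff _).2 hf
  have h2 : P.valuation h ≠ 0 := (Valuation.ne_zero_iff _).2 hh
  rw [ord, map_mul, WithZero.log_mul h1 h2, ord, ord]
  ring

theorem ord_inv (P : Point K F) (f : F) : P.ord f⁻¹ = -P.ord f := by
  simp [ord]

end Point

section Divisors

variable (K F : Type*) [Field K] [Field F] [Algebra K F]

/-- Divisors: finite formal integral combinations of points. -/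
abbrev Divisor : Type _ := Point K F →₀ ℤ

/-- The degree of a divisor; all points are rational, since `K` is algebraically closed. -/
noncomputable def degree : Divisor K F →+ ℤ :=
  Finsupp.liftAddHom fun _ => AddMonoidHom.id ℤ

/-- The group of divisors of degree zero. -/
noncomputable def divisorsDegreeZero : AddSubgroup (Divisor K F) :=
  (degree K F).ker

/-- The group of principal divisors, i.e. of divisors of nonzero rational functions. -/
def principalDivisors : AddSubgroup (Divisor K F) where
  carrier := {D | ∃ f : F, f ≠ 0 ∧ ∀ P : Point K F, D P = P.ord f}
  zero_mem' := ⟨1, one_ne_zero, fun P => by simp [P.ord_one]⟩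
  add_mem' := by
    rintro D E ⟨f, hf, hD⟩ ⟨h, hh, hE⟩
    exact ⟨f * h, mul_ne_zero hf hh, fun P => by
      rw [Finsupp.add_apply, hD, hE, P.ord_mul hf hh]⟩
  neg_mem' := by
    rintro D ⟨f, hf, hD⟩
    exact ⟨f⁻¹, inv_ne_zero hf, fun P => by rw [Finsupp.neg_apply, hD, P.ord_inv]⟩

/-- The group `J(K)` of points of the Jacobian: divisors of degree zero modulo linear
equivalence. -/
abbrev Jacobian : Type _ :=
  divisorsDegreeZero K F ⧸ (principalDivisors K F).addSubgroupOf (divisorsDegreeZero K F)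

variable {K F}

/-- The embedding of the curve into its Jacobian that sends a point `P` to the class of the
divisor `(P) - (O)`. -/
noncomputable def toJacobian (O P : Point K F) : Jacobian K F :=
  QuotientAddGroup.mk
    ⟨Finsupp.single P 1 - Finsupp.single O 1, by
      rw [divisorsDegreeZero, AddMonoidHom.mem_ker, map_sub]
      simp [degree]⟩

/-- The set of the points of the curve, embedded in its Jacobian with `O` as origin, whose order
in the group `J(K)` is exactly `d` (for `d > 0`). -/
def torsionPoints (O : Point K F) (d : ℕ) : Set (Point K F) :=
  {P | addOrderOf (toJacobian O P) = d}

/-- The Riemann-Roch space `L(D)`: zero and the rational functions `f ≠ 0` with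
`ord_P f + D P ≥ 0` for all points `P`. -/
noncomputable def riemannRochSpace (D : Divisor K F) : Submodule K F where
  carrier := {f | ∀ P : Point K F, P.valuation f ≤ WithZero.exp (D P)}
  zero_mem' P := by simp
  add_mem' {f h} hf hh P := (P.valuation.map_add f h).trans (max_le (hf P) (hh P))
  smul_mem' c f hf P := by
    rw [Algebra.smul_def, map_mul]
    exact (mul_le_mul' (P.valuation_algebraMap_le_one c) le_rfl).trans
      ((one_mul _).le.trans (hf P))

theorem mem_riemannRochSpace_iff {D : Divisor K F} {f : F} (hf : f ≠ 0) :
    f ∈ riemannRochSpace D ↔ ∀ P : Point K F, 0 ≤ P.ord f + D P := by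
  refine forall_congr' fun P => ?_
  have h : P.valuation f ≠ 0 := (Valuation.ne_zero_iff _).2 hf
  rw [← WithZero.log_le_iff_le_exp h, Point.ord]
  constructor <;> intro h <;> linarith

variable (K F)

/-- `g` is the genus of the curve, i.e. the largest value of `deg D + 1 - dim L(D)` on divisors
(Riemann's definition). -/
def HasGenus (g : ℕ) : Prop :=
  IsGreatest {n : ℤ | ∃ D : Divisor K F,
    n = degree K F D + 1 - Module.finrank K (riemannRochSpace D)} g

end Divisors

section Hyperelliptic

variable {K F : Type*} [Field K] [Field F] [Algebra K F]

/-- `ι` is (the action on rational functions of) a hyperelliptic involution: an automorphism of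
order two of the curve whose quotient curve is the projective line, that is, whose field of
invariants is `K(x)` for some `x` in `F`. -/
def IsHyperellipticInvolution (ι : F ≃ₐ[K] F) : Prop :=
  orderOf ι = 2 ∧
    ∃ x : F, IntermediateField.fixedField (Subgroup.zpowers ι) = IntermediateField.adjoin K {x}

variable (K F) in
/-- The curve with function field `F`, together with its point `O`, is a marked hyperelliptic curve
of genus `g` over `K` (algebraically closed of characteristic different from two, `g > 1`):
the curve has a hyperelliptic involution, and `O` is one of its Weierstrass points, i.e. of the
fixed points of the hyperelliptic involution. -/
structure IsMarkedHyperellipticCurve (g : ℕ) (O : Point K F) : Prop where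
  isFunctionField : IsFunctionField K F
  hasGenus : HasGenus K F g
  isWeierstrass : ∃ ι : F ≃ₐ[K] F, IsHyperellipticInvolution ι ∧
    ∀ f : F, ι f ∈ O.localRing ↔ f ∈ O.localRing

end Hyperelliptic

/-- The curve over `K` with function field `F` is defined over the (perfect) subfield `k` of `K`:
it is obtained by extension of scalars from a curve over `k`. In terms of function fields, there is
a function field `F₀` of one variable over `k` inside `F` such that `F` is the fraction field of
`F₀ ⊗ K` (tensor product over `k`), i.e. `F₀` and `K` are linearly disjoint over `k` and generate
`F`. -/
def IsDefinedOver {K : Type*} (F : Type*) [Field K] [Field F] [Algebra K F] (k : Subfield K) :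
    Prop :=
  ∃ F₀ : IntermediateField k F, IsFunctionField k F₀ ∧ F₀.LinearDisjoint K ∧
    IntermediateField.adjoin K (F₀ : Set F) = ⊤

end HyperellipticTorsion

/-!
Put the Weierstrass point `O` at infinity, so that the curve becomes `y² = f(x)` with `f` squarefree
of degree `2m+1` (`IsHyperellipticInvolution.exists_oddModel`). The functions without poles outside
`O` are the `A(x) + B(x) y` (`OddModel.exists_eq_of_regular`), and Riemann's inequality with the
constant `m` follows by counting them (`OddModel.riemannBound`); so `g ≤ m`. If `P` has order `2g+1`,
let `h` be a function with divisor `(2g+1) (P) - (2g+1) (O)`. Its pole of odd order forces `m = g`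
and `h = y - v(x)` up to a constant, where `deg v ≤ g`, and taking norms to `K(x)` gives
`f = (X - a) ^ (2g+1) + v²` with `a = x(P)` (`OddModel.exists_eq_pow_add_sq`). Over each value of `x`
there are at most two points, so more than four torsion points give three presentations of `f` of
this kind, with different `a₁, a₂, a₃` (`OddModel.exists_three_coordinates`).

It remains to see that three presentations make `f` algebraic over the prime field, after an affine
substitution that achieves `a₁ = 0` and `a₂ = 1` (`exists_affine_isIntegral`). An element of `K` is
algebraic over the prime field if it lies in all valuation rings `A` of `K` that contain the prime
field. After a permutation and a rescaling of the `aᵢ`, suppose that `a₁ - a₂` is a unit of `A` and that `a₃` lies in `A`.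

* Suppose that `v₁` is not integral at `A`. As `vᵢ² - vⱼ² = (X - aⱼ) ^ (2g+1) - (X - aᵢ) ^ (2g+1)`
  is integral, all `vᵢ` have the same leading form `U` up to sign, and `U` divides the reductions of
  these differences, and even of their quotients by `aᵢ - aⱼ` (`exists_red_eq_mul`). Then `U` has
  degree `g > 1` and simple roots `β`, which, if the `aᵢ` remain distinct, satisfy
  `(β - a₁) ^ (2g+1) = (β - a₂) ^ (2g+1) = (β - a₃) ^ (2g+1)` in an extension of the residue field.
  In characteristic zero, `β` is then the circumcenter of a triangle in the complex plane, and so is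
  unique: a contradiction. In characteristic `p`, uniqueness follows from the irreducibility of the
  cyclotomic polynomial of order `2g+1` modulo `p` (`AdmissibleChar.circumcenter_unique`). This is
  where the hypothesis on the characteristic is needed.
* Suppose that the `vᵢ` are integral, but two of the `aᵢ` have the same reduction. Then the common
  reduction of `f` is both `(X - a) ^ (2g+1) + s (X - a) ^ (2g)` and `(X - b) ^ (2g+1) + v²` with
  `a ≠ b`, which a Wronskian argument excludes (`X_sub_C_pow_add_mul_pow_ne`).

Finally, a curve `y² = f(x)` is defined over every field that contains the coefficients of `f`
(`isDefinedOver_of_coeff_mem`), and finitely many elements algebraic over the prime field generate a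
number field or a finite field (`exists_subfield_of_isIntegral`).
-/

namespace HyperellipticTorsion

open Polynomial

/-! ### Roots of unity in admissible characteristic -/

/-- The hypothesis of the theorem on the characteristic of the ground field, as a condition on
`g` and on the characteristic `p` (which may be zero). -/
def AdmissibleChar (p g : ℕ) : Prop :=
  p = 0 ∨ (Nat.Prime (2 * g + 1) ∧ Nat.Prime p ∧ p ≠ 2 ∧
    orderOf ((p : ℕ) : ZMod (2 * g + 1)) = 2 * g)

section Char

variable {L : Type*} [Field L] {g : ℕ}

theorem AdmissibleChar.two_ne_zero (h : AdmissibleChar (ringChar L) g) : (2 : L) ≠ 0 := by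
  intro h2
  have h2' : ((2 : ℕ) : L) = 0 := by exact_mod_cast h2
  rw [ringChar.spec] at h2'
  rcases h with h | ⟨-, hp, hp2, -⟩
  · rw [h] at h2'
    simp at h2'
  · exact hp2 ((Nat.prime_dvd_prime_iff_eq hp Nat.prime_two).1 h2')

theorem AdmissibleChar.not_dvd (h : AdmissibleChar (ringChar L) g) (hg : 1 < g) :
    ¬ ringChar L ∣ 2 * g + 1 := by
  intro hd
  rcases h with h | ⟨hq, hp, -, ho⟩
  · rw [h] at hd
    simp at hd
  · rw [Nat.prime_dvd_prime_iff_eq hp hq] at hd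
    have : Fact (1 < 2 * g + 1) := ⟨by omega⟩
    rw [hd, ZMod.natCast_self, orderOf_zero] at ho
    omega

theorem AdmissibleChar.cast_ne_zero (h : AdmissibleChar (ringChar L) g) (hg : 1 < g) :
    (2 * (g : L) + 1) ≠ 0 := by
  intro h0
  refine h.not_dvd hg ((ringChar.spec L _).1 ?_)
  push_cast
  exact h0

/-- Complex conjugation inverts roots of unity, so that the conjugate of the given relation is a
second equation between the same four numbers; together they leave only the trivial solutions. -/
theorem eq_of_one_sub_mul_one_sub_complex {n : ℕ} (hn : n ≠ 0) {ζ η ζ' η' : ℂ}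
    (hζ : ζ ^ n = 1) (hη : η ^ n = 1) (hζ' : ζ' ^ n = 1) (hη' : η' ^ n = 1)
    (hη1 : η ≠ 1) (hζ'1 : ζ' ≠ 1) (hne : ζ ≠ η)
    (h : (1 - η) * (1 - ζ') = (1 - η') * (1 - ζ)) : ζ = ζ' := by
  have conj_mul {z : ℂ} (hz : z ^ n = 1) : starRingEnd ℂ z * z = 1 := by
    rw [mul_comm, Complex.mul_conj, Complex.normSq_eq_norm_sq, Complex.norm_eq_one_of_pow_eq_one hz hn]
    simp
  have hc := congrArg (starRingEnd ℂ) h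
  simp only [map_mul, map_sub, map_one] at hc
  have e1 := conj_mul hζ
  have e2 := conj_mul hη
  have e3 := conj_mul hζ'
  have e4 := conj_mul hη'
  set a := starRingEnd ℂ ζ
  set b := starRingEnd ℂ η
  set c := starRingEnd ℂ ζ'
  set d := starRingEnd ℂ η'
  have h1 : (1 - η) * (1 - ζ') ≠ 0 :=
    mul_ne_zero (sub_ne_zero.2 hη1.symm) (sub_ne_zero.2 hζ'1.symm)
  have h2 : η' * ζ = η * ζ' := by
    apply mul_left_cancel₀ h1
    have : (1 - b) * η * ((1 - c) * ζ') * (η' * ζ) = (1 - d) * η' * ((1 - a) * ζ) * (η * ζ') := by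
      linear_combination (η * ζ' * (η' * ζ)) * hc
    have k1 : (1 - b) * η = η - 1 := by linear_combination -e2
    have k2 : (1 - c) * ζ' = ζ' - 1 := by linear_combination -e3
    have k3 : (1 - d) * η' = η' - 1 := by linear_combination -e4
    have k4 : (1 - a) * ζ = ζ - 1 := by linear_combination -e1
    rw [k1, k2, k3, k4] at this
    linear_combination this - η * ζ' * h
  have h3 : (η - η') * (η - ζ) = 0 := by linear_combination (1 - η) * h2 - η * h
  rcases mul_eq_zero.1 h3 with h4 | h4
  · have : η = η' := sub_eq_zero.1 h4
    subst this
    have : η ≠ 0 := by rintro rfl; simp [hn] at hη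
    exact mul_left_cancel₀ this h2
  · exact absurd (sub_eq_zero.1 h4).symm hne

theorem eq_of_one_sub_mul_one_sub_charZero [CharZero L] {n : ℕ} (hn : n ≠ 0) {ζ η ζ' η' : L}
    (hζ : ζ ^ n = 1) (hη : η ^ n = 1) (hζ' : ζ' ^ n = 1) (hη' : η' ^ n = 1)
    (hη1 : η ≠ 1) (hζ'1 : ζ' ≠ 1) (hne : ζ ≠ η)
    (h : (1 - η) * (1 - ζ') = (1 - η') * (1 - ζ)) : ζ = ζ' := by
  let M := algebraicClosure ℚ L
  have mem {z : L} (hz : z ^ n = 1) : z ∈ M := by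
    rw [mem_algebraicClosure_iff]
    exact (IsIntegral.of_pow (R := ℚ) (Nat.pos_of_ne_zero hn) (by rw [hz]; exact isIntegral_one)).isAlgebraic
  have : Algebra.IsAlgebraic ℚ M := algebraicClosure.isAlgebraic ℚ L
  let φ : M →ₐ[ℚ] ℂ := IsAlgClosed.lift
  have hφ : Function.Injective φ := φ.injective
  lift ζ to M using mem hζ
  lift η to M using mem hη
  lift ζ' to M using mem hζ'
  lift η' to M using mem hη'
  norm_cast at *
  apply hφ
  refine eq_of_one_sub_mul_one_sub_complex hn (η := φ η) (η' := φ η') ?_ ?_ ?_ ?_ ?_ ?_ ?_ ?_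
  · rw [← map_pow, hζ, map_one]
  · rw [← map_pow, hη, map_one]
  · rw [← map_pow, hζ', map_one]
  · rw [← map_pow, hη', map_one]
  · exact fun h => hη1 (hφ (by rw [h, map_one]))
  · exact fun h => hζ'1 (hφ (by rw [h, map_one]))
  · exact fun h => hne (hφ h)
  · simpa using congrArg φ h

/-- If `p` is a primitive root modulo `q`, the `q`-th cyclotomic polynomial is irreducible modulo
`p`. A polynomial of degree less than `q` over the prime field that vanishes at a primitive `q`-th
root of unity is therefore a multiple of `1 + X + ⋯ + X ^ (q-1)` by a constant, and this constant is
zero if the polynomial also vanishes at `1`. -/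
theorem eq_zero_of_aeval_primitiveRoot {p q : ℕ} [Fact p.Prime] (hq : q.Prime)
    (hpq : ¬ p ∣ q) (ho : orderOf (p : ZMod q) = q - 1) [Algebra (ZMod p) L] {ζ : L}
    (hζ : IsPrimitiveRoot ζ q) {T : (ZMod p)[X]} (hdeg : T.degree < q) (h0 : aeval ζ T = 0)
    (h1 : T.eval 1 = 0) : T = 0 := by
  have hq0 : 0 < q := hq.pos
  have : NeZero ((q : ℕ) : L) := by
    refine ⟨fun h => hpq ?_⟩
    have : CharP L p := charP_of_injective_algebraMap (algebraMap (ZMod p) L).injective p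
    exact (CharP.cast_eq_zero_iff L p q).1 h
  have hirr : Irreducible (cyclotomic q (ZMod p)) := by
    refine ZMod.irreducible_of_dvd_cyclotomic_of_natDegree hpq dvd_rfl ?_
    rw [natDegree_cyclotomic, Nat.totient_prime hq, ← ho, ← orderOf_units,
      ZMod.coe_unitOfCoprime]
  have hroot : aeval ζ (cyclotomic q (ZMod p)) = 0 := by
    rw [aeval_def, eval₂_eq_eval_map, map_cyclotomic]
    exact (isRoot_cyclotomic_iff.2 hζ)
  have hmin := minpoly.eq_of_irreducible_of_monic hirr hroot (cyclotomic.monic q _)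
  obtain ⟨S, hS⟩ : cyclotomic q (ZMod p) ∣ T := hmin ▸ minpoly.dvd _ _ h0
  by_contra hT
  have hS0 : S ≠ 0 := by rintro rfl; exact hT (by rw [hS, mul_zero])
  have hSdeg : S.natDegree = 0 := by
    have := natDegree_mul (cyclotomic_ne_zero q (ZMod p)) hS0
    rw [← hS, natDegree_cyclotomic, Nat.totient_prime hq] at this
    have h2 := (natDegree_lt_iff_degree_lt hT).2 hdeg
    omega
  obtain ⟨c, rfl⟩ := natDegree_eq_zero.1 hSdeg
  have : Fact q.Prime := ⟨hq⟩
  rw [hS, eval_mul, eval_C, eval_one_cyclotomic_prime] at h1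
  rcases mul_eq_zero.1 h1 with h | h
  · exact hpq ((ZMod.natCast_eq_zero_iff _ _).1 h)
  · exact hS0 (by rw [h, C_0])

/-- If `p` is a primitive root modulo the prime `q`, then the only linear relation between the
powers of a primitive `q`-th root of unity in characteristic `p` is the vanishing of the sum of
all of them, so that the given relation must already hold in the group ring. -/
theorem eq_of_one_sub_mul_one_sub_charP {p q : ℕ} [Fact p.Prime] (hp2 : p ≠ 2) (hq : q.Prime)
    (hq3 : 3 < q) (hpq : ¬ p ∣ q) (ho : orderOf (p : ZMod q) = q - 1) [Algebra (ZMod p) L]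
    {ζ η ζ' η' : L}
    (hζ : ζ ^ q = 1) (hη : η ^ q = 1) (hζ' : ζ' ^ q = 1) (hη' : η' ^ q = 1)
    (hζ1 : ζ ≠ 1) (hη1 : η ≠ 1) (hζ'1 : ζ' ≠ 1) (hη'1 : η' ≠ 1) (hne : ζ ≠ η)
    (h : (1 - η) * (1 - ζ') = (1 - η') * (1 - ζ)) : ζ = ζ' := by
  have hq0 : 0 < q := hq.pos
  have : NeZero q := ⟨hq0.ne'⟩
  have hprim : IsPrimitiveRoot ζ q := by
    have : Fact q.Prime := ⟨hq⟩
    rw [IsPrimitiveRoot.iff_orderOf]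
    exact orderOf_eq_prime hζ hζ1
  obtain ⟨i, hi, rfl⟩ := hprim.eq_pow_of_pow_eq_one hη
  obtain ⟨j, hj, rfl⟩ := hprim.eq_pow_of_pow_eq_one hζ'
  obtain ⟨k, hk, rfl⟩ := hprim.eq_pow_of_pow_eq_one hη'
  by_contra hj1
  have hi0 : i ≠ 0 := by rintro rfl; simp at hη1
  have hj0 : j ≠ 0 := by rintro rfl; simp at hζ'1
  have hk0 : k ≠ 0 := by rintro rfl; simp at hη'1
  have hi1 : i ≠ 1 := by rintro rfl; simp at hne
  have hj1' : j ≠ 1 := by rintro rfl; simp at hj1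
  have hik : i ≠ k := by
    rintro rfl
    exact hj1 (by linear_combination mul_left_cancel₀ (sub_ne_zero.2 hη1.symm) h)
  let T : (ZMod p)[X] := X ^ i + X ^ j - X ^ ((i + j) % q) - X ^ k - X ^ 1 + X ^ ((k + 1) % q)
  have hmod (m : ℕ) : ζ ^ (m % q) = ζ ^ m := by
    conv_rhs => rw [← Nat.mod_add_div m q, pow_add, pow_mul, hζ, one_pow, mul_one]
  have hT : T = 0 := by
    refine eq_zero_of_aeval_primitiveRoot hq hpq ho hprim ?_ ?_ ?_
    · have hX {m : ℕ} (hm : m < q) : (X ^ m : (ZMod p)[X]) ∈ degreeLT (ZMod p) q := by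
        rw [mem_degreeLT, degree_X_pow]
        exact_mod_cast hm
      rw [← mem_degreeLT]
      exact add_mem (sub_mem (sub_mem (sub_mem (add_mem (hX hi) (hX hj))
        (hX (Nat.mod_lt _ hq0))) (hX hk)) (hX (by omega))) (hX (Nat.mod_lt _ hq0))
    · simp only [T, map_add, map_sub, map_pow, aeval_X, hmod]
      linear_combination -h
    · simp [T]
  have hcoef (m : ℕ) := congrArg (fun P => coeff P m) hT
  simp only [T, coeff_add, coeff_sub, coeff_X_pow, coeff_zero] at hcoef
  have hij : i ≠ (i + j) % q := by
    intro e
    rcases lt_or_ge (i + j) q with h' | h'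
    · rw [Nat.mod_eq_of_lt h'] at e; omega
    · rw [Nat.mod_eq_sub_mod h', Nat.mod_eq_of_lt (by omega)] at e; omega
  have hkk : k ≠ (k + 1) % q := by
    intro e
    rcases lt_or_ge (k + 1) q with h' | h'
    · rw [Nat.mod_eq_of_lt h'] at e; omega
    · rw [Nat.mod_eq_sub_mod h', Nat.mod_eq_of_lt (by omega)] at e; omega
  have two : (2 : ZMod p) ≠ 0 := by
    have : ((2 : ℕ) : ZMod p) ≠ 0 := by
      rw [Ne, ZMod.natCast_eq_zero_iff, Nat.prime_dvd_prime_iff_eq Fact.out Nat.prime_two]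
      exact hp2
    exact_mod_cast this
  have two' : (1 + 1 : ZMod p) ≠ 0 := by rwa [one_add_one_eq_two]
  have ci := hcoef i
  have ck := hcoef k
  rw [if_pos rfl, if_neg hij, if_neg hik, if_neg hi1] at ci
  rw [if_neg hik.symm, if_pos (rfl : k = k), if_neg hkk] at ck
  have e1 : i = j ∧ i = (k + 1) % q := by
    by_contra hcon
    split_ifs at ci <;> first | (exact hcon ⟨by assumption, by assumption⟩) | simp at ci
    all_goals exact two (by linear_combination ci)
  have e2 : k = (i + j) % q ∧ k = 1 := by
    have hkj : k ≠ j := fun e => hik (e1.1.trans e.symm)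
    rw [if_neg hkj] at ck
    by_contra hcon
    split_ifs at ck <;> first | (exact hcon ⟨by assumption, by assumption⟩) | simp at ck
    all_goals exact two (by linear_combination -ck)
  obtain ⟨e3, rfl⟩ := e2
  rw [Nat.mod_eq_of_lt (by omega)] at e1
  obtain ⟨rfl, rfl⟩ := e1
  norm_num at e3
  rcases lt_or_ge 4 q with h' | h'
  · rw [Nat.mod_eq_of_lt h'] at e3; omega
  · have : q = 4 := by omega
    subst this
    simp at e3

/-- A pair `ζ, η` of nontrivial `(2g+1)`-th roots of unity is determined by the ratio
`(1 - η) / (1 - ζ)` if this ratio is not `1`. -/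
theorem AdmissibleChar.eq_of_one_sub_mul_one_sub (hL : AdmissibleChar (ringChar L) g) (hg : 1 < g)
    {ζ η ζ' η' : L} (hζ : ζ ^ (2 * g + 1) = 1) (hη : η ^ (2 * g + 1) = 1)
    (hζ' : ζ' ^ (2 * g + 1) = 1) (hη' : η' ^ (2 * g + 1) = 1)
    (hζ1 : ζ ≠ 1) (hη1 : η ≠ 1) (hζ'1 : ζ' ≠ 1) (hη'1 : η' ≠ 1) (hne : ζ ≠ η)
    (h : (1 - η) * (1 - ζ') = (1 - η') * (1 - ζ)) : ζ = ζ' := by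
  have hnd := hL.not_dvd hg
  rcases hL with h0 | ⟨hq, hp, hp2, ho⟩
  · have : CharZero L := by
      have := ringChar.charP L
      rw [h0] at this
      exact CharP.charP_to_charZero L
    exact eq_of_one_sub_mul_one_sub_charZero (by omega) hζ hη hζ' hη' hη1 hζ'1 hne h
  · have : Fact (ringChar L).Prime := ⟨hp⟩
    have := ringChar.charP L
    let : Algebra (ZMod (ringChar L)) L := ZMod.algebra L (ringChar L)
    exact eq_of_one_sub_mul_one_sub_charP hp2 hq (by omega) hnd (by simpa using ho)
      hζ hη hζ' hη' hζ1 hη1 hζ'1 hη'1 hne h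

/-- Over the complex numbers a point at equal distance from three points of the plane is unique;
`(β - a) ^ (2g+1) = (β - b) ^ (2g+1)` is an algebraic form of equality of distances. -/
theorem AdmissibleChar.circumcenter_unique (hL : AdmissibleChar (ringChar L) g) (hg : 1 < g)
    {a b c β β' : L} (hab : a ≠ b) (hac : a ≠ c) (hbc : b ≠ c)
    (h1 : (β - a) ^ (2 * g + 1) = (β - b) ^ (2 * g + 1))
    (h2 : (β - a) ^ (2 * g + 1) = (β - c) ^ (2 * g + 1))
    (h1' : (β' - a) ^ (2 * g + 1) = (β' - b) ^ (2 * g + 1))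
    (h2' : (β' - a) ^ (2 * g + 1) = (β' - c) ^ (2 * g + 1)) : β = β' := by
  have key {β : L} (h1 : (β - a) ^ (2 * g + 1) = (β - b) ^ (2 * g + 1)) : β - a ≠ 0 := by
    intro h0
    rw [h0, zero_pow (by omega), eq_comm, pow_eq_zero_iff (by omega)] at h1
    exact hab (by linear_combination h1 - h0)
  have d := key h1
  have d' := key h1'
  have p {β c : L} (d : β - a ≠ 0) (h : (β - a) ^ (2 * g + 1) = (β - c) ^ (2 * g + 1)) :
      ((β - c) / (β - a)) ^ (2 * g + 1) = 1 := by
    rw [div_pow, ← h, div_self (pow_ne_zero _ d)]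
  have q {β c : L} (d : β - a ≠ 0) (hac : a ≠ c) : (β - c) / (β - a) ≠ 1 := by
    rw [Ne, div_eq_one_iff_eq d]
    exact fun h => hac (by linear_combination h)
  have := hL.eq_of_one_sub_mul_one_sub hg (p d h1) (p d h2) (p d' h1') (p d' h2')
    (q d hab) (q d hac) (q d' hab) (q d' hac)
    (fun h => hbc (by rw [div_left_inj' d] at h; linear_combination -h))
    (by field_simp; ring)
  rw [div_eq_div_iff d d'] at this
  have h3 : (b - a) * (β - β') = 0 := by linear_combination this
  rcases mul_eq_zero.1 h3 with h | h
  · exact absurd (sub_eq_zero.1 h).symm hab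
  · exact sub_eq_zero.1 h

end Char

/-! ### Polynomial identities over the residue field -/

section Degenerate

variable {L : Type*} [Field L]

theorem coeff_X_sub_C_pow (r : L) (n k : ℕ) :
    ((X - C r) ^ n).coeff k = (-r) ^ (n - k) * (n.choose k : L) := by
  rw [sub_eq_add_neg, ← C_neg, coeff_X_add_C_pow]

/-- The polynomials `X ^ (2g+1) + s X ^ (2g)` and `(X - d) ^ (2g+1)` cannot differ by a square:
a Wronskian argument bounds the degree of the square root by one. -/
theorem X_pow_add_mul_pow_ne {g : ℕ} (hg : 1 < g) (hn : 2 * (g : L) + 1 ≠ 0) {d s : L}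
    (hd : d ≠ 0) (v : L[X]) :
    X ^ (2 * g + 1) + C s * X ^ (2 * g) ≠ (X - C d) ^ (2 * g + 1) + v ^ 2 := by
  intro h
  obtain ⟨k, rfl⟩ : ∃ k, g = k + 2 := ⟨g - 2, by omega⟩
  have hn' : (2 * (k + 2 : L) + 1) ≠ 0 := by exact_mod_cast hn
  have hs : s ≠ -d := by
    rintro rfl
    have hw : (X - C d : L[X]) ∣ v := by
      rw [dvd_iff_isRoot, IsRoot.def]
      have := congrArg (eval d) h
      simp only [eval_add, eval_mul, eval_pow, eval_X, eval_C, eval_sub, sub_self] at this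
      rw [zero_pow (by omega)] at this
      exact pow_eq_zero_iff (two_ne_zero) |>.1 (by linear_combination -this)
    obtain ⟨w, rfl⟩ := hw
    have h2 : (X - C d : L[X]) * (X ^ (2 * (k + 2)) - (X - C d) ^ (2 * (k + 2)))
        = (X - C d) * ((X - C d) * w ^ 2) := by
      rw [C_neg] at h
      linear_combination h
    have h3 := congrArg (eval d) (mul_left_cancel₀ (X_sub_C_ne_zero d) h2)
    simp at h3
    exact hd h3
  have hv0 : ¬ X ∣ v := by
    rw [X_dvd_iff, coeff_zero_eq_eval_zero]
    intro h0
    have := congrArg (eval 0) h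
    simp [h0] at this
    rw [eq_comm, pow_eq_zero_iff (by omega), neg_eq_zero] at this
    exact hd this
  have hvd : ¬ (X - C d) ∣ v := by
    rw [dvd_iff_isRoot, IsRoot.def]
    intro h0
    have := congrArg (eval d) h
    simp only [eval_add, eval_mul, eval_pow, eval_X, eval_C, eval_sub, sub_self, h0] at this
    rw [zero_pow (by omega), zero_pow two_ne_zero] at this
    have h3 : d ^ (2 * (k + 2)) * (d + s) = 0 := by linear_combination this
    rcases mul_eq_zero.1 h3 with h3 | h3
    · exact hd (pow_eq_zero_iff (by omega) |>.1 h3)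
    · exact hs (by linear_combination h3)
  -- the leading coefficients exclude the possibility that `v` is at most linear
  have key (h1 : s + (2 * (k + 2) + 1) * d = 0) (h2 : (k + 2 : L) = 0) : False := by
    rw [h2] at h1
    exact hs (by linear_combination h1)
  have hder := congrArg derivative h
  simp only [derivative_add, derivative_mul, derivative_C, derivative_pow,
    derivative_X, derivative_sub, C_eq_natCast] at hder
  push_cast at hder
  have hdvd : v ∣ (X - C d) ^ (2 * (k + 2)) * X ^ (2 * k + 3) *
      (C (s + (2 * (k + 2) + 1) * d) * X + C (2 * (k + 2) * s * d)) := by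
    refine ⟨(2 * ((k : L[X]) + 2) + 1) * (X - C d) ^ (2 * (k + 2)) * v -
      2 * (X - C d) ^ (2 * (k + 2) + 1) * derivative v, ?_⟩
    have e1 : 2 * (k + 2) - 1 = 2 * k + 3 := by omega
    rw [e1] at hder
    simp only [C_add, C_mul, map_natCast, C_1, map_ofNat]
    linear_combination (2 * ((k : L[X]) + 2) + 1) * (X - C d) ^ (2 * (k + 2)) * h -
      (X - C d) ^ (2 * (k + 2) + 1) * hder
  have hcop1 : IsCoprime v ((X - C d) ^ (2 * (k + 2)) * X ^ (2 * k + 3)) := by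
    refine IsCoprime.mul_right (IsCoprime.pow_right ?_) (IsCoprime.pow_right ?_)
    · exact ((irreducible_X_sub_C d).coprime_iff_not_dvd.2 hvd).symm
    · exact (irreducible_X.coprime_iff_not_dvd.2 hv0).symm
  have hl := hcop1.dvd_of_dvd_mul_left hdvd
  by_cases hl0 : C (s + (2 * (k + 2) + 1) * d) * X + C (2 * (k + 2) * s * d) = (0 : L[X])
  · have c1 := congrArg (fun P => coeff P 1) hl0
    have c0 := congrArg (fun P => coeff P 0) hl0
    simp [coeff_C] at c0 c1
    refine key c1 ?_
    rcases c0 with ((c0 | c0) | c0) | c0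
    · exfalso
      have : (2 * (k + 2 : L) + 1) = 1 := by rw [c0]; ring
      rw [this] at c1
      exact hs (by linear_combination c1)
    · exact c0
    · rw [c0] at c1
      simp [hd] at c1
      exact absurd c1 hn'
    · exact absurd c0 hd
  · have hvdeg : v.natDegree ≤ 1 := (natDegree_le_of_dvd hl hl0).trans natDegree_linear_le
    have hv2 : (v ^ 2).natDegree ≤ 2 := natDegree_pow_le.trans (by omega)
    have c1 := congrArg (fun P => coeff P (2 * (k + 2))) h
    have c2 := congrArg (fun P => coeff P (2 * k + 3)) h
    simp only [coeff_add, coeff_C_mul, coeff_X_pow, coeff_X_sub_C_pow] at c1 c2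
    rw [coeff_eq_zero_of_natDegree_lt (show (v ^ 2).natDegree < _ by omega)] at c1 c2
    rw [if_neg (by omega), if_pos trivial, show 2 * (k + 2) + 1 - 2 * (k + 2) = 1 by omega,
      Nat.choose_succ_self_right] at c1
    rw [if_neg (by omega), if_neg (by omega), show 2 * (k + 2) + 1 - (2 * k + 3) = 2 by omega,
      ← Nat.choose_symm (by omega), show 2 * (k + 2) + 1 - (2 * k + 3) = 2 by omega] at c2
    have hch : (2 * (k + 2) + 1).choose 2 = (k + 2) * (2 * (k + 2) + 1) := by
      rw [Nat.choose_two_right]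
      have : (2 * (k + 2) + 1) * (2 * (k + 2) + 1 - 1) = 2 * ((k + 2) * (2 * (k + 2) + 1)) := by
        rw [Nat.add_sub_cancel]; ring
      rw [this, Nat.mul_div_cancel_left _ two_pos]
    rw [hch] at c2
    push_cast at c1 c2
    refine key (by linear_combination c1) ?_
    have c3 : d ^ 2 * ((k + 2 : L) * (2 * (k + 2) + 1)) = 0 := by linear_combination -c2
    simpa [hd, hn'] using c3

theorem X_sub_C_pow_add_mul_pow_ne {g : ℕ} (hg : 1 < g) (hn : 2 * (g : L) + 1 ≠ 0) {a b s : L}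
    (hab : a ≠ b) (v : L[X]) :
    (X - C a) ^ (2 * g + 1) + C s * (X - C a) ^ (2 * g) ≠ (X - C b) ^ (2 * g + 1) + v ^ 2 := by
  intro h
  refine X_pow_add_mul_pow_ne hg hn (sub_ne_zero.2 hab.symm) (v.comp (X + C a)) (s := s) ?_
  have := congrArg (fun P => P.comp (X + C a)) h
  simp only [add_comp, pow_comp, mul_comp, sub_comp, X_comp, C_comp] at this
  rw [C_sub]
  convert this using 2 <;> ring

/-- Where `n = 2g+1` is invertible and `a ≠ b`, the polynomial `(X - a) ^ n - (X - b) ^ n` of degree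
`2g` is separable, and so a factor of degree `g > 1` of it has two different roots. -/
theorem exists_roots_of_mul_eq_sub_pow {g : ℕ} (hg : 1 < g) (hn : 2 * (g : L) + 1 ≠ 0) {a b : L}
    (hab : a ≠ b) {U S : L[X]} (hU : U.natDegree ≤ g) (hS : S.natDegree ≤ g)
    (h : (X - C a) ^ (2 * g + 1) - (X - C b) ^ (2 * g + 1) = S * U) :
    U.natDegree = g ∧ ∃ ρ ρ' : AlgebraicClosure L, ρ ≠ ρ' ∧ aeval ρ U = 0 ∧ aeval ρ' U = 0 := by
  have hcoeff : (S * U).coeff (2 * g) ≠ 0 := by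
    rw [← h, coeff_sub, coeff_X_sub_C_pow, coeff_X_sub_C_pow,
      show 2 * g + 1 - 2 * g = 1 by omega, Nat.choose_succ_self_right, ← sub_mul, pow_one, pow_one]
    refine mul_ne_zero ?_ (by exact_mod_cast hn)
    rw [neg_sub_neg]
    exact sub_ne_zero.2 hab.symm
  have hdeg : U.natDegree = g := by
    have h1 := le_natDegree_of_ne_zero hcoeff
    have h2 := natDegree_mul_le (p := S) (q := U)
    omega
  refine ⟨hdeg, ?_⟩
  have hU0 : U ≠ 0 := by rintro rfl; simp at hcoeff
  have hsep : U.Separable := by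
    refine Separable.of_dvd ?_ (Dvd.intro_left S h.symm)
    rw [separable_def]
    have hder : derivative ((X - C a) ^ (2 * g + 1) - (X - C b) ^ (2 * g + 1)) =
        C (2 * (g : L) + 1) * ((X - C a) ^ (2 * g) - (X - C b) ^ (2 * g)) := by
      simp [derivative_X_sub_C_pow]
      ring
    rw [hder]
    have hcop : IsCoprime (X - C a : L[X]) (X - C b) := isCoprime_X_sub_C_of_isUnit_sub
      (sub_ne_zero.2 hab).isUnit
    have h1 : IsCoprime ((X - C a) ^ (2 * g) - (X - C b) ^ (2 * g) : L[X])
        ((X - C b) ^ (2 * g)) := by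
      have := (hcop.pow_left (m := 2 * g)).pow_right (n := 2 * g)
      have := this.add_mul_left_left (-1)
      rwa [mul_neg_one, ← sub_eq_add_neg] at this
    have h2 : IsCoprime ((X - C a) ^ (2 * g) - (X - C b) ^ (2 * g) : L[X])
        ((X - C a) ^ (2 * g + 1) - (X - C b) ^ (2 * g + 1)) := by
      have h3 : IsCoprime ((X - C a) ^ (2 * g) - (X - C b) ^ (2 * g) : L[X])
          (C (b - a) * (X - C b) ^ (2 * g)) := by
        rwa [isCoprime_mul_unit_left_right (isUnit_C.2 (sub_ne_zero.2 hab.symm).isUnit)]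
      have := h3.add_mul_left_right (X - C a)
      have e : (X - C a : L[X]) ^ (2 * g + 1) - (X - C b) ^ (2 * g + 1) = C (b - a) *
          (X - C b) ^ (2 * g) + ((X - C a) ^ (2 * g) - (X - C b) ^ (2 * g)) * (X - C a) := by
        rw [C_sub]; ring
      rwa [e]
    rw [isCoprime_mul_unit_left_right (isUnit_C.2 hn.isUnit)]
    exact h2.symm
  have hcard := card_rootSet_eq_natDegree (K := AlgebraicClosure L) hsep (IsAlgClosed.splits _)
  rw [hdeg] at hcard
  obtain ⟨⟨ρ, hρ⟩, ⟨ρ', hρ'⟩, hne⟩ := Fintype.one_lt_card_iff.1 (hcard ▸ hg)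
  exact ⟨ρ, ρ', fun h => hne (Subtype.ext h), (mem_rootSet.1 hρ).2, (mem_rootSet.1 hρ').2⟩

end Degenerate

/-! ### Reduction modulo a valuation ring and Gauss's lemma -/

section Gauss

variable {K : Type*} [Field K] (A : ValuationSubring K)

/-- Reduction of polynomials modulo the maximal ideal of a valuation ring. -/
noncomputable abbrev red : A[X] →+* (IsLocalRing.ResidueField A)[X] :=
  mapRingHom (IsLocalRing.residue A)

/-- Polynomials over a valuation ring as polynomials over its fraction field. -/
noncomputable abbrev incl : A[X] →+* K[X] :=
  mapRingHom (algebraMap A K)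

variable {A}

theorem incl_injective : Function.Injective (incl A) :=
  map_injective _ Subtype.val_injective

theorem mem_range_incl {W : K[X]} (h : ∀ i, W.coeff i ∈ A) : ∃ V : A[X], W = incl A V := by
  have : W ∈ lifts (algebraMap A K) := by
    rw [lifts_iff_coeff_lifts]
    exact fun i => ⟨⟨_, h i⟩, rfl⟩
  obtain ⟨V, hV⟩ := (mem_lifts _).1 this
  exact ⟨V, hV.symm⟩

theorem coeff_incl_mem (V : A[X]) (i : ℕ) : (incl A V).coeff i ∈ A := by
  simp [incl]

theorem natDegree_incl (V : A[X]) : (incl A V).natDegree = V.natDegree :=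
  natDegree_map_eq_of_injective Subtype.val_injective _

theorem natDegree_red_le (V : A[X]) : (red A V).natDegree ≤ V.natDegree :=
  natDegree_map_le

theorem residue_eq_zero_of_inv_not_mem {e : A} (he : (e : K)⁻¹ ∉ A) :
    IsLocalRing.residue A e = 0 := by
  rw [IsLocalRing.residue_eq_zero_iff, IsLocalRing.mem_maximalIdeal, mem_nonunits_iff]
  intro hu
  obtain ⟨b, hb⟩ := hu.exists_right_inv
  apply he
  have : (e : K) * b = 1 := by exact_mod_cast congrArg Subtype.val hb
  rw [inv_eq_of_mul_eq_one_right this]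
  exact b.2

/-- A nonzero polynomial is a constant multiple of one with coefficients in the valuation ring and
nonzero reduction: divide by a coefficient of largest valuation. -/
theorem exists_eq_C_mul_incl {W : K[X]} (hW : W ≠ 0) :
    ∃ (e : K) (V : A[X]), e ≠ 0 ∧ W = C e * incl A V ∧ red A V ≠ 0 := by
  obtain ⟨i, hi, hmax⟩ := W.support.exists_max_image (fun i => A.valuation (W.coeff i))
    (nonempty_support_iff.2 hW)
  have he : W.coeff i ≠ 0 := mem_support_iff.1 hi
  obtain ⟨V, hV⟩ : ∃ V : A[X], C (W.coeff i)⁻¹ * W = incl A V := by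
    apply mem_range_incl
    intro j
    rw [coeff_C_mul, ← A.valuation_le_one_iff, map_mul, map_inv₀]
    by_cases hj : j ∈ W.support
    · exact inv_mul_le_one_of_le₀ (hmax j hj) zero_le
    · rw [notMem_support_iff.1 hj, map_zero, mul_zero]
      exact zero_le
  refine ⟨W.coeff i, V, he, ?_, fun h => ?_⟩
  · rw [← hV, ← mul_assoc, ← C_mul, mul_inv_cancel₀ he, C_1, one_mul]
  · have h1 : V.coeff i = 1 := by
      apply Subtype.val_injective
      have := congrArg (fun P => coeff P i) hV
      simp only [coeff_C_mul, inv_mul_cancel₀ he, incl, coe_mapRingHom, coeff_map] at this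
      exact this.symm
    have h2 := congrArg (fun P => coeff P i) h
    simp [red, h1] at h2

/-- Gauss's lemma: a polynomial with nonzero reduction is primitive. -/
theorem exists_of_mul_incl_eq_incl {W : K[X]} {P Q : A[X]} (hP : red A P ≠ 0)
    (h : W * incl A P = incl A Q) : ∃ V : A[X], W = incl A V ∧ V * P = Q := by
  suffices ∃ V : A[X], W = incl A V by
    obtain ⟨V, rfl⟩ := this
    exact ⟨V, rfl, incl_injective (by rw [map_mul, h])⟩
  by_cases hW : W = 0
  · exact ⟨0, by rw [hW, map_zero]⟩
  obtain ⟨e, V, he, rfl, hV⟩ := exists_eq_C_mul_incl (A := A) hW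
  by_cases heA : e ∈ A
  · exact ⟨C ⟨e, heA⟩ * V, by rw [map_mul]; simp [incl]⟩
  have heA' : e⁻¹ ∈ A := (A.mem_or_inv_mem e).resolve_left heA
  have h1 : V * P = C ⟨e⁻¹, heA'⟩ * Q := by
    apply incl_injective
    have : incl A (C ⟨e⁻¹, heA'⟩) = C e⁻¹ := by simp [incl]
    rw [map_mul, map_mul, ← h, this, ← mul_assoc, ← mul_assoc, ← C_mul, inv_mul_cancel₀ he, C_1,
      one_mul]
  have h2 := congrArg (red A) h1
  have h3 : red A (C ⟨e⁻¹, heA'⟩) = 0 := by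
    simp only [red, coe_mapRingHom, map_C]
    rw [residue_eq_zero_of_inv_not_mem (by simpa using heA), C_0]
  rw [map_mul, map_mul, h3, zero_mul] at h2
  exact absurd h2 (mul_ne_zero hV hP)

theorem exists_eq_incl_of_sq {W : K[X]} {Q : A[X]} (h : W ^ 2 = incl A Q) :
    ∃ V : A[X], W = incl A V := by
  by_cases hW : W = 0
  · exact ⟨0, by rw [hW, map_zero]⟩
  obtain ⟨e, V, he, rfl, hV⟩ := exists_eq_C_mul_incl (A := A) hW
  have h1 : C (e ^ 2) * incl A (V ^ 2) = incl A Q := by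
    rw [← h, map_pow (incl A), C_pow]; ring
  obtain ⟨E, hE, -⟩ := exists_of_mul_incl_eq_incl (by rw [map_pow]; exact pow_ne_zero _ hV) h1
  have h2 : e ^ 2 ∈ A := by
    have := coeff_incl_mem E 0
    rwa [← hE, coeff_C_zero] at this
  have heA : e ∈ A := by
    rw [← A.valuation_le_one_iff, map_pow] at h2
    rw [← A.valuation_le_one_iff]
    exact (pow_le_one_iff_of_nonneg zero_le two_ne_zero).1 h2
  exact ⟨C ⟨e, heA⟩ * V, by rw [map_mul]; simp [incl]⟩

end Gauss

section Valuations

variable {K : Type*} [Field K] {A : ValuationSubring K} {g : ℕ}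

open IsLocalRing

/-- If `v` is not integral at `A`, then `v` and every square root `w` of `v² + t r` have the same
leading form `U` up to sign, and so `U` divides the reduction of `r`. -/
theorem exists_red_eq_mul (h2 : (2 : ResidueField A) ≠ 0) {e t : K} (he : e ∉ A) (ht : t ∈ A)
    (ht0 : t ≠ 0) {V r : A[X]} (hV : red A V ≠ 0) {w : K[X]} (hVg : V.natDegree ≤ g)
    (hw : w.natDegree ≤ g) (h : w ^ 2 = (C e * incl A V) ^ 2 + C t * incl A r) :
    ∃ S : (ResidueField A)[X], S.natDegree ≤ g ∧ red A r = S * red A V := by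
  have he0 : e ≠ 0 := by rintro rfl; exact he A.zero_mem
  have heA' : e⁻¹ ∈ A := (A.mem_or_inv_mem e).resolve_left he
  let ε : A := ⟨e⁻¹, heA'⟩
  let τ : A := ⟨t, ht⟩
  have hε : residue A ε = 0 := residue_eq_zero_of_inv_not_mem (by simpa [ε] using he)
  have hCε : incl A (C ε) = C e⁻¹ := by simp [incl, ε]
  have hCτ : incl A (C τ) = C t := by simp [incl, τ]
  have hee : C e⁻¹ * C e = (1 : K[X]) := by rw [← C_mul, inv_mul_cancel₀ he0, C_1]
  have hW2 : (C e⁻¹ * w) ^ 2 = incl A (V ^ 2 + C ε ^ 2 * C τ * r) := by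
    simp only [map_add, map_mul, map_pow, hCε, hCτ]
    linear_combination C e⁻¹ ^ 2 * h + (incl A V) ^ 2 * (C e⁻¹ * C e + 1) * hee
  obtain ⟨W, hW⟩ := exists_eq_incl_of_sq hW2
  rw [hW, ← map_pow] at hW2
  have hW3 := incl_injective hW2
  have hdegW : W.natDegree ≤ g := by
    rw [← natDegree_incl, ← hW]
    exact (natDegree_C_mul_le _ _).trans hw
  have hredC : red A (C ε) = 0 := by simp only [red, coe_mapRingHom, map_C, hε, C_0]
  have hred : red A W ^ 2 = red A V ^ 2 := by
    rw [← map_pow, hW3]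
    simp only [map_add, map_mul, map_pow, hredC]
    ring
  have main {W : A[X]} (hdegW : W.natDegree ≤ g) (hW3 : W ^ 2 = V ^ 2 + C ε ^ 2 * C τ * r)
      (hred : red A W = red A V) : ∃ S : (ResidueField A)[X], S.natDegree ≤ g ∧
        red A r = S * red A V := by
    have hsum : red A (W + V) = C 2 * red A V := by rw [map_add, hred, C_ofNat]; ring
    have hne : red A (W + V) ≠ 0 := by
      rw [hsum]
      exact mul_ne_zero (C_ne_zero.2 h2) hV
    have hee2 : C t⁻¹ * C t = (1 : K[X]) := by rw [← C_mul, inv_mul_cancel₀ ht0, C_1]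
    have hdiv : (C (e ^ 2 * t⁻¹) * incl A (W - V)) * incl A (W + V) = incl A r := by
      have := congrArg (incl A) hW3
      simp only [map_add, map_mul, map_pow, hCε, hCτ] at this
      simp only [map_sub, map_add, C_mul, C_pow]
      linear_combination C e ^ 2 * C t⁻¹ * this + incl A r * ((C e⁻¹ * C e) ^ 2 * hee2 +
        (C e⁻¹ * C e + 1) * hee)
    obtain ⟨S, hS, hS'⟩ := exists_of_mul_incl_eq_incl hne hdiv
    refine ⟨red A S * C 2, ?_, ?_⟩
    · refine (natDegree_mul_C_le _ _).trans ((natDegree_red_le S).trans ?_)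
      rw [← natDegree_incl, ← hS]
      refine (natDegree_C_mul_le _ _).trans ?_
      rw [natDegree_incl]
      exact (natDegree_sub_le _ _).trans (max_le hdegW hVg)
    · rw [← hS', map_mul, hsum, mul_assoc]
  rcases sq_eq_sq_iff_eq_or_eq_neg.1 hred with h | h
  · exact main hdegW hW3 h
  · exact main (W := -W) (by rwa [natDegree_neg]) (by linear_combination hW3)
      (by rw [map_neg, h, neg_neg])

/-- The polynomial `((X - a) ^ (2g+1) - (X - c) ^ (2g+1)) / (c - a)`. -/
theorem exists_sub_pow_eq (a c : A) : ∃ ρ : A[X],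
    (X - C a) ^ (2 * g + 1) - (X - C c) ^ (2 * g + 1) = C (c - a) * ρ ∧
      (residue A c = residue A a → red A ρ =
        C (2 * (g : ResidueField A) + 1) * (X - C (residue A a)) ^ (2 * g)) := by
  refine ⟨∑ i ∈ Finset.range (2 * g + 1), (X - C a) ^ i * (X - C c) ^ (2 * g + 1 - 1 - i), ?_, ?_⟩
  · rw [← (Commute.all _ _).mul_geom_sum₂, C_sub]
    ring
  · intro h
    rw [map_sum]
    simp only [map_mul, map_pow, map_sub, red, coe_mapRingHom, map_X, map_C, h]
    rw [Finset.sum_congr rfl (g := fun _ => (X - C (residue A a)) ^ (2 * g))]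
    · simp only [Finset.sum_const, Finset.card_range, nsmul_eq_mul, C_add, C_mul, C_1, C_ofNat,
        map_natCast]
      push_cast
      ring
    · intro i hi
      rw [← pow_add]
      congr 1
      have := Finset.mem_range.1 hi
      omega

variable (hg : 1 < g) (hκ : AdmissibleChar (ringChar (ResidueField A)) g)
include hg hκ

/-- Of three solutions of `(X - aᵢ) ^ (2g+1) + vᵢ² = f` with `aᵢ` in `A`, the first has `v₁`
integral at `A` if `a₁, a₂` and `a₂, a₃` remain distinct modulo the maximal ideal. Otherwise the
leading form `U` of `v₁` has two different roots, each of which is a circumcenter of the reductions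
of the `aᵢ`; if `a₁` and `a₃` have the same reduction, then `U` is a power of `X - a₁`, although
`U(a₁) ≠ 0`. -/
theorem exists_eq_incl_of_residue_ne {a b c : A} (hab : residue A a ≠ residue A b)
    (hbc : residue A b ≠ residue A c) (hac : a ≠ c) {v₁ v₂ v₃ : K[X]}
    (d₁ : v₁.natDegree ≤ g) (d₂ : v₂.natDegree ≤ g) (d₃ : v₃.natDegree ≤ g)
    (h₂ : v₂ ^ 2 = v₁ ^ 2 + incl A ((X - C a) ^ (2 * g + 1) - (X - C b) ^ (2 * g + 1)))
    (h₃ : v₃ ^ 2 = v₁ ^ 2 + incl A ((X - C a) ^ (2 * g + 1) - (X - C c) ^ (2 * g + 1))) :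
    ∃ V : A[X], v₁ = incl A V := by
  by_contra hv
  have two := hκ.two_ne_zero
  have hn := hκ.cast_ne_zero hg
  have hv0 : v₁ ≠ 0 := by rintro rfl; exact hv ⟨0, by simp⟩
  obtain ⟨e, V, he0, rfl, hV⟩ := exists_eq_C_mul_incl (A := A) hv0
  have he : e ∉ A := fun heA => hv ⟨C ⟨e, heA⟩ * V, by rw [map_mul]; simp [incl]⟩
  have dV : V.natDegree ≤ g := by
    rwa [natDegree_C_mul he0, natDegree_incl] at d₁
  have dU : (red A V).natDegree ≤ g := (natDegree_red_le V).trans dV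
  obtain ⟨S, dS, hS⟩ := exists_red_eq_mul two he A.one_mem one_ne_zero hV dV d₂
    (by rw [h₂, C_1, one_mul])
  have hr (x y : A) : red A ((X - C x) ^ (2 * g + 1) - (X - C y) ^ (2 * g + 1)) =
      (X - C (residue A x)) ^ (2 * g + 1) - (X - C (residue A y)) ^ (2 * g + 1) := by
    simp [red]
  rw [hr] at hS
  obtain ⟨degU, ρ, ρ', hne, hρ, hρ'⟩ := exists_roots_of_mul_eq_sub_pow hg hn hab dU dS hS
  by_cases hac' : residue A a = residue A c
  · obtain ⟨r, hr1, hr2⟩ := exists_sub_pow_eq (g := g) a c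
    have hca : (c : K) - a ≠ 0 := sub_ne_zero.2 fun h => hac (Subtype.ext h.symm)
    obtain ⟨S', -, hS'⟩ := exists_red_eq_mul two he (sub_mem c.2 a.2) hca hV dV d₃
      (r := r) (by rw [h₃, hr1, map_mul]; simp [incl])
    rw [hr2 hac'.symm] at hS'
    have hcop : IsCoprime (red A V)
        (C (2 * (g : ResidueField A) + 1) * (X - C (residue A a)) ^ (2 * g)) := by
      rw [isCoprime_mul_unit_left_right (isUnit_C.2 hn.isUnit)]
      refine IsCoprime.pow_right ((irreducible_X_sub_C _).coprime_iff_not_dvd.2 ?_).symm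
      rw [dvd_iff_isRoot, IsRoot.def]
      intro h0
      have := congrArg (eval (residue A a)) hS
      simp only [eval_sub, eval_pow, eval_X, eval_C, sub_self, eval_mul, h0] at this
      rw [zero_pow (by omega), zero_sub, mul_zero, neg_eq_zero, pow_eq_zero_iff (by omega)] at this
      exact hab (sub_eq_zero.1 this)
    have hu := hcop.isUnit_of_dvd' dvd_rfl (Dvd.intro_left S' hS'.symm)
    have := natDegree_eq_zero_of_isUnit hu
    omega
  · obtain ⟨S', -, hS'⟩ := exists_red_eq_mul two he A.one_mem one_ne_zero hV dV d₃
      (by rw [h₃, C_1, one_mul])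
    rw [hr] at hS'
    let φ := algebraMap (ResidueField A) (AlgebraicClosure (ResidueField A))
    have hφ : Function.Injective φ := φ.injective
    have hchar : AdmissibleChar (ringChar (AlgebraicClosure (ResidueField A))) g := by
      rwa [← Algebra.ringChar_eq (ResidueField A)]
    have ev {S : (ResidueField A)[X]} {y : A} {ρ : AlgebraicClosure (ResidueField A)}
        (hS : (X - C (residue A a)) ^ (2 * g + 1) - (X - C (residue A y)) ^ (2 * g + 1)
          = S * red A V) (hρ : aeval ρ (red A V) = 0) :
        (ρ - φ (residue A a)) ^ (2 * g + 1) = (ρ - φ (residue A y)) ^ (2 * g + 1) := by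
      have := congrArg (aeval ρ) hS
      rw [map_mul, hρ, mul_zero] at this
      simpa [sub_eq_zero] using this
    exact hne (hchar.circumcenter_unique hg (hφ.ne hab) (hφ.ne hac') (hφ.ne hbc)
      (ev hS hρ) (ev hS' hρ) (ev hS hρ') (ev hS' hρ'))

/-- If all three `vᵢ` are integral and `a₁ - a₂` is a unit, then so is `a₁ - a₃`: if `a₁` and `a₃`
came together, the reduction of `v₁` would be a multiple of `(X - a₁) ^ g`. -/
theorem residue_ne_of_eq_incl {a b c : A} (hab : residue A a ≠ residue A b)
    (hac : a ≠ c) {V₁ V₂ V₃ : A[X]} (d₁ : V₁.natDegree ≤ g) (d₃ : V₃.natDegree ≤ g)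
    (h₂ : V₂ ^ 2 = V₁ ^ 2 + ((X - C a) ^ (2 * g + 1) - (X - C b) ^ (2 * g + 1)))
    (h₃ : V₃ ^ 2 = V₁ ^ 2 + ((X - C a) ^ (2 * g + 1) - (X - C c) ^ (2 * g + 1))) :
    residue A a ≠ residue A c := by
  intro hac'
  have two := hκ.two_ne_zero
  have hn := hκ.cast_ne_zero hg
  have hr (x y : A) : red A ((X - C x) ^ (2 * g + 1) - (X - C y) ^ (2 * g + 1)) =
      (X - C (residue A x)) ^ (2 * g + 1) - (X - C (residue A y)) ^ (2 * g + 1) := by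
    simp [red]
  -- the reduction of `v₁` is a multiple of `(X - a) ^ g`
  have hU : ∃ s : ResidueField A, red A V₁ ^ 2 = C s * (X - C (residue A a)) ^ (2 * g) := by
    by_cases hV : red A V₁ = 0
    · exact ⟨0, by simp [hV]⟩
    obtain ⟨r, hr1, hr2⟩ := exists_sub_pow_eq (g := g) a c
    have hca : (c : K) - a ≠ 0 := sub_ne_zero.2 fun h => hac (Subtype.ext h.symm)
    have hC : C ((c : K) - a)⁻¹ * C ((c : K) - a) = (1 : K[X]) := by
      rw [← C_mul, inv_mul_cancel₀ hca, C_1]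
    have hCi : incl A (C (c - a)) = C ((c : K) - a) := by simp [incl]
    have main {V₃ : A[X]} (d₃ : V₃.natDegree ≤ g)
        (h₃ : V₃ ^ 2 = V₁ ^ 2 + ((X - C a) ^ (2 * g + 1) - (X - C c) ^ (2 * g + 1)))
        (hred : red A V₃ = red A V₁) :
        ∃ s : ResidueField A, red A V₁ ^ 2 = C s * (X - C (residue A a)) ^ (2 * g) := by
      have hsum : red A (V₃ + V₁) = C 2 * red A V₁ := by rw [map_add, hred, C_ofNat]; ring
      have hne : red A (V₃ + V₁) ≠ 0 := by
        rw [hsum]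
        exact mul_ne_zero (C_ne_zero.2 two) hV
      have hdiv : (C ((c : K) - a)⁻¹ * incl A (V₃ - V₁)) * incl A (V₃ + V₁) = incl A r := by
        rw [hr1] at h₃
        have := congrArg (incl A) h₃
        rw [map_add, map_mul, hCi, map_pow, map_pow] at this
        rw [map_sub, map_add]
        linear_combination C ((c : K) - a)⁻¹ * this + incl A r * hC
      obtain ⟨S, hS, hS'⟩ := exists_of_mul_incl_eq_incl hne hdiv
      have dS : (red A S).natDegree ≤ g := by
        refine (natDegree_red_le S).trans ?_
        rw [← natDegree_incl, ← hS]
        refine (natDegree_C_mul_le _ _).trans ?_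
        rw [natDegree_incl]
        exact (natDegree_sub_le _ _).trans (max_le d₃ d₁)
      have h1 := congrArg (red A) hS'
      rw [map_mul, hsum, hr2 hac'.symm] at h1
      have hdvd : red A V₁ ∣ (X - C (residue A a)) ^ (2 * g) := by
        rw [← IsUnit.dvd_mul_left (isUnit_C.2 hn.isUnit), ← h1]
        exact ⟨red A S * C 2, by ring⟩
      obtain ⟨j, -, u, hu⟩ := (dvd_prime_pow (prime_X_sub_C _) _).1 hdvd
      obtain ⟨γ, hγ, hγu⟩ := isUnit_iff.1 u⁻¹.isUnit
      have hV1 : red A V₁ = C γ * (X - C (residue A a)) ^ j := by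
        rw [hγu, ← hu]
        rw [mul_comm, mul_assoc, Units.mul_inv, mul_one]
      have hdeg := congrArg natDegree h1
      have hS0 : red A S ≠ 0 := by
        intro h0
        rw [h0, zero_mul] at h1
        exact mul_ne_zero (C_ne_zero.2 hn) (pow_ne_zero _ (X_sub_C_ne_zero _)) h1.symm
      rw [natDegree_C_mul hn, natDegree_pow, natDegree_X_sub_C,
        natDegree_mul hS0 (mul_ne_zero (C_ne_zero.2 two) hV), natDegree_C_mul two] at hdeg
      have hj : (red A V₁).natDegree = j := by
        rw [hV1, natDegree_C_mul hγ.ne_zero, natDegree_pow, natDegree_X_sub_C, mul_one]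
      have dV := (natDegree_red_le V₁).trans d₁
      have hjg : j = g := by omega
      refine ⟨γ ^ 2, ?_⟩
      rw [hV1, hjg, C_pow]
      ring
    have hred : red A V₃ ^ 2 = red A V₁ ^ 2 := by
      rw [← map_pow, h₃, map_add, hr, hac', sub_self, add_zero, map_pow]
    rcases sq_eq_sq_iff_eq_or_eq_neg.1 hred with h | h
    · exact main d₃ h₃ h
    · exact main (V₃ := -V₃) (by rwa [natDegree_neg]) (by linear_combination h₃)
        (by rw [map_neg, h, neg_neg])
  obtain ⟨s, hs⟩ := hU
  refine X_sub_C_pow_add_mul_pow_ne hg hn hab (red A V₂) (s := s) ?_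
  rw [← map_pow, h₂, map_add, hr, map_pow, hs]
  ring

end Valuations

/-! ### Integrality over the prime field -/

section Descent

variable {K : Type*} [Field K] {g : ℕ}

open IsLocalRing

/-- A valuation ring that contains the inverses of all integers contains the prime field, so that
its residue field has the characteristic of `K`. -/
theorem ringChar_residueField (A : ValuationSubring K) (hA : ∀ n : ℕ, (n : K)⁻¹ ∈ A) :
    ringChar (ResidueField A) = ringChar K := by
  refine ringChar.eq_iff.2 ⟨fun n => ?_⟩
  rw [← ringChar.spec]
  constructor
  · intro h
    by_contra hn
    have h1 : ((n : A) : K) = n := by simp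
    have h2 : residue A ((n : A) * ⟨(n : K)⁻¹, hA n⟩) = 0 := by
      rw [map_mul, map_natCast, h, zero_mul]
    have h3 : (n : A) * ⟨(n : K)⁻¹, hA n⟩ = 1 := Subtype.ext (by simp [mul_inv_cancel₀ hn])
    rw [h3, map_one] at h2
    exact one_ne_zero h2
  · intro h
    have : (n : A) = 0 := Subtype.ext (by simpa using h)
    rw [← map_natCast (residue A), this, map_zero]

/-- For three solutions of `(X - aᵢ) ^ (2g+1) + vᵢ² = f` with `a₁ - a₂` a unit of `A` and `a₃` in `A`,
also `a₁ - a₃` is a unit, and `v₁` is integral. -/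
theorem exists_eq_incl_and_residue_ne (hg : 1 < g) (hK : AdmissibleChar (ringChar K) g)
    (A : ValuationSubring K) (hA : ∀ n : ℕ, (n : K)⁻¹ ∈ A) {a b c : A}
    (hab : residue A a ≠ residue A b) (hac : a ≠ c) (hbc : b ≠ c)
    {v₁ v₂ v₃ f : K[X]}
    (d₁ : v₁.natDegree ≤ g) (d₂ : v₂.natDegree ≤ g) (d₃ : v₃.natDegree ≤ g)
    (h₁ : (X - C (a : K)) ^ (2 * g + 1) + v₁ ^ 2 = f)
    (h₂ : (X - C (b : K)) ^ (2 * g + 1) + v₂ ^ 2 = f)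
    (h₃ : (X - C (c : K)) ^ (2 * g + 1) + v₃ ^ 2 = f) :
    (∃ V : A[X], v₁ = incl A V) ∧ residue A a ≠ residue A c := by
  have hκ : AdmissibleChar (ringChar (ResidueField A)) g := by rwa [ringChar_residueField A hA]
  have hi (x y : A) : incl A ((X - C x) ^ (2 * g + 1) - (X - C y) ^ (2 * g + 1)) =
      (X - C (x : K)) ^ (2 * g + 1) - (X - C (y : K)) ^ (2 * g + 1) := by
    simp [incl]
  have lift_of {V : A[X]} {v : K[X]} {r : A[X]} (h : v ^ 2 = incl A V ^ 2 + incl A r) :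
      ∃ W : A[X], v = incl A W :=
    exists_eq_incl_of_sq (by rw [h, ← map_pow, ← map_add])
  have key {a b c : A} {v₁ v₂ v₃ : K[X]} (hab : residue A a ≠ residue A b)
      (hac : a ≠ c) (hbc : residue A b ≠ residue A c)
      (d₁ : v₁.natDegree ≤ g) (d₂ : v₂.natDegree ≤ g) (d₃ : v₃.natDegree ≤ g)
      (h₁ : (X - C (a : K)) ^ (2 * g + 1) + v₁ ^ 2 = f)
      (h₂ : (X - C (b : K)) ^ (2 * g + 1) + v₂ ^ 2 = f)
      (h₃ : (X - C (c : K)) ^ (2 * g + 1) + v₃ ^ 2 = f) :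
      (∃ V : A[X], v₁ = incl A V) ∧ residue A a ≠ residue A c := by
    have e₂ : v₂ ^ 2 = v₁ ^ 2 + incl A ((X - C a) ^ (2 * g + 1) - (X - C b) ^ (2 * g + 1)) := by
      rw [hi]; linear_combination h₂ - h₁
    have e₃ : v₃ ^ 2 = v₁ ^ 2 + incl A ((X - C a) ^ (2 * g + 1) - (X - C c) ^ (2 * g + 1)) := by
      rw [hi]; linear_combination h₃ - h₁
    obtain ⟨V₁, rfl⟩ := exists_eq_incl_of_residue_ne hg hκ hab hbc hac d₁ d₂ d₃ e₂ e₃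
    obtain ⟨V₂, rfl⟩ := lift_of e₂
    obtain ⟨V₃, rfl⟩ := lift_of e₃
    rw [natDegree_incl] at d₁ d₃
    refine ⟨⟨V₁, rfl⟩, residue_ne_of_eq_incl hg hκ hab hac d₁ d₃ (V₂ := V₂) (V₃ := V₃) ?_ ?_⟩
    · apply incl_injective
      rw [map_pow, e₂, map_add, map_pow]
    · apply incl_injective
      rw [map_pow, e₃, map_add, map_pow]
  by_cases hbc' : residue A b = residue A c
  · exact absurd hbc' (key hab.symm hbc (hbc' ▸ hab) d₂ d₁ d₃ h₂ h₁ h₃).2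
  · exact key hab hac hbc' d₁ d₂ d₃ h₁ h₂ h₃

/-- Effect of the substitution `X ↦ δ X + α` on solutions of `(X - a) ^ (2g+1) + v ^ 2 = f`. -/
theorem affine_substitution {α δ μ a : K} (hδ : δ ≠ 0) (hμ : μ ^ 2 = δ ^ (2 * g + 1)) {v f : K[X]}
    (h : (X - C a) ^ (2 * g + 1) + v ^ 2 = f) :
    (X - C ((a - α) / δ)) ^ (2 * g + 1) + (C μ⁻¹ * v.comp (C δ * X + C α)) ^ 2 =
      C (δ ^ (2 * g + 1))⁻¹ * f.comp (C δ * X + C α) := by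
  have h1 : C δ * (X - C ((a - α) / δ)) = C δ * X + C α - C a := by
    rw [mul_sub, ← C_mul, mul_div_cancel₀ _ hδ, C_sub]
    ring
  have hd : δ ^ (2 * g + 1) ≠ 0 := pow_ne_zero _ hδ
  have h2 : (C (δ ^ (2 * g + 1))⁻¹ : K[X]) * C δ ^ (2 * g + 1) = 1 := by
    rw [← C_pow, ← C_mul, inv_mul_cancel₀ hd, C_1]
  have h3 : (C μ⁻¹ : K[X]) ^ 2 = C (δ ^ (2 * g + 1))⁻¹ := by
    rw [← C_pow, inv_pow, hμ]
  rw [← h, add_comp, pow_comp, pow_comp, sub_comp, X_comp, C_comp, ← h1, mul_pow, mul_pow, h3]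
  linear_combination -(X - C ((a - α) / δ)) ^ (2 * g + 1) * h2

theorem natDegree_affine_le {α δ μ : K} {v : K[X]} (h : v.natDegree ≤ g) :
    (C μ * v.comp (C δ * X + C α)).natDegree ≤ g := by
  refine (natDegree_C_mul_le _ _).trans (natDegree_comp_le.trans ?_)
  exact (Nat.mul_le_mul h natDegree_linear_le).trans (by omega)

theorem mem_bot_of_inv (n : ℕ) : ((n : K)⁻¹) ∈ (⊥ : Subfield K) :=
  inv_mem (natCast_mem _ n)

/-- The algebraic closure of the prime field in `K` is the intersection of the valuation rings of
`K` that contain the prime field. -/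
theorem isIntegral_of_forall_valuationSubring {z : K}
    (h : ∀ A : ValuationSubring K, (∀ n : ℕ, (n : K)⁻¹ ∈ A) → z ∈ A) :
    IsIntegral (⊥ : Subfield K) z := by
  let R : Subalgebra (⊥ : Subfield K) K := integralClosure (⊥ : Subfield K) K
  by_contra hz
  have : IsIntegrallyClosedIn R.toSubring K :=
    inferInstanceAs (IsIntegrallyClosedIn (integralClosure (⊥ : Subfield K) K) K)
  obtain ⟨V, hV, hzV⟩ := Subring.exists_le_valuationSubring_of_isIntegrallyClosedIn
    (R := R.toSubring) (x := z) hz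
  refine hzV (h V fun n => hV ?_)
  exact (isIntegral_algebraMap : IsIntegral (⊥ : Subfield K)
    (algebraMap (⊥ : Subfield K) K ⟨_, mem_bot_of_inv n⟩))

/-- If `f = (X - a) ^ (2g+1) + v ^ 2` with `deg v ≤ g` has three solutions with distinct `a`, then
an affine substitution and a rescaling make the coefficients of `f` algebraic over the prime
field. -/
theorem exists_affine_isIntegral [IsAlgClosed K] (hg : 1 < g)
    (hK : AdmissibleChar (ringChar K) g)
    {a b c : K} (hab : a ≠ b) (hac : a ≠ c) (hbc : b ≠ c) {v₁ v₂ v₃ f : K[X]}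
    (d₁ : v₁.natDegree ≤ g) (d₂ : v₂.natDegree ≤ g) (d₃ : v₃.natDegree ≤ g)
    (h₁ : (X - C a) ^ (2 * g + 1) + v₁ ^ 2 = f)
    (h₂ : (X - C b) ^ (2 * g + 1) + v₂ ^ 2 = f)
    (h₃ : (X - C c) ^ (2 * g + 1) + v₃ ^ 2 = f) :
    ∃ α δ : K, δ ≠ 0 ∧ ∀ i, IsIntegral (⊥ : Subfield K)
      ((C (δ ^ (2 * g + 1))⁻¹ * f.comp (C δ * X + C α)).coeff i) := by
  have hδ : b - a ≠ 0 := sub_ne_zero.2 hab.symm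
  refine ⟨a, b - a, hδ, ?_⟩
  obtain ⟨μ, hμ⟩ := IsAlgClosed.exists_pow_nat_eq ((b - a) ^ (2 * g + 1)) two_pos
  have k₁ := affine_substitution (α := a) hδ hμ h₁
  have k₂ := affine_substitution (α := a) hδ hμ h₂
  have k₃ := affine_substitution (α := a) hδ hμ h₃
  have m₁ := natDegree_affine_le (α := a) (δ := b - a) (μ := μ⁻¹) d₁
  have m₂ := natDegree_affine_le (α := a) (δ := b - a) (μ := μ⁻¹) d₂
  have m₃ := natDegree_affine_le (α := a) (δ := b - a) (μ := μ⁻¹) d₃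
  rw [sub_self, zero_div] at k₁
  rw [div_self hδ] at k₂
  set x := (c - a) / (b - a)
  have hx0 : x ≠ 0 := div_ne_zero (sub_ne_zero.2 hac.symm) hδ
  have hx1 : x ≠ 1 := by
    rw [Ne, div_eq_one_iff_eq hδ]
    exact fun h => hbc (by linear_combination -h)
  set w₁ := C μ⁻¹ * v₁.comp (C (b - a) * X + C a)
  set w₂ := C μ⁻¹ * v₂.comp (C (b - a) * X + C a)
  set w₃ := C μ⁻¹ * v₃.comp (C (b - a) * X + C a)
  set F := C ((b - a) ^ (2 * g + 1))⁻¹ * f.comp (C (b - a) * X + C a)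
  clear_value F w₁ w₂ w₃ x
  have one_ne (A : ValuationSubring K) : residue A 0 ≠ residue A 1 := by simp
  refine fun i => isIntegral_of_forall_valuationSubring fun A hA => ?_
  -- otherwise the normalization that sends `a, c` to `0, 1` would make `b` reduce to `0`
  have hxA : x ∈ A := by
    by_contra hxA
    have hxA' : x⁻¹ ∈ A := (A.mem_or_inv_mem x).resolve_left hxA
    obtain ⟨ν, hν⟩ := IsAlgClosed.exists_pow_nat_eq (x ^ (2 * g + 1)) two_pos
    have l₁ := affine_substitution (α := 0) hx0 hν k₁
    have l₂ := affine_substitution (α := 0) hx0 hν k₂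
    have l₃ := affine_substitution (α := 0) hx0 hν k₃
    rw [sub_self, zero_div] at l₁
    rw [sub_zero, one_div] at l₂
    rw [sub_zero, div_self hx0] at l₃
    have := (exists_eq_incl_and_residue_ne hg hK A hA (a := 0) (b := 1) (c := ⟨x⁻¹, hxA'⟩)
      (one_ne A) (fun h => inv_ne_zero hx0 (congrArg Subtype.val h).symm)
      (fun h => hx1 (inv_eq_one.1 (congrArg Subtype.val h).symm))
      (natDegree_affine_le m₁) (natDegree_affine_le m₃) (natDegree_affine_le m₂) l₁ l₃ l₂).2
    rw [map_zero] at this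
    exact this (residue_eq_zero_of_inv_not_mem (by simpa using hxA)).symm
  obtain ⟨V, hV⟩ := (exists_eq_incl_and_residue_ne hg hK A hA (a := 0) (b := 1) (c := ⟨x, hxA⟩)
      (one_ne A) (fun h => hx0 (congrArg Subtype.val h).symm)
      (fun h => hx1 (congrArg Subtype.val h).symm) m₁ m₂ m₃ k₁ k₂ k₃).1
  have hF : F = incl A (X ^ (2 * g + 1) + V ^ 2) := by
    rw [← k₁, hV]
    simp [incl]
  rw [hF]
  exact coeff_incl_mem _ i

end Descent

/-! ### Points and local parameters -/

section Points

variable {K F : Type*} [Field K] [Field F] [Algebra K F]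

namespace Point

theorem ext_localRing {P Q : Point K F} (h : P.localRing = Q.localRing) : P = Q := by
  cases P; cases Q; cases h; rfl

theorem mem_localRing_iff (P : Point K F) (f : F) : f ∈ P.localRing ↔ P.valuation f ≤ 1 := by
  have := P.isDVR
  constructor
  · intro h
    exact (IsDiscreteValuationRing.maximalIdeal P.localRing).valuation_le_one (K := F) ⟨f, h⟩
  · intro h
    obtain ⟨a, rfl⟩ := IsDiscreteValuationRing.exists_lift_of_le_one h
    exact a.2

theorem isEquiv (P : Point K F) : P.valuation.IsEquiv P.localRing.valuation := by
  have : P.localRing = P.valuation.valuationSubring := by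
    ext f
    rw [mem_localRing_iff, Valuation.mem_valuationSubring_iff]
  rw [this]
  exact Valuation.isEquiv_valuation_valuationSubring _

theorem ord_nonneg_iff (P : Point K F) {f : F} (hf : f ≠ 0) : 0 ≤ P.ord f ↔ f ∈ P.localRing := by
  have h : P.valuation f ≠ 0 := (Valuation.ne_zero_iff _).2 hf
  rw [mem_localRing_iff, ord, ← WithZero.exp_zero, ← WithZero.log_le_iff_le_exp h]
  omega

theorem ord_pos_iff (P : Point K F) {f : F} (hf : f ≠ 0) :
    0 < P.ord f ↔ P.localRing.valuation f < 1 := by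
  have h : P.valuation f ≠ 0 := (Valuation.ne_zero_iff _).2 hf
  rw [← P.isEquiv.lt_one_iff_lt_one, ord, ← WithZero.exp_zero, ← WithZero.log_lt_iff_lt_exp h]
  omega

theorem ord_eq_zero_iff (P : Point K F) {f : F} (hf : f ≠ 0) :
    P.ord f = 0 ↔ P.localRing.valuation f = 1 := by
  have h1 := P.ord_pos_iff hf
  have h2 := P.ord_nonneg_iff hf
  rw [← ValuationSubring.valuation_le_one_iff] at h2
  constructor
  · intro h
    exact le_antisymm (h2.1 h.ge) (not_lt.1 fun h' => (h1.2 h').ne' h)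
  · intro h
    exact le_antisymm (not_lt.1 fun h' => (h1.1 h').ne h) (h2.2 h.le)

theorem ord_pow (P : Point K F) {f : F} (hf : f ≠ 0) (n : ℕ) : P.ord (f ^ n) = n * P.ord f := by
  induction n with
  | zero => simp [P.ord_one]
  | succ n ih =>
    rw [pow_succ, P.ord_mul (pow_ne_zero _ hf) hf, ih]
    push_cast; ring

theorem ord_zpow (P : Point K F) {f : F} (hf : f ≠ 0) (n : ℤ) : P.ord (f ^ n) = n * P.ord f := by
  cases n with
  | ofNat n => simpa using P.ord_pow hf n
  | negSucc n =>
    rw [zpow_negSucc, P.ord_inv, P.ord_pow hf, Int.negSucc_eq]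
    push_cast; ring

theorem exists_ord_eq_one (P : Point K F) : ∃ t : F, t ≠ 0 ∧ P.ord t = 1 := by
  have := P.isDVR
  obtain ⟨t, ht⟩ := (IsDiscreteValuationRing.maximalIdeal P.localRing).valuation_exists_uniformizer F
  have h0 : t ≠ 0 := by
    rintro rfl
    rw [map_zero] at ht
    exact WithZero.exp_ne_zero ht.symm
  refine ⟨t, h0, ?_⟩
  rw [ord, show P.valuation t = _ from ht]
  simp

/-- The image of a point under an automorphism of the curve. -/
def comap (P : Point K F) (ι : F ≃ₐ[K] F) : Point K F where
  localRing := P.localRing.comap (ι : F →+* F)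
  algebraMap_mem c := by
    rw [ValuationSubring.mem_comap]
    simpa using P.algebraMap_mem c
  isDVR := by
    have := P.isDVR
    let e : P.localRing ≃+* P.localRing.comap (ι : F →+* F) :=
      { toFun := fun f => ⟨ι.symm f, by
          rw [ValuationSubring.mem_comap]
          simp⟩
        invFun := fun f => ⟨ι f, ValuationSubring.mem_comap.1 f.2⟩
        left_inv := fun f => by ext; simp
        right_inv := fun f => by ext; simp
        map_mul' := fun f h => by ext; simp
        map_add' := fun f h => by ext; simp }
    exact IsDiscreteValuationRing.RingEquivClass.isDiscreteValuationRing e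

theorem mem_comap (P : Point K F) (ι : F ≃ₐ[K] F) (f : F) :
    f ∈ (P.comap ι).localRing ↔ ι f ∈ P.localRing :=
  Iff.rfl

theorem comap_valuation_lt_one_iff (P : Point K F) (ι : F ≃ₐ[K] F) (f : F) :
    (P.comap ι).localRing.valuation f < 1 ↔ P.localRing.valuation (ι f) < 1 := by
  rw [← ValuationSubring.mem_nonunits_iff, ← ValuationSubring.mem_nonunits_iff,
    ValuationSubring.mem_nonunits_iff_or, ValuationSubring.mem_nonunits_iff_or, mem_comap, map_inv₀]
  simp

end Point

end Points

section Model

variable {K F : Type*} [Field K] [Field F] [Algebra K F]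

/-- The curve has the affine equation `y² = f(x)`, and `ι` is its hyperelliptic involution
`(x, y) ↦ (x, -y)`. That `F = K(x, y)` is expressed by writing each element as a quotient of an
element `A(x) + B(x) y` by a polynomial `C(x)`. -/
structure HyperellipticModel (ι : F ≃ₐ[K] F) (x y : F) (f : K[X]) : Prop where
  transcendental : Transcendental K x
  map_x : ι x = x
  map_y : ι y = -y
  y_sq : y ^ 2 = aeval x f
  y_ne_zero : y ≠ 0
  exists_eq : ∀ h : F, ∃ A B C : K[X], C ≠ 0 ∧ h * aeval x C = aeval x A + aeval x B * y

/-- The center of the valuation ring `V` on the affine curve is the point `(a, c)`. -/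
structure IsCenter (x y : F) (V : ValuationSubring F) (a c : K) : Prop where
  algebraMap_mem : ∀ r : K, algebraMap K F r ∈ V
  x_lt : V.valuation (x - algebraMap K F a) < 1
  y_lt : V.valuation (y - algebraMap K F c) < 1

theorem valuation_algebraMap_eq_one {V : ValuationSubring F} (hV : ∀ r : K, algebraMap K F r ∈ V)
    {c : K} (hc : c ≠ 0) : V.valuation (algebraMap K F c) = 1 := by
  refine le_antisymm ((V.valuation_le_one_iff _).2 (hV c)) ?_
  have := (V.valuation_le_one_iff _).2 (hV c⁻¹)
  rwa [map_inv₀, map_inv₀, inv_le_one₀] at this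
  rw [zero_lt_iff, Valuation.ne_zero_iff]
  exact (_root_.map_ne_zero _).2 hc

section Aeval

variable {V : ValuationSubring F} (hV : ∀ r : K, algebraMap K F r ∈ V) {x : F}

include hV

theorem mem_of_valuation_sub_lt {a : K} (hx : V.valuation (x - algebraMap K F a) < 1) :
    x ∈ V := by
  have := V.add_mem _ _ ((V.valuation_le_one_iff _).1 hx.le) (hV a)
  rwa [sub_add_cancel] at this

theorem aeval_mem (hx : x ∈ V) (A : K[X]) : aeval x A ∈ V := by
  rw [aeval_eq_sum_range]
  refine sum_mem fun i _ => ?_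
  rw [Algebra.smul_def]
  exact mul_mem (hV _) (pow_mem hx _)

theorem valuation_aeval_sub_lt {a : K} (hx : V.valuation (x - algebraMap K F a) < 1) (A : K[X]) :
    V.valuation (aeval x A - algebraMap K F (A.eval a)) < 1 := by
  obtain ⟨B, hB⟩ := X_sub_C_dvd_sub_C_eval (a := a) (p := A)
  have := congrArg (aeval x) hB
  simp only [map_sub, map_mul, aeval_C, aeval_X] at this
  rw [this, map_mul]
  exact mul_lt_one_of_lt_of_le hx
    ((V.valuation_le_one_iff _).2 (aeval_mem hV (mem_of_valuation_sub_lt hV hx) B))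

theorem valuation_eq_one_of_sub_lt {z : F} {c : K} (hc : c ≠ 0)
    (hz : V.valuation (z - algebraMap K F c) < 1) : V.valuation z = 1 := by
  have h1 := valuation_algebraMap_eq_one hV hc
  have := V.valuation.map_add_eq_of_lt_left (hz.trans_eq h1.symm)
  rwa [add_sub_cancel, h1] at this

theorem valuation_aeval_eq_one {a : K} (hx : V.valuation (x - algebraMap K F a) < 1) {A : K[X]}
    (hA : A.eval a ≠ 0) : V.valuation (aeval x A) = 1 :=
  valuation_eq_one_of_sub_lt hV hA (valuation_aeval_sub_lt hV hx A)

theorem valuation_aeval {a : K} (hx : V.valuation (x - algebraMap K F a) < 1) {A : K[X]}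
    (hA : A ≠ 0) :
    V.valuation (aeval x A) = V.valuation (x - algebraMap K F a) ^ (A.rootMultiplicity a) := by
  obtain ⟨B, hB, hB'⟩ := exists_eq_pow_rootMultiplicity_mul_and_not_dvd A hA a
  rw [dvd_iff_isRoot, IsRoot.def] at hB'
  conv_lhs => rw [hB]
  rw [map_mul, map_mul, valuation_aeval_eq_one hV hx hB', mul_one]
  simp

end Aeval

namespace HyperellipticModel

variable {ι : F ≃ₐ[K] F} {x y : F} {f : K[X]} (M : HyperellipticModel ι x y f)

include M

theorem aeval_ne_zero {A : K[X]} (hA : A ≠ 0) : aeval x A ≠ 0 :=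
  fun h => hA ((transcendental_iff.1 M.transcendental) A h)

theorem map_aeval (A : K[X]) : ι (aeval x A) = aeval x A := by
  have := (aeval_algHom_apply (ι : F →ₐ[K] F) x A).symm
  simpa [M.map_x] using this

theorem map_add_mul (A B : K[X]) :
    ι (aeval x A + aeval x B * y) = aeval x A - aeval x B * y := by
  rw [map_add, map_mul, M.map_aeval, M.map_aeval, M.map_y]
  ring

theorem eq_zero_of_add_mul_eq_zero (h2 : (2 : K) ≠ 0) {A B : K[X]}
    (h : aeval x A + aeval x B * y = 0) : A = 0 ∧ B = 0 := by
  have h1 := congrArg ι h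
  rw [M.map_add_mul, map_zero] at h1
  have h2' : (2 : F) ≠ 0 := by
    have := (_root_.map_ne_zero (algebraMap K F)).2 h2
    rwa [map_ofNat] at this
  have hA : aeval x A = 0 := by
    apply mul_left_cancel₀ h2'
    linear_combination h + h1
  have hA' : A = 0 := by
    by_contra h0
    exact M.aeval_ne_zero h0 hA
  refine ⟨hA', ?_⟩
  by_contra h0
  rw [hA, zero_add] at h
  exact mul_ne_zero (M.aeval_ne_zero h0) M.y_ne_zero h

theorem sub_ne_zero (a : K) : x - algebraMap K F a ≠ 0 := by
  have := M.aeval_ne_zero (X_sub_C_ne_zero a)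
  simpa using this

/-- At a branch point, `y` is a local parameter and `x - a` has a double zero. -/
theorem valuation_sub_eq_sq {a : K} (hfa : ¬ (X - C a) ^ 2 ∣ f) (hf0 : f.eval a = 0)
    {V : ValuationSubring F} (hV : IsCenter x y V a 0) :
    V.valuation (x - algebraMap K F a) = V.valuation y ^ 2 := by
  obtain ⟨f₁, rfl⟩ := dvd_iff_isRoot.2 (IsRoot.def.2 hf0)
  have h1 : f₁.eval a ≠ 0 := by
    intro h
    obtain ⟨f₂, rfl⟩ := dvd_iff_isRoot.2 (IsRoot.def.2 h)
    exact hfa ⟨f₂, by ring⟩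
  rw [← map_pow, M.y_sq, map_mul, map_mul,
    valuation_aeval_eq_one hV.algebraMap_mem hV.x_lt h1, mul_one]
  simp

theorem exists_valuation_eq_of_ramified {a : K} (hfa : ¬ (X - C a) ^ 2 ∣ f) (hf0 : f.eval a = 0)
    {A B : K[X]} (hAB : A ≠ 0 ∨ B ≠ 0) :
    ∃ k : ℕ, ∀ V : ValuationSubring F, IsCenter x y V a 0 →
      V.valuation (aeval x A + aeval x B * y) = V.valuation y ^ k := by
  have hA (A : K[X]) (hA : A ≠ 0) (V : ValuationSubring F) (hV : IsCenter x y V a 0) :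
      V.valuation (aeval x A) = V.valuation y ^ (2 * A.rootMultiplicity a) := by
    rw [valuation_aeval hV.algebraMap_mem hV.x_lt hA, M.valuation_sub_eq_sq hfa hf0 hV, pow_mul]
  have hB (B : K[X]) (hB : B ≠ 0) (V : ValuationSubring F) (hV : IsCenter x y V a 0) :
      V.valuation (aeval x B * y) = V.valuation y ^ (2 * B.rootMultiplicity a + 1) := by
    rw [map_mul, hA B hB V hV, pow_succ]
  by_cases hA0 : A = 0
  · subst hA0
    have hB0 : B ≠ 0 := hAB.resolve_left (by simp)
    exact ⟨_, fun V hV => by rw [map_zero, zero_add]; exact hB B hB0 V hV⟩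
  by_cases hB0 : B = 0
  · subst hB0
    exact ⟨_, fun V hV => by rw [map_zero, zero_mul, add_zero]; exact hA A hA0 V hV⟩
  have hlt {V : ValuationSubring F} (hV : IsCenter x y V a 0) {i j : ℕ} (hij : i < j) :
      V.valuation y ^ j < V.valuation y ^ i := by
    have h1 := hV.y_lt
    rw [map_zero, sub_zero] at h1
    exact pow_lt_pow_right_of_lt_one₀ (zero_lt_iff.2 ((Valuation.ne_zero_iff _).2 M.y_ne_zero))
      h1 hij
  rcases Nat.lt_or_gt_of_ne (show 2 * A.rootMultiplicity a ≠ 2 * B.rootMultiplicity a + 1 by omega)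
    with h | h
  · refine ⟨2 * A.rootMultiplicity a, fun V hV => ?_⟩
    rw [V.valuation.map_add_eq_of_lt_left, hA A hA0 V hV]
    rw [hA A hA0 V hV, hB B hB0 V hV]
    exact hlt hV h
  · refine ⟨2 * B.rootMultiplicity a + 1, fun V hV => ?_⟩
    rw [V.valuation.map_add_eq_of_lt_right, hB B hB0 V hV]
    rw [hA A hA0 V hV, hB B hB0 V hV]
    exact hlt hV h

theorem exists_valuation_eq_of_unramified (h2 : (2 : K) ≠ 0) {a c : K}
    (hc0 : c ≠ 0) {A B : K[X]} (hAB : A ≠ 0 ∨ B ≠ 0) :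
    ∃ k : ℕ, ∀ V : ValuationSubring F, IsCenter x y V a c →
      V.valuation (aeval x A + aeval x B * y) = V.valuation (x - algebraMap K F a) ^ k := by
  classical
  have hD : EuclideanDomain.gcd A B ≠ 0 := by
    rw [Ne, EuclideanDomain.gcd_eq_zero_iff]
    tauto
  obtain ⟨A₁, hA⟩ := EuclideanDomain.gcd_dvd_left A B
  obtain ⟨B₁, hB⟩ := EuclideanDomain.gcd_dvd_right A B
  set D := EuclideanDomain.gcd A B with hDdef
  have hcop : IsCoprime A₁ B₁ := by
    obtain ⟨u, v, huv⟩ : ∃ u v, D = A * u + B * v :=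
      ⟨_, _, EuclideanDomain.gcd_eq_gcd_ab A B⟩
    refine ⟨u, v, mul_left_cancel₀ hD ?_⟩
    linear_combination -huv - u * hA - v * hB
  have hev (V : ValuationSubring F) (hV : IsCenter x y V a c) (A B : K[X]) :
      V.valuation (aeval x A + aeval x B * y - algebraMap K F (A.eval a + B.eval a * c)) < 1 := by
    have e : aeval x A + aeval x B * y - algebraMap K F (A.eval a + B.eval a * c) =
        (aeval x A - algebraMap K F (A.eval a)) + ((aeval x B - algebraMap K F (B.eval a)) * y +
          algebraMap K F (B.eval a) * (y - algebraMap K F c)) := by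
      rw [map_add, map_mul]; ring
    rw [e]
    have hy : y ∈ V := mem_of_valuation_sub_lt hV.algebraMap_mem hV.y_lt
    refine V.valuation.map_add_lt (valuation_aeval_sub_lt hV.algebraMap_mem hV.x_lt A)
      (V.valuation.map_add_lt ?_ ?_)
    · rw [map_mul]
      exact mul_lt_one_of_lt_of_le (valuation_aeval_sub_lt hV.algebraMap_mem hV.x_lt B)
        ((V.valuation_le_one_iff _).2 hy)
    · rw [map_mul, mul_comm]
      exact mul_lt_one_of_lt_of_le hV.y_lt ((V.valuation_le_one_iff _).2 (hV.algebraMap_mem _))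
  have hfac : aeval x A + aeval x B * y = aeval x D * (aeval x A₁ + aeval x B₁ * y) := by
    conv_lhs => rw [hA, hB]
    rw [map_mul, map_mul]; ring
  by_cases h1 : A₁.eval a + B₁.eval a * c = 0
  · have h1' : A₁.eval a + (-B₁).eval a * c ≠ 0 := by
      intro h
      rw [eval_neg] at h
      have hA0 : A₁.eval a = 0 := by
        apply mul_left_cancel₀ h2; linear_combination h + h1
      have hB0 : B₁.eval a = 0 := by
        apply mul_right_cancel₀ hc0; rw [hA0] at h1; linear_combination h1
      obtain ⟨u, v, huv⟩ := hcop
      have := congrArg (eval a) huv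
      simp [hA0, hB0] at this
    -- the norm of `A₁ + B₁ y` computes its valuation, since the conjugate is a unit
    have hG : A₁ ^ 2 - B₁ ^ 2 * f ≠ 0 := by
      intro h
      have h3 : (aeval x A₁ + aeval x B₁ * y) * (aeval x A₁ - aeval x B₁ * y) = 0 := by
        have := congrArg (aeval x) h
        rw [map_sub, map_mul, map_pow, map_pow, ← M.y_sq, map_zero] at this
        linear_combination this
      have h4 : A₁ = 0 ∧ B₁ = 0 := by
        rcases mul_eq_zero.1 h3 with h | h
        · exact M.eq_zero_of_add_mul_eq_zero h2 h
        · have := M.eq_zero_of_add_mul_eq_zero h2 (A := A₁) (B := -B₁)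
            (by rw [map_neg]; linear_combination h)
          exact ⟨this.1, neg_eq_zero.1 this.2⟩
      rw [h4.1, h4.2] at hcop
      exact not_isCoprime_zero_zero hcop
    refine ⟨D.rootMultiplicity a + (A₁ ^ 2 - B₁ ^ 2 * f).rootMultiplicity a, fun V hV => ?_⟩
    have hu := valuation_eq_one_of_sub_lt hV.algebraMap_mem h1' (hev V hV A₁ (-B₁))
    rw [hfac, map_mul, pow_add, valuation_aeval hV.algebraMap_mem hV.x_lt hD,
      ← valuation_aeval hV.algebraMap_mem hV.x_lt hG]
    congr 1
    have e : aeval x (A₁ ^ 2 - B₁ ^ 2 * f) =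
        (aeval x A₁ + aeval x B₁ * y) * (aeval x A₁ + aeval x (-B₁) * y) := by
      rw [map_sub, map_mul, map_pow, map_pow, ← M.y_sq, map_neg]
      ring
    rw [e, map_mul, hu, mul_one]
  · refine ⟨D.rootMultiplicity a, fun V hV => ?_⟩
    rw [hfac, map_mul, valuation_aeval hV.algebraMap_mem hV.x_lt hD,
      valuation_eq_one_of_sub_lt hV.algebraMap_mem h1 (hev V hV A₁ B₁), mul_one]

open scoped Classical in
/-- Smooth affine points carry a local parameter `π`, in terms of which the valuation of a function
does not depend on the choice of a valuation ring centered at the point. -/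
theorem exists_uniformizer (h2 : (2 : K) ≠ 0) {a c : K} (hfa : ¬ (X - C a) ^ 2 ∣ f)
    (hc : f.eval a = c ^ 2) : ∃ π : F, π ≠ 0 ∧
      (∀ V : ValuationSubring F, IsCenter x y V a c → V.valuation π < 1 ∧
        V.valuation (x - algebraMap K F a) = V.valuation π ^ (if c = 0 then 2 else 1)) ∧
      ∀ h : F, h ≠ 0 → ∃ k : ℤ, ∀ V : ValuationSubring F, IsCenter x y V a c →
        V.valuation h = V.valuation π ^ k := by
  have of_poly {π : F} (hπ : π ≠ 0) (H : ∀ A B : K[X], A ≠ 0 ∨ B ≠ 0 →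
      ∃ k : ℕ, ∀ V : ValuationSubring F, IsCenter x y V a c →
        V.valuation (aeval x A + aeval x B * y) = V.valuation π ^ k) (h : F) (hh : h ≠ 0) :
      ∃ k : ℤ, ∀ V : ValuationSubring F, IsCenter x y V a c →
        V.valuation h = V.valuation π ^ k := by
    obtain ⟨A, B, D, hD, e⟩ := M.exists_eq h
    have hAB : A ≠ 0 ∨ B ≠ 0 := by
      by_contra! hcon
      rw [hcon.1, hcon.2, map_zero, zero_mul, add_zero] at e
      exact mul_ne_zero hh (M.aeval_ne_zero hD) e
    obtain ⟨k, hk⟩ := H A B hAB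
    obtain ⟨l, hl⟩ := H D 0 (Or.inl hD)
    refine ⟨k - l, fun V hV => ?_⟩
    have hπV : V.valuation π ≠ 0 := (Valuation.ne_zero_iff _).2 hπ
    have h1 := congrArg V.valuation e
    have h3 := hl V hV
    rw [map_zero, zero_mul, add_zero] at h3
    rw [map_mul, hk V hV, h3] at h1
    rw [zpow_sub₀ hπV, zpow_natCast, zpow_natCast, eq_div_iff (pow_ne_zero _ hπV), h1]
  by_cases hc0 : c = 0
  · subst hc0
    rw [zero_pow two_ne_zero] at hc
    refine ⟨y, M.y_ne_zero, fun V hV => ⟨?_, ?_⟩, of_poly M.y_ne_zero fun A B hAB =>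
      M.exists_valuation_eq_of_ramified hfa hc hAB⟩
    · simpa using hV.y_lt
    · rw [if_pos rfl]
      exact M.valuation_sub_eq_sq hfa hc hV
  · refine ⟨x - algebraMap K F a, M.sub_ne_zero a, fun V hV => ⟨hV.x_lt, ?_⟩,
      of_poly (M.sub_ne_zero a) fun A B hAB =>
      M.exists_valuation_eq_of_unramified h2 hc0 hAB⟩
    rw [if_neg hc0, pow_one]

theorem center_unique (h2 : (2 : K) ≠ 0) {a c : K} (hfa : ¬ (X - C a) ^ 2 ∣ f)
    (hc : f.eval a = c ^ 2) {V W : ValuationSubring F} (hV : IsCenter x y V a c)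
    (hW : IsCenter x y W a c) : V = W := by
  obtain ⟨π, hπ, h1, h3⟩ := M.exists_uniformizer h2 hfa hc
  have key {V : ValuationSubring F} (hV : IsCenter x y V a c) {h : F} {k : ℤ}
      (hk : V.valuation h = V.valuation π ^ k) : h ∈ V ↔ 0 ≤ k := by
    rw [← V.valuation_le_one_iff, hk, ← zpow_zero (V.valuation π)]
    exact zpow_le_zpow_iff_right_of_lt_one₀
      (zero_lt_iff.2 ((Valuation.ne_zero_iff _).2 hπ)) (h1 V hV).1
  ext h
  by_cases h0 : h = 0
  · simp [h0, V.zero_mem, W.zero_mem]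
  obtain ⟨k, hk⟩ := h3 h h0
  rw [key hV (hk V hV), key hW (hk W hW)]

theorem isDiscreteValuationRing_of_isCenter (h2 : (2 : K) ≠ 0) {a c : K}
    (hfa : ¬ (X - C a) ^ 2 ∣ f) (hc : f.eval a = c ^ 2) {V : ValuationSubring F}
    (hV : IsCenter x y V a c) : IsDiscreteValuationRing V := by
  obtain ⟨π, hπ, h1, h3⟩ := M.exists_uniformizer h2 hfa hc
  have hπ1 := (h1 V hV).1
  have hπ0 : 0 < V.valuation π := zero_lt_iff.2 ((Valuation.ne_zero_iff _).2 hπ)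
  let p : V := ⟨π, (V.valuation_le_one_iff _).1 hπ1.le⟩
  have hpow {z : V} (hz : z ≠ 0) : ∃ n : ℕ, V.valuation (z : F) = V.valuation π ^ n := by
    obtain ⟨k, hk⟩ := h3 z (fun h => hz (Subtype.ext h))
    have hk' := hk V hV
    have : 0 ≤ k := by
      have h4 := V.valuation_le_one z
      rw [hk', ← zpow_zero (V.valuation π)] at h4
      exact (zpow_le_zpow_iff_right_of_lt_one₀ hπ0 hπ1).1 h4
    obtain ⟨n, rfl⟩ := Int.eq_ofNat_of_zero_le this
    exact ⟨n, by rw [hk']; exact zpow_natCast _ _⟩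
  have hinj {n m : ℕ} (h : V.valuation π ^ n = V.valuation π ^ m) : n = m :=
    (pow_right_injective₀ hπ0 hπ1.ne) h
  refine IsDiscreteValuationRing.ofHasUnitMulPowIrreducibleFactorization ⟨p, ⟨?_, ?_⟩, ?_⟩
  · intro hu
    exact hπ1.ne ((V.valuation_eq_one_iff p).1 hu)
  · intro z w hzw
    have hz : z ≠ 0 := by
      rintro rfl; rw [zero_mul] at hzw; exact hπ (congrArg Subtype.val hzw)
    have hw : w ≠ 0 := by
      rintro rfl; rw [mul_zero] at hzw; exact hπ (congrArg Subtype.val hzw)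
    obtain ⟨n, hn⟩ := hpow hz
    obtain ⟨m, hm⟩ := hpow hw
    have h4 : V.valuation π = V.valuation (z : F) * V.valuation (w : F) := by
      rw [← map_mul]; exact congrArg V.valuation (congrArg Subtype.val hzw)
    rw [hn, hm, ← pow_add] at h4
    have h5 : 1 = n + m := hinj (by rw [pow_one]; exact h4)
    rw [V.valuation_eq_one_iff, V.valuation_eq_one_iff, hn, hm]
    rcases Nat.eq_zero_or_pos n with h | h
    · left; rw [h, pow_zero]
    · right; rw [show m = 0 by omega, pow_zero]
  · intro z hz
    obtain ⟨n, hn⟩ := hpow hz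
    refine ⟨n, ?_⟩
    have : V.valuation (z : F) = V.valuation ((p ^ n : V) : F) := by
      rw [hn, ← map_pow]; rfl
    obtain ⟨u, hu⟩ := (V.valuation_eq_iff _ _).1 this
    exact ⟨u, Subtype.ext (by rw [mul_comm]; exact hu)⟩

open scoped Classical in
theorem ord_sub_of_isCenter (h2 : (2 : K) ≠ 0) {a c : K} (hfa : ¬ (X - C a) ^ 2 ∣ f)
    (hc : f.eval a = c ^ 2) {P : Point K F} (hP : IsCenter x y P.localRing a c) :
    P.ord (x - algebraMap K F a) = if c = 0 then 2 else 1 := by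
  obtain ⟨π, hπ, h1, h3⟩ := M.exists_uniformizer h2 hfa hc
  have key {h : F} (hh : h ≠ 0) {k : ℤ}
      (hk : P.localRing.valuation h = P.localRing.valuation π ^ k) : P.ord h = k * P.ord π := by
    have h4 : P.ord (h * π ^ (-k)) = 0 := by
      rw [P.ord_eq_zero_iff (mul_ne_zero hh (zpow_ne_zero _ hπ)), map_mul, map_zpow₀, hk,
        ← zpow_add₀ ((Valuation.ne_zero_iff _).2 hπ), add_neg_cancel, zpow_zero]
    rw [P.ord_mul hh (zpow_ne_zero _ hπ), P.ord_zpow hπ] at h4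
    linarith
  have hπ1 : P.ord π = 1 := by
    obtain ⟨t, ht, ht1⟩ := P.exists_ord_eq_one
    obtain ⟨k, hk⟩ := h3 t ht
    have h5 := key ht (hk _ hP)
    have h6 := (P.ord_pos_iff hπ).2 (h1 _ hP).1
    rw [ht1] at h5
    exact Int.eq_one_of_mul_eq_one_left h6.le h5.symm
  have := key (M.sub_ne_zero a) (k := if c = 0 then 2 else 1) (by
    rw [(h1 _ hP).2]
    split_ifs <;> norm_cast)
  rw [this, hπ1, mul_one]

end HyperellipticModel

end Model

/-! ### The coordinate ring and the divisors of `x - a` -/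

section Affine

variable {K F : Type*} [Field K] [Field F] [Algebra K F]

theorem aeval_eq_pow_mul_aeval_inv {x : F} (hx : x ≠ 0) {A : K[X]} {N : ℕ} (hA : A.natDegree ≤ N) :
    aeval x A = x ^ N * aeval x⁻¹ (A.reflect N) := by
  let : Invertible x := invertibleOfNonzero hx
  have := eval₂_reflect_mul_pow (algebraMap K F) x N A hA
  rw [invOf_eq_inv] at this
  rw [aeval_def, aeval_def, ← this, mul_comm]

/-- Away from the poles of `x`, a proper valuation ring is centered at some value `a` of `x`: the
field `K` being algebraically closed, otherwise all rational functions of `x` would be integral. -/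
theorem exists_valuation_sub_lt [IsAlgClosed K] {x : F} (V : ValuationSubring F)
    (hV : ∀ r : K, algebraMap K F r ∈ V) (hx : x ∈ V)
    (hgen : (∀ A B : K[X], aeval x A / aeval x B ∈ V) → V = ⊤) (hne : V ≠ ⊤) :
    ∃ a : K, V.valuation (x - algebraMap K F a) < 1 := by
  by_contra! hcon
  have h1 (a : K) : V.valuation (x - algebraMap K F a) = 1 :=
    le_antisymm ((V.valuation_le_one_iff _).2 (sub_mem hx (hV a))) (hcon a)
  have h2 (n : ℕ) : ∀ A : K[X], A.natDegree = n → A ≠ 0 → V.valuation (aeval x A) = 1 := by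
    induction n with
    | zero =>
      intro A hA hA0
      obtain ⟨c, rfl⟩ := natDegree_eq_zero.1 hA
      rw [aeval_C]
      exact valuation_algebraMap_eq_one hV (fun h => hA0 (by rw [h, C_0]))
    | succ n ih =>
      intro A hA hA0
      obtain ⟨a, ha⟩ := IsAlgClosed.exists_root A (by
        rw [degree_eq_natDegree hA0, hA]; exact_mod_cast Nat.succ_ne_zero n)
      obtain ⟨B, rfl⟩ := dvd_iff_isRoot.2 ha
      have hB0 : B ≠ 0 := right_ne_zero_of_mul hA0
      rw [natDegree_mul (X_sub_C_ne_zero a) hB0, natDegree_X_sub_C] at hA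
      rw [map_mul, map_mul, ih B (by omega) hB0, mul_one]
      simpa using h1 a
  refine hne (hgen fun A B => ?_)
  by_cases hB : B = 0
  · simp [hB, V.zero_mem]
  rw [← V.valuation_le_one_iff, map_div₀, h2 _ B rfl hB, div_one, V.valuation_le_one_iff]
  exact aeval_mem hV hx A

theorem Point.localRing_ne_top (P : Point K F) : P.localRing ≠ ⊤ := by
  intro h
  obtain ⟨t, ht, ht1⟩ := P.exists_ord_eq_one
  have h1 : t⁻¹ ∈ P.localRing := h ▸ ValuationSubring.mem_top _
  rw [← P.ord_nonneg_iff (inv_ne_zero ht), P.ord_inv, ht1] at h1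
  omega

theorem valuation_inv_lt_one {V : ValuationSubring F} {x : F} (hx : x ∉ V) :
    V.valuation x⁻¹ < 1 := by
  rw [← ValuationSubring.mem_nonunits_iff, ValuationSubring.inv_mem_nonunits_iff]
  exact Or.inr hx

theorem mem_of_sq_mem {V : ValuationSubring F} {y : F} (hy : y ^ 2 ∈ V) : y ∈ V := by
  rw [← V.valuation_le_one_iff, map_pow] at hy
  rw [← V.valuation_le_one_iff]
  exact (pow_le_one_iff_of_nonneg zero_le two_ne_zero).1 hy

namespace HyperellipticModel

variable {ι : F ≃ₐ[K] F} {x y : F} {f : K[X]}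

theorem x_ne_zero (M : HyperellipticModel ι x y f) : x ≠ 0 := by
  have := M.aeval_ne_zero X_ne_zero
  rwa [aeval_X] at this

theorem y_mem (M : HyperellipticModel ι x y f) {V : ValuationSubring F}
    (hV : ∀ r : K, algebraMap K F r ∈ V) (hx : x ∈ V) : y ∈ V :=
  mem_of_sq_mem (by rw [M.y_sq]; exact aeval_mem hV hx f)

theorem exists_sub_lt [IsAlgClosed K] (M : HyperellipticModel ι x y f) (Q : Point K F)
    (hx : x ∈ Q.localRing) : ∃ a : K, Q.localRing.valuation (x - algebraMap K F a) < 1 := by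
  refine exists_valuation_sub_lt Q.localRing Q.algebraMap_mem hx (fun h => ?_) Q.localRing_ne_top
  rw [eq_top_iff]
  intro z _
  obtain ⟨A, B, D, hD, e⟩ := M.exists_eq z
  have hD' := M.aeval_ne_zero hD
  have : z = aeval x A / aeval x D + aeval x B / aeval x D * y := by
    field_simp
    exact e
  rw [this]
  exact add_mem (h _ _) (mul_mem (h _ _) (M.y_mem Q.algebraMap_mem hx))

theorem exists_isCenter [IsAlgClosed K] (M : HyperellipticModel ι x y f) {V : ValuationSubring F}
    (hV : ∀ r : K, algebraMap K F r ∈ V) {a : K} (hx : V.valuation (x - algebraMap K F a) < 1) :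
    ∃ c : K, f.eval a = c ^ 2 ∧ IsCenter x y V a c := by
  obtain ⟨c, hc⟩ := IsAlgClosed.exists_pow_nat_eq (f.eval a) two_pos
  have h1 := valuation_aeval_sub_lt hV hx f
  rw [← M.y_sq, ← hc, map_pow, sq_sub_sq, map_mul] at h1
  by_cases h2 : V.valuation (y - algebraMap K F c) < 1
  · exact ⟨c, hc.symm, hV, hx, h2⟩
  · refine ⟨-c, by rw [neg_sq, hc], hV, hx, ?_⟩
    rw [map_neg, sub_neg_eq_add]
    by_contra h3
    exact h1.not_ge (one_le_mul (not_lt.1 h3) (not_lt.1 h2))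

theorem exists_valuationSubring (M : HyperellipticModel ι x y f) (a : K) :
    ∃ V : ValuationSubring F, (∀ r : K, algebraMap K F r ∈ V) ∧
      V.valuation (x - algebraMap K F a) < 1 := by
  let R : Subring F := (aeval x : K[X] →ₐ[K] F).range.toSubring
  let t : R := ⟨x - algebraMap K F a, ⟨X - C a, by simp⟩⟩
  have hI : Ideal.span {t} ≠ ⊤ := by
    rw [Ne, Ideal.span_singleton_eq_top]
    intro hu
    obtain ⟨⟨_, B, rfl⟩, hb⟩ := hu.exists_right_inv
    have h1 : (x - algebraMap K F a) * aeval x B = 1 := congrArg Subtype.val hb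
    have h2 : (X - C a) * B - 1 = 0 := by
      by_contra h0
      refine M.aeval_ne_zero h0 ?_
      rw [map_sub, map_mul, map_one]
      simpa [sub_eq_zero] using h1
    have h3 := congrArg (eval a) h2
    simp at h3
  obtain ⟨V, hV, hV'⟩ := Ideal.image_subset_nonunits_valuationSubring _ hI
  refine ⟨V, fun r => hV ⟨C r, by simp⟩, ?_⟩
  exact V.mem_nonunits_iff.1 (hV' ⟨t, Ideal.mem_span_singleton_self t, rfl⟩)

theorem exists_point [IsAlgClosed K] (M : HyperellipticModel ι x y f) (h2 : (2 : K) ≠ 0) {a : K}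
    (hfa : ¬ (X - C a) ^ 2 ∣ f) :
    ∃ (P : Point K F) (c : K), f.eval a = c ^ 2 ∧ IsCenter x y P.localRing a c := by
  obtain ⟨V, hV, hx⟩ := M.exists_valuationSubring a
  obtain ⟨c, hc, hcen⟩ := M.exists_isCenter hV hx
  exact ⟨⟨V, hV, M.isDiscreteValuationRing_of_isCenter h2 hfa hc hcen⟩, c, hc, hcen⟩

/-- The equation of the curve in the coordinates `1/x` and `y/x^(m+1)`, which are regular at the
points at infinity. -/
theorem inv (M : HyperellipticModel ι x y f) {m : ℕ} (hf : f.natDegree = 2 * m + 1) :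
    HyperellipticModel ι x⁻¹ (y * x⁻¹ ^ (m + 1)) (X * f.reverse) where
  transcendental := by
    intro h
    exact M.transcendental (by simpa using h.inv)
  map_x := by rw [map_inv₀, M.map_x]
  map_y := by rw [map_mul, map_pow, map_inv₀, M.map_x, M.map_y]; ring
  y_sq := by
    have hx := M.x_ne_zero
    have := aeval_eq_pow_mul_aeval_inv hx hf.le
    have hs : x ^ (2 * m + 1) * (x⁻¹ ^ (m + 1)) ^ 2 = x⁻¹ := by
      calc x ^ (2 * m + 1) * (x⁻¹ ^ (m + 1)) ^ 2 = (x * x⁻¹) ^ (2 * m + 1) * x⁻¹ := by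
            generalize x⁻¹ = s
            ring
        _ = x⁻¹ := by rw [mul_inv_cancel₀ hx, one_pow, one_mul]
    rw [mul_pow, M.y_sq, this, map_mul, aeval_X, reverse, hf]
    linear_combination aeval x⁻¹ (f.reflect (2 * m + 1)) * hs
  y_ne_zero := mul_ne_zero M.y_ne_zero (pow_ne_zero _ (inv_ne_zero M.x_ne_zero))
  exists_eq := by
    intro h
    have hx := M.x_ne_zero
    obtain ⟨A, B, D, hD, e⟩ := M.exists_eq h
    let N := max A.natDegree (max B.natDegree D.natDegree)
    refine ⟨X ^ (m + 1) * A.reflect N, B.reflect N, X ^ (m + 1) * D.reflect N,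
      mul_ne_zero (pow_ne_zero _ X_ne_zero) (by rwa [Ne, reflect_eq_zero_iff]), ?_⟩
    rw [aeval_eq_pow_mul_aeval_inv hx (A := A) (N := N) (le_max_left _ _),
      aeval_eq_pow_mul_aeval_inv hx (A := B) (N := N) ((le_max_left _ _).trans (le_max_right _ _)),
      aeval_eq_pow_mul_aeval_inv hx (A := D) (N := N)
        ((le_max_right _ _).trans (le_max_right _ _))] at e
    have e' : h * aeval x⁻¹ (D.reflect N) =
        aeval x⁻¹ (A.reflect N) + aeval x⁻¹ (B.reflect N) * y := by
      apply mul_left_cancel₀ (pow_ne_zero N hx)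
      linear_combination e
    simp only [map_mul, map_pow, aeval_X]
    linear_combination x⁻¹ ^ (m + 1) * e'

theorem isCenter_comap (M : HyperellipticModel ι x y f) {P : Point K F} {a c : K}
    (hP : IsCenter x y P.localRing a c) : IsCenter x y (P.comap ι).localRing a (-c) where
  algebraMap_mem := (P.comap ι).algebraMap_mem
  x_lt := by
    rw [P.comap_valuation_lt_one_iff, map_sub, M.map_x, AlgEquiv.commutes]
    exact hP.x_lt
  y_lt := by
    rw [P.comap_valuation_lt_one_iff, map_sub, M.map_y, AlgEquiv.commutes, map_neg, sub_neg_eq_add,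
      ← Valuation.map_neg, neg_add, neg_neg, ← sub_eq_add_neg]
    exact hP.y_lt

end HyperellipticModel

/-- A model `y² = f(x)` with `f` monic, squarefree and of odd degree `2m+1`; the given point `O` is
the point at infinity. -/
structure OddModel (ι : F ≃ₐ[K] F) (x y : F) (f : K[X]) (m : ℕ) (O : Point K F) : Prop
    extends HyperellipticModel ι x y f where
  squarefree : Squarefree f
  monic : f.Monic
  natDegree_eq : f.natDegree = 2 * m + 1
  not_mem : x ∉ O.localRing

namespace OddModel

variable {ι : F ≃ₐ[K] F} {x y : F} {f : K[X]} {m : ℕ} {O : Point K F}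

theorem not_sq_dvd (M : OddModel ι x y f m O) (a : K) : ¬ (X - C a) ^ 2 ∣ f := by
  intro h
  rw [pow_two] at h
  exact (irreducible_X_sub_C a).not_isUnit (M.squarefree _ h)

theorem not_sq_dvd_inv (M : OddModel ι x y f m O) : ¬ (X - C (0 : K)) ^ 2 ∣ X * f.reverse := by
  rw [C_0, sub_zero, pow_two, mul_dvd_mul_iff_left X_ne_zero, X_dvd_iff, coeff_zero_reverse,
    M.monic.leadingCoeff]
  exact one_ne_zero

theorem isCenter_infinity (M : OddModel ι x y f m O) {V : ValuationSubring F}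
    (hV : ∀ r : K, algebraMap K F r ∈ V) (hx : x ∉ V) :
    IsCenter x⁻¹ (y * x⁻¹ ^ (m + 1)) V (0 : K) 0 := by
  have h1 : V.valuation (x⁻¹ - algebraMap K F 0) < 1 := by
    rw [map_zero, sub_zero]; exact valuation_inv_lt_one hx
  refine ⟨hV, h1, ?_⟩
  have h2 := valuation_aeval_sub_lt hV h1 (X * f.reverse)
  rw [← (M.inv M.natDegree_eq).y_sq] at h2
  simp only [eval_mul, eval_X, zero_mul, map_zero, sub_zero, map_pow] at h2 ⊢
  exact (pow_lt_one_iff_of_nonneg zero_le two_ne_zero).1 h2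

theorem mem_of_ne (M : OddModel ι x y f m O) (h2 : (2 : K) ≠ 0) {Q : Point K F} (hQ : Q ≠ O) :
    x ∈ Q.localRing := by
  by_contra hx
  refine hQ (Point.ext_localRing ((M.inv M.natDegree_eq).center_unique h2 M.not_sq_dvd_inv
    (by simp) (M.isCenter_infinity Q.algebraMap_mem hx)
    (M.isCenter_infinity O.algebraMap_mem M.not_mem)))

theorem ord_infinity_x (M : OddModel ι x y f m O) (h2 : (2 : K) ≠ 0) : O.ord x = -2 := by
  have := (M.inv M.natDegree_eq).ord_sub_of_isCenter h2 M.not_sq_dvd_inv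
    (by simp) (M.isCenter_infinity O.algebraMap_mem M.not_mem)
  rw [if_pos rfl, map_zero, sub_zero, O.ord_inv] at this
  omega

theorem ord_infinity_aeval (M : OddModel ι x y f m O) (h2 : (2 : K) ≠ 0) {A : K[X]} (hA : A ≠ 0) :
    O.ord (aeval x A) = -2 * A.natDegree := by
  have hx := M.x_ne_zero
  have h1 := valuation_aeval_eq_one O.algebraMap_mem
    (M.isCenter_infinity O.algebraMap_mem M.not_mem).x_lt (A := A.reverse) (by
      rw [← coeff_zero_eq_eval_zero, coeff_zero_reverse]
      exact leadingCoeff_ne_zero.2 hA)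
  have h0 : aeval x⁻¹ A.reverse ≠ 0 := by
    intro h; rw [h, map_zero] at h1; exact zero_ne_one h1
  have e : aeval x A = x ^ A.natDegree * aeval x⁻¹ A.reverse :=
    aeval_eq_pow_mul_aeval_inv hx le_rfl
  rw [e, O.ord_mul (pow_ne_zero _ hx) h0, O.ord_pow hx,
    M.ord_infinity_x h2, (O.ord_eq_zero_iff h0).2 h1]
  ring

theorem ord_infinity_y (M : OddModel ι x y f m O) (h2 : (2 : K) ≠ 0) :
    O.ord y = -(2 * m + 1) := by
  have h1 := M.ord_infinity_aeval h2 M.monic.ne_zero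
  rw [← M.y_sq, O.ord_pow M.y_ne_zero, M.natDegree_eq] at h1
  push_cast at h1
  linarith

open scoped Classical in
/-- The divisor of `x - a` is `P + ι P - 2 O` for a point `P` over `a`. -/
theorem exists_ord_sub_eq [IsAlgClosed K] (M : OddModel ι x y f m O) (h2 : (2 : K) ≠ 0) (a : K) :
    ∃ P : Point K F, P ≠ O ∧ P.comap ι ≠ O ∧
      P.localRing.valuation (x - algebraMap K F a) < 1 ∧ ∀ Q : Point K F,
      Q.ord (x - algebraMap K F a) = (if Q = P then 1 else 0) + (if Q = P.comap ι then 1 else 0) -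
        (if Q = O then 2 else 0) := by
  obtain ⟨P, c, hc, hP⟩ := M.exists_point h2 (M.not_sq_dvd a)
  have hP' := M.toHyperellipticModel.isCenter_comap hP
  have ne_O {Q : Point K F} (h : Q.localRing.valuation (x - algebraMap K F a) < 1) : Q ≠ O := by
    rintro rfl
    exact M.not_mem (mem_of_valuation_sub_lt Q.algebraMap_mem h)
  refine ⟨P, ne_O hP.x_lt, ne_O hP'.x_lt, hP.x_lt, fun Q => ?_⟩
  by_cases hQO : Q = O
  · subst hQO
    rw [if_neg (ne_O hP.x_lt).symm, if_neg (ne_O hP'.x_lt).symm, if_pos rfl]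
    have := M.ord_infinity_aeval h2 (X_sub_C_ne_zero a)
    rw [natDegree_X_sub_C] at this
    simpa using this
  rw [if_neg hQO, sub_zero]
  have h0 := M.sub_ne_zero a
  have hmem := sub_mem (M.mem_of_ne h2 hQO) (Q.algebraMap_mem a)
  by_cases hQ : Q.localRing.valuation (x - algebraMap K F a) < 1
  · obtain ⟨d, hd, hQd⟩ := M.exists_isCenter Q.algebraMap_mem hQ
    rw [M.ord_sub_of_isCenter h2 (M.not_sq_dvd a) hd hQd]
    have uniq {R : Point K F} (hR : IsCenter x y R.localRing a d) : Q = R :=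
      Point.ext_localRing (M.center_unique h2 (M.not_sq_dvd a) hd hQd hR)
    have hdc : d ^ 2 = c ^ 2 := by rw [← hd, hc]
    by_cases hd0 : d = 0
    · subst hd0
      have hc0 : c = 0 := by
        rw [zero_pow two_ne_zero] at hdc
        exact pow_eq_zero_iff two_ne_zero |>.1 hdc.symm
      subst hc0
      rw [neg_zero] at hP'
      rw [if_pos rfl, if_pos (uniq hP), if_pos (uniq hP')]
      norm_num
    · rw [if_neg hd0]
      have hne {R : Point K F} {r : K} (hR : IsCenter x y R.localRing a r) (hr : r = -d) :
          Q ≠ R := by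
        rintro rfl
        have h3 := Q.localRing.valuation.map_sub_lt hR.y_lt hQd.y_lt
        rw [sub_sub_sub_cancel_left, ← map_sub, hr, sub_neg_eq_add] at h3
        refine h3.ne (valuation_algebraMap_eq_one Q.algebraMap_mem ?_)
        rw [← two_mul]
        exact mul_ne_zero h2 hd0
      rcases sq_eq_sq_iff_eq_or_eq_neg.1 hdc with h | h
      · rw [if_pos (uniq (by rw [h]; exact hP)), if_neg (hne hP' (by rw [h]))]
        norm_num
      · rw [if_neg (hne hP (by rw [h, neg_neg])), if_pos (uniq (by rw [h]; exact hP'))]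
        norm_num
  · have hP1 : Q ≠ P := by rintro rfl; exact hQ hP.x_lt
    have hP2 : Q ≠ P.comap ι := by rintro rfl; exact hQ hP'.x_lt
    rw [if_neg hP1, if_neg hP2, Q.ord_eq_zero_iff h0 |>.2]
    · norm_num
    · exact le_antisymm ((ValuationSubring.valuation_le_one_iff _ _).2 hmem) (not_lt.1 hQ)

/-- A rational function of `x` without poles outside `O` is a polynomial in `x`. -/
theorem exists_eq_aeval_of_mul [IsAlgClosed K] (M : OddModel ι x y f m O) (h2 : (2 : K) ≠ 0) {r : F}
    (hr : ∀ Q : Point K F, Q ≠ O → r ∈ Q.localRing) {A D : K[X]} (hD : D ≠ 0)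
    (h : r * aeval x D = aeval x A) : ∃ B : K[X], r = aeval x B := by
  classical
  have hG : EuclideanDomain.gcd A D ≠ 0 := by
    rw [Ne, EuclideanDomain.gcd_eq_zero_iff]
    tauto
  obtain ⟨A₁, hA⟩ := EuclideanDomain.gcd_dvd_left A D
  obtain ⟨D₁, hD1⟩ := EuclideanDomain.gcd_dvd_right A D
  obtain ⟨u, v, huv⟩ : ∃ u v, EuclideanDomain.gcd A D = A * u + D * v :=
    ⟨_, _, EuclideanDomain.gcd_eq_gcd_ab A D⟩
  set G := EuclideanDomain.gcd A D
  have hcop : A₁ * u + D₁ * v = 1 := by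
    apply mul_left_cancel₀ hG
    linear_combination -huv - u * hA - v * hD1
  have h' : r * aeval x D₁ = aeval x A₁ := by
    apply mul_left_cancel₀ (M.aeval_ne_zero hG)
    rw [hA, hD1, map_mul, map_mul] at h
    linear_combination h
  have hdeg : D₁.degree = 0 := by
    by_contra hdeg
    obtain ⟨a, ha⟩ := IsAlgClosed.exists_root D₁ hdeg
    obtain ⟨P, hPO, -, hP, -⟩ := M.exists_ord_sub_eq h2 a
    have hAa : A₁.eval a ≠ 0 := by
      intro h0
      have := congrArg (eval a) hcop
      simp [h0, IsRoot.def.1 ha] at this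
    have h3 := valuation_aeval_eq_one P.algebraMap_mem hP hAa
    have h4 := valuation_aeval_sub_lt P.algebraMap_mem hP D₁
    rw [IsRoot.def.1 ha, map_zero, sub_zero] at h4
    rw [← h', map_mul, mul_comm] at h3
    exact (mul_lt_one_of_lt_of_le h4
      ((ValuationSubring.valuation_le_one_iff _ _).2 (hr P hPO))).ne h3
  obtain ⟨d, rfl⟩ : ∃ d, D₁ = C d := ⟨_, eq_C_of_degree_eq_zero hdeg⟩
  have hd : d ≠ 0 := by rintro rfl; simp at hdeg
  refine ⟨C d⁻¹ * A₁, ?_⟩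
  rw [map_mul, ← h', aeval_C, aeval_C, map_inv₀]
  have : algebraMap K F d ≠ 0 := (_root_.map_ne_zero _).2 hd
  field_simp

theorem comap_ne (M : OddModel ι x y f m O) (h2 : (2 : K) ≠ 0) {Q : Point K F} (hQ : Q ≠ O) :
    Q.comap ι ≠ O := by
  intro hQO
  have h1 := M.mem_of_ne h2 hQ
  have h3 : x ∈ (Q.comap ι).localRing := by rwa [Point.mem_comap, M.map_x]
  rw [hQO] at h3
  exact M.not_mem h3

/-- The functions without poles outside `O` are the elements of the coordinate ring
`K[x] + K[x] y`. -/
theorem exists_eq_of_regular [IsAlgClosed K] (M : OddModel ι x y f m O) (h2 : (2 : K) ≠ 0) {h : F}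
    (hr : ∀ Q : Point K F, Q ≠ O → h ∈ Q.localRing) :
    ∃ A B : K[X], h = aeval x A + aeval x B * y := by
  obtain ⟨A, B, D, hD, e⟩ := M.exists_eq h
  have h2' : algebraMap K F 2 ≠ 0 := (_root_.map_ne_zero _).2 h2
  have hι {Q : Point K F} (hQ : Q ≠ O) : ι h ∈ Q.localRing :=
    (Q.mem_comap ι h).1 (hr _ (M.comap_ne h2 hQ))
  have e' : ι h * aeval x D = aeval x A - aeval x B * y := by
    have := congrArg ι e
    rwa [map_mul, M.map_aeval, M.map_add_mul] at this
  have half {Q : Point K F} {z : F} (hz : z ∈ Q.localRing) : algebraMap K F 2⁻¹ * z ∈ Q.localRing :=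
    mul_mem (Q.algebraMap_mem _) hz
  have hhalf : algebraMap K F 2⁻¹ * 2 = 1 := by
    rw [map_inv₀, ← map_ofNat (algebraMap K F) 2]; exact inv_mul_cancel₀ h2'
  obtain ⟨A', hA'⟩ := M.exists_eq_aeval_of_mul h2 (r := algebraMap K F 2⁻¹ * (h + ι h))
    (fun Q hQ => half (add_mem (hr Q hQ) (hι hQ))) hD (A := A)
    (by linear_combination algebraMap K F 2⁻¹ * e + algebraMap K F 2⁻¹ * e' + aeval x A * hhalf)
  set s := algebraMap K F 2⁻¹ * (h - ι h) with hs
  have hs' : s * aeval x D = aeval x B * y := by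
    linear_combination algebraMap K F 2⁻¹ * e - algebraMap K F 2⁻¹ * e' + aeval x B * y * hhalf
  -- `s² = B² f / D²` is a polynomial, hence so is `B / D`, as `f` is squarefree
  obtain ⟨G, hG⟩ := M.exists_eq_aeval_of_mul h2 (r := s ^ 2)
    (fun Q hQ => pow_mem (half (sub_mem (hr Q hQ) (hι hQ))) 2) (pow_ne_zero 2 hD)
    (A := B ^ 2 * f) (by
      rw [map_mul, map_pow, map_pow, ← M.y_sq]
      linear_combination (s * aeval x D + aeval x B * y) * hs')
  have hBf : B ^ 2 * f = G * D ^ 2 := by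
    rw [← sub_eq_zero]
    by_contra h0
    refine M.aeval_ne_zero h0 ?_
    rw [map_sub, map_mul, map_mul, map_pow, map_pow, ← M.y_sq, ← hG]
    linear_combination -(s * aeval x D + aeval x B * y) * hs'
  have hDB : D ∣ B := by
    have h3 : D ^ 2 ∣ B ^ 2 * f := ⟨G, by rw [hBf]; ring⟩
    classical
    have hG : EuclideanDomain.gcd B D ≠ 0 := by
      rw [Ne, EuclideanDomain.gcd_eq_zero_iff]
      tauto
    obtain ⟨B₁, hB⟩ := EuclideanDomain.gcd_dvd_left B D
    obtain ⟨D₁, hD1⟩ := EuclideanDomain.gcd_dvd_right B D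
    obtain ⟨u, v, huv⟩ : ∃ u v, EuclideanDomain.gcd B D = B * u + D * v :=
      ⟨_, _, EuclideanDomain.gcd_eq_gcd_ab B D⟩
    set E := EuclideanDomain.gcd B D
    have hcop : IsCoprime D₁ B₁ := by
      refine ⟨v, u, ?_⟩
      apply mul_left_cancel₀ hG
      linear_combination -huv - u * hB - v * hD1
    have h4 : D₁ ^ 2 ∣ B₁ ^ 2 * f := by
      rw [hB, hD1, mul_pow, mul_pow, mul_assoc, mul_dvd_mul_iff_left (pow_ne_zero 2 hG)] at h3
      exact h3
    have h5 : D₁ ^ 2 ∣ f := (hcop.pow (m := 2) (n := 2)).dvd_of_dvd_mul_left h4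
    have h6 : IsUnit D₁ := M.squarefree _ (by rwa [← pow_two])
    rw [hD1]
    exact (h6.mul_right_dvd).2 ⟨B₁, hB⟩
  obtain ⟨B', rfl⟩ := hDB
  refine ⟨A', B', ?_⟩
  have hs'' : s = aeval x B' * y := by
    apply mul_right_cancel₀ (M.aeval_ne_zero hD)
    rw [hs', map_mul]; ring
  rw [← hA', ← hs'', hs]
  linear_combination -h * hhalf

end OddModel

end Affine

/-! ### Riemann's inequality -/

section Genus

variable {K F : Type*} [Field K] [Field F] [Algebra K F]

theorem Point.valuation_eq_exp (P : Point K F) {f : F} (hf : f ≠ 0) :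
    P.valuation f = WithZero.exp (-P.ord f) := by
  rw [ord, neg_neg, WithZero.exp_log ((Valuation.ne_zero_iff _).2 hf)]

theorem exists_algebraMap_eq [IsAlgClosed K] {z : F} (hz : IsAlgebraic K z) :
    ∃ c : K, algebraMap K F c = z := by
  have h := hz.isIntegral
  exact minpoly.mem_range_of_degree_eq_one K z
    (IsAlgClosed.degree_eq_one_of_irreducible K (minpoly.irreducible h))

/-- The residue field of a point is `K`: a function that takes no value in `K` at a point would
generate a field of units there, over which `x - a` is algebraic. -/
theorem HyperellipticModel.exists_residue [IsAlgClosed K] {ι : F ≃ₐ[K] F} {x y : F} {f : K[X]}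
    (M : HyperellipticModel ι x y f) {Q : Point K F} (hx : x ∈ Q.localRing) {z : F}
    (hz : z ∈ Q.localRing) : ∃ c : K, Q.localRing.valuation (z - algebraMap K F c) < 1 := by
  by_cases halg : IsAlgebraic K z
  · obtain ⟨c, hc⟩ := exists_algebraMap_eq halg
    exact ⟨c, by simp [hc]⟩
  obtain ⟨a, ha⟩ := M.exists_sub_lt Q hx
  refine exists_valuation_sub_lt Q.localRing Q.algebraMap_mem hz (fun hgen => ?_)
    Q.localRing_ne_top
  exfalso
  obtain ⟨A, B, D, hD, e⟩ := M.exists_eq z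
  -- the relation `(z D(x) - A(x))² = B(x)² f(x)` as a polynomial in `x` with coefficients in `K[z]`
  let G : K[X][X] := (C X * D.map C - A.map C) ^ 2 - (B.map C) ^ 2 * f.map C
  have hG0 : G ≠ 0 := by
    obtain ⟨b, hb⟩ : ∃ b, D.eval b ≠ 0 := by
      by_contra! h
      exact hD (Polynomial.funext fun r => by rw [h r, eval_zero])
    intro h
    have h1 := congrArg (fun P => coeff (eval (C b) P) 2) h
    have hev (P : K[X]) : eval (C b) (P.map C) = C (P.eval b) := by
      rw [eval_map, eval₂_at_apply]
    simp only [G, eval_sub, eval_mul, eval_pow, eval_C, hev, eval_zero, coeff_zero] at h1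
    have h2 : (X * C (D.eval b) - C (A.eval b)) ^ 2 - C (B.eval b) ^ 2 * C (f.eval b) =
        C (D.eval b ^ 2) * X ^ 2 + C (-(2 * D.eval b * A.eval b)) * X +
          C (A.eval b ^ 2 - B.eval b ^ 2 * f.eval b) := by
      simp only [C_pow, C_neg, C_mul, C_sub, C_ofNat]
      ring
    rw [h2] at h1
    simp only [coeff_add, coeff_C_mul, coeff_X_pow, coeff_X, coeff_C] at h1
    norm_num at h1
    exact hb h1
  have hmap (P : K[X]) : eval₂ (aeval z : K[X] →ₐ[K] F).toRingHom x (P.map C) = aeval x P := by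
    rw [eval₂_map]
    congr 1
    ext r
    simp
  have hGx : eval₂ (aeval z : K[X] →ₐ[K] F).toRingHom x G = 0 := by
    simp only [G, eval₂_sub, eval₂_mul, eval₂_pow, eval₂_C, hmap]
    have : (aeval z : K[X] →ₐ[K] F).toRingHom X = z := aeval_X z
    rw [this, ← M.y_sq]
    linear_combination (z * aeval x D - aeval x A + aeval x B * y) * e
  obtain ⟨H, hH, hH'⟩ := exists_eq_pow_rootMultiplicity_mul_and_not_dvd G hG0 (C a)
  rw [hH, eval₂_mul, eval₂_pow, mul_eq_zero] at hGx
  have hxa : eval₂ (aeval z : K[X] →ₐ[K] F).toRingHom x (X - C (C a)) = x - algebraMap K F a := by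
    rw [eval₂_sub, eval₂_X, eval₂_C]
    congr 1
    exact aeval_C z a
  have hHx : eval₂ (aeval z : K[X] →ₐ[K] F).toRingHom x H = 0 := by
    refine hGx.resolve_left (pow_ne_zero _ ?_)
    rw [hxa]
    exact M.sub_ne_zero a
  rw [dvd_iff_isRoot, IsRoot.def] at hH'
  obtain ⟨H', hH''⟩ := X_sub_C_dvd_sub_C_eval (a := C a) (p := H)
  have h1 := congrArg (eval₂ (aeval z : K[X] →ₐ[K] F).toRingHom x) hH''
  rw [eval₂_sub, eval₂_mul, hxa, hHx, eval₂_C, zero_sub] at h1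
  have hmem : eval₂ (aeval z : K[X] →ₐ[K] F).toRingHom x H' ∈ Q.localRing := by
    rw [eval₂_eq_sum_range]
    exact sum_mem fun i _ => mul_mem (aeval_mem Q.algebraMap_mem hz _) (pow_mem hx i)
  have hlt : Q.localRing.valuation (aeval z (H.eval (C a))) < 1 := by
    rw [← Valuation.map_neg, show -(aeval z (H.eval (C a)) : F) = _ from h1, map_mul]
    exact mul_lt_one_of_lt_of_le ha ((ValuationSubring.valuation_le_one_iff _ _).2 hmem)
  have h2 := hgen 1 (H.eval (C a))
  rw [← ValuationSubring.valuation_le_one_iff, map_one, one_div, map_inv₀] at h2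
  have h0 : aeval z (H.eval (C a)) ≠ 0 := by
    intro h0
    exact halg ⟨_, hH', h0⟩
  rw [inv_le_one₀ (zero_lt_iff.2 ((Valuation.ne_zero_iff _).2 h0))] at h2
  exact hlt.not_ge h2

namespace OddModel

variable {ι : F ≃ₐ[K] F} {x y : F} {f : K[X]} {m : ℕ} {O : Point K F}

theorem exists_residue [IsAlgClosed K] (M : OddModel ι x y f m O) (Q : Point K F) {z : F}
    (hz : z ∈ Q.localRing) : ∃ c : K, Q.localRing.valuation (z - algebraMap K F c) < 1 := by
  by_cases hx : x ∈ Q.localRing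
  · exact M.toHyperellipticModel.exists_residue hx hz
  · exact (M.inv M.natDegree_eq).exists_residue
      (((ValuationSubring.valuation_le_one_iff _ _).1 (valuation_inv_lt_one hx).le)) hz

end OddModel

theorem riemannRochSpace_mono {D E : Divisor K F} (h : D ≤ E) :
    riemannRochSpace D ≤ riemannRochSpace E :=
  fun _ hf P => (hf P).trans (WithZero.exp_le_exp.2 (h P))

theorem degree_single (P : Point K F) (n : ℤ) : degree K F (Finsupp.single P n) = n := by
  simp [degree]

/-- Allowing one more pole at `P` raises the dimension of a Riemann-Roch space by at most one. -/
theorem OddModel.riemannRochSpace_add_single_le [IsAlgClosed K] {ι : F ≃ₐ[K] F} {x y : F}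
    {f : K[X]} {m : ℕ} {O : Point K F} (M : OddModel ι x y f m O) (D : Divisor K F)
    (P : Point K F) : ∃ h : F, riemannRochSpace (D + Finsupp.single P 1) ≤
      riemannRochSpace D ⊔ Submodule.span K {h} := by
  by_cases hle : riemannRochSpace (D + Finsupp.single P 1) ≤ riemannRochSpace D
  · exact ⟨0, hle.trans le_sup_left⟩
  obtain ⟨h, hh, hhD⟩ := SetLike.not_le_iff_exists.1 hle
  refine ⟨h, fun z hz => ?_⟩
  have h0 : h ≠ 0 := by rintro rfl; exact hhD (zero_mem _)
  have hne {Q : Point K F} (hQ : Q ≠ P) : (D + Finsupp.single P 1 : Divisor K F) Q = D Q := by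
    rw [Finsupp.add_apply, Finsupp.single_eq_of_ne hQ, add_zero]
  have hP : (D + Finsupp.single P 1 : Divisor K F) P = D P + 1 := by
    rw [Finsupp.add_apply, Finsupp.single_eq_same]
  have hval : P.valuation h = WithZero.exp (D P + 1) := by
    refine le_antisymm (hP ▸ hh P) ?_
    have : ¬ P.valuation h ≤ WithZero.exp (D P) := by
      intro hcon
      refine hhD fun Q => ?_
      by_cases hQ : Q = P
      · subst hQ; exact hcon
      · rw [← hne hQ]; exact hh Q
    rw [P.valuation_eq_exp h0, WithZero.exp_le_exp] at this ⊢
    omega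
  have hzh : z / h ∈ P.localRing := by
    rw [P.mem_localRing_iff, map_div₀, hval]
    exact div_le_one_of_le₀ (hP ▸ hz P) zero_le
  obtain ⟨c, hc⟩ := M.exists_residue P hzh
  have hmem : z - c • h ∈ riemannRochSpace D := by
    intro Q
    by_cases hQ : Q = P
    · subst hQ
      have e : z - c • h = (z / h - algebraMap K F c) * h := by
        rw [sub_mul, div_mul_cancel₀ _ h0, Algebra.smul_def]
      by_cases hzero : z - c • h = 0
      · rw [hzero, map_zero]; exact zero_le
      have hlt : Q.valuation (z - c • h) < WithZero.exp (D Q + 1) := by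
        rw [e, map_mul, hval]
        rw [← Q.isEquiv.lt_one_iff_lt_one] at hc
        exact mul_lt_of_lt_one_left (WithZero.exp_pos) hc
      rw [Q.valuation_eq_exp hzero, WithZero.exp_lt_exp] at hlt
      rw [Q.valuation_eq_exp hzero, WithZero.exp_le_exp]
      omega
    · rw [← hne hQ]
      have := sub_mem hz (Submodule.smul_mem _ c hh)
      exact this Q
  have : z = (z - c • h) + c • h := by ring
  rw [this]
  exact add_mem (Submodule.mem_sup_left hmem)
    (Submodule.mem_sup_right (Submodule.smul_mem _ c (Submodule.mem_span_singleton_self h)))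

/-- Riemann's inequality `deg D + 1 - dim L(D) ≤ m` for the divisor `D`, together with the
finiteness of the dimension of `L(D)`, without which `finrank` would be a junk value. -/
def RiemannBound (m : ℕ) (D : Divisor K F) : Prop :=
  FiniteDimensional K (riemannRochSpace D) ∧
    degree K F D + 1 - Module.finrank K (riemannRochSpace D) ≤ m

namespace OddModel

variable {ι : F ≃ₐ[K] F} {x y : F} {f : K[X]} {m : ℕ} {O : Point K F}

theorem riemannBound_of_add_single [IsAlgClosed K] (M : OddModel ι x y f m O) {D : Divisor K F}
    {P : Point K F} (h : RiemannBound m (D + Finsupp.single P 1)) : RiemannBound m D := by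
  obtain ⟨hfin, hb⟩ := h
  have hle : riemannRochSpace D ≤ riemannRochSpace (D + Finsupp.single P 1) :=
    riemannRochSpace_mono (le_add_of_nonneg_right (Finsupp.single_nonneg.2 zero_le_one))
  have hfin' : FiniteDimensional K (riemannRochSpace D) :=
    Submodule.finiteDimensional_of_le hle
  obtain ⟨h, hh⟩ := M.riemannRochSpace_add_single_le D P
  have h1 := Submodule.finrank_mono hh
  have h2 := Submodule.finrank_add_le_finrank_add_finrank (riemannRochSpace D)
    (Submodule.span K {h})
  have h3 : Module.finrank K (Submodule.span K {h}) ≤ 1 :=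
    (finrank_span_le_card ({h} : Set F)).trans (by simp)
  refine ⟨hfin', ?_⟩
  rw [map_add, degree_single] at hb
  omega

theorem riemannBound_of_le [IsAlgClosed K] (M : OddModel ι x y f m O) {D E : Divisor K F}
    (hDE : D ≤ E) (h : RiemannBound m E) : RiemannBound m D := by
  have key (W : Point K F →₀ ℕ) : ∀ D : Divisor K F,
      RiemannBound m (D + W.mapRange (Nat.cast : ℕ → ℤ) Nat.cast_zero) → RiemannBound m D := by
    induction W using Finsupp.induction_linear with
    | zero => intro D h; simpa using h
    | add V W hV hW =>
      intro D h
      refine hV D (hW _ ?_)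
      rw [add_assoc, ← Finsupp.mapRange_add (by simp)]
      exact h
    | single P n =>
      induction n with
      | zero => intro D h; simpa using h
      | succ n ih =>
        intro D h
        refine ih D (M.riemannBound_of_add_single (P := P) ?_)
        rw [add_assoc]
        convert h using 2
        rw [Finsupp.mapRange_single, Finsupp.mapRange_single, ← Finsupp.single_add]
        push_cast
        rfl
  refine key ((E - D).mapRange Int.toNat (by simp)) D ?_
  convert h using 1
  ext P
  have := hDE P
  simp only [Finsupp.add_apply, Finsupp.mapRange_apply, Finsupp.sub_apply]
  omega

open scoped Classical in
/-- Adding the divisor `T` of `x - a` with `x(P) = a` does not affect Riemann's inequality, and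
allows a further pole at `P`. -/
theorem exists_riemannBound_add [IsAlgClosed K] (M : OddModel ι x y f m O) (h2 : (2 : K) ≠ 0)
    {P : Point K F} (hP : P ≠ O) : ∃ T : Divisor K F, (∀ Q ≠ O, 0 ≤ T Q) ∧ 1 ≤ T P ∧
      ∀ D : Divisor K F, RiemannBound m D → RiemannBound m (D + T) := by
  obtain ⟨a, ha⟩ := M.exists_sub_lt P (M.mem_of_ne h2 hP)
  obtain ⟨R, hRO, hRO', -, hR⟩ := M.exists_ord_sub_eq h2 a
  have h0 := M.sub_ne_zero a
  let T : Divisor K F := Finsupp.single R 1 + Finsupp.single (R.comap ι) 1 - Finsupp.single O 2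
  have hT (Q : Point K F) : T Q = Q.ord (x - algebraMap K F a) := by
    rw [hR]
    simp [T, Finsupp.single_apply, eq_comm]
  refine ⟨T, fun Q hQ => ?_, ?_, fun D hD => ?_⟩
  · rw [hT, Q.ord_nonneg_iff h0]
    exact sub_mem (M.mem_of_ne h2 hQ) (Q.algebraMap_mem a)
  · rw [hT]
    exact (P.ord_pos_iff h0).2 ha
  · have hmap : riemannRochSpace (D + T) = (riemannRochSpace D).map
        (LinearMap.mulLeft K (x - algebraMap K F a)⁻¹) := by
      ext z
      rw [Submodule.mem_map]
      have hQ (Q : Point K F) (w : F) : Q.valuation ((x - algebraMap K F a)⁻¹ * w) ≤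
          WithZero.exp ((D + T) Q) ↔ Q.valuation w ≤ WithZero.exp (D Q) := by
        by_cases hw : w = 0
        · simp [hw]
        rw [Q.valuation_eq_exp hw, Q.valuation_eq_exp (mul_ne_zero (inv_ne_zero h0) hw),
          Q.ord_mul (inv_ne_zero h0) hw, Q.ord_inv, Finsupp.add_apply, hT, WithZero.exp_le_exp,
          WithZero.exp_le_exp]
        constructor <;> intro h <;> linarith
      constructor
      · intro hz
        refine ⟨(x - algebraMap K F a) * z, fun Q => ?_, ?_⟩
        · rw [← hQ, inv_mul_cancel_left₀ h0]
          exact hz Q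
        · rw [LinearMap.mulLeft_apply, inv_mul_cancel_left₀ h0]
      · rintro ⟨w, hw, rfl⟩ Q
        rw [LinearMap.mulLeft_apply, hQ]
        exact hw Q
    let e := Submodule.equivMapOfInjective (LinearMap.mulLeft K (x - algebraMap K F a)⁻¹)
      (mul_right_injective₀ (inv_ne_zero h0)) (riemannRochSpace D)
    obtain ⟨hfin, hb⟩ := hD
    refine ⟨?_, ?_⟩
    · rw [hmap]
      exact Module.Finite.equiv e
    · rw [hmap, ← e.finrank_eq]
      have : degree K F T = 0 := by
        simp only [T, map_add, map_sub, degree_single]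
        norm_num
      rw [map_add, this]
      linarith

/-- The pole orders at infinity of `A(x)` and of `B(x) y` have different parities, so that there
is no cancellation between them. -/
theorem valuation_infinity_add_le_iff (M : OddModel ι x y f m O) (h2 : (2 : K) ≠ 0) (A B : K[X])
    (N : ℕ) : O.valuation (aeval x A + aeval x B * y) ≤ WithZero.exp (N : ℤ) ↔
      (A = 0 ∨ 2 * A.natDegree ≤ N) ∧ (B = 0 ∨ 2 * B.natDegree + (2 * m + 1) ≤ N) := by
  have hA {A : K[X]} (hA : A ≠ 0) : O.valuation (aeval x A) =
      WithZero.exp (2 * A.natDegree : ℤ) := by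
    rw [O.valuation_eq_exp (M.aeval_ne_zero hA), M.ord_infinity_aeval h2 hA]
    congr 1; ring
  have hB {B : K[X]} (hB : B ≠ 0) : O.valuation (aeval x B * y) =
      WithZero.exp (2 * B.natDegree + (2 * m + 1) : ℤ) := by
    rw [O.valuation_eq_exp (mul_ne_zero (M.aeval_ne_zero hB) M.y_ne_zero),
      O.ord_mul (M.aeval_ne_zero hB) M.y_ne_zero, M.ord_infinity_aeval h2 hB, M.ord_infinity_y h2]
    congr 1; ring
  have hA' : O.valuation (aeval x A) ≤ WithZero.exp (N : ℤ) ↔ (A = 0 ∨ 2 * A.natDegree ≤ N) := by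
    by_cases h : A = 0
    · simp [h]
    · rw [hA h, WithZero.exp_le_exp]
      simp only [h, false_or]
      omega
  have hB' : O.valuation (aeval x B * y) ≤ WithZero.exp (N : ℤ) ↔
      (B = 0 ∨ 2 * B.natDegree + (2 * m + 1) ≤ N) := by
    by_cases h : B = 0
    · simp [h]
    · rw [hB h, WithZero.exp_le_exp]
      simp only [h, false_or]
      omega
  rw [← hA', ← hB', ← max_le_iff]
  by_cases hA0 : A = 0
  · simp [hA0]
  by_cases hB0 : B = 0
  · simp [hB0]
  rw [O.valuation.map_add_of_distinct_val]
  rw [hA hA0, hB hB0]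
  intro h
  have := WithZero.exp_injective h
  omega

theorem mem_riemannRochSpace_single_iff [IsAlgClosed K] (M : OddModel ι x y f m O)
    (h2 : (2 : K) ≠ 0) (N : ℕ) (h : F) :
    h ∈ riemannRochSpace (Finsupp.single O (N : ℤ)) ↔ ∃ A B : K[X],
      (A = 0 ∨ 2 * A.natDegree ≤ N) ∧ (B = 0 ∨ 2 * B.natDegree + (2 * m + 1) ≤ N) ∧
      h = aeval x A + aeval x B * y := by
  constructor
  · intro hh
    obtain ⟨A, B, rfl⟩ := M.exists_eq_of_regular h2 (h := h) (fun Q hQ => by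
      have := hh Q
      rwa [Finsupp.single_eq_of_ne hQ, WithZero.exp_zero, ← Q.mem_localRing_iff] at this)
    have h1 := hh O
    rw [Finsupp.single_eq_same, M.valuation_infinity_add_le_iff h2] at h1
    exact ⟨A, B, h1.1, h1.2, rfl⟩
  · rintro ⟨A, B, hA, hB, rfl⟩ Q
    by_cases hQ : Q = O
    · subst hQ
      rw [Finsupp.single_eq_same, M.valuation_infinity_add_le_iff h2]
      exact ⟨hA, hB⟩
    · rw [Finsupp.single_eq_of_ne hQ, WithZero.exp_zero, ← Q.mem_localRing_iff]
      have hx := M.mem_of_ne h2 hQ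
      exact add_mem (aeval_mem Q.algebraMap_mem hx A) (mul_mem (aeval_mem Q.algebraMap_mem hx B)
        (M.y_mem Q.algebraMap_mem hx))

/-- The functions with a pole of order at most `2(N+m)` at infinity are `A(x) + B(x) y` with
`deg A ≤ N + m` and `deg B < N`. -/
theorem riemannBound_infinity [IsAlgClosed K] (M : OddModel ι x y f m O) (h2 : (2 : K) ≠ 0)
    (N : ℕ) : RiemannBound m (Finsupp.single O (2 * (N + m) : ℤ)) := by
  let Φ : degreeLT K (N + m + 1) × degreeLT K N →ₗ[K] F :=
    ((aeval x).toLinearMap ∘ₗ (degreeLT K (N + m + 1)).subtype).coprod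
      (LinearMap.mulRight K y ∘ₗ (aeval x).toLinearMap ∘ₗ (degreeLT K N).subtype)
  have hΦ (p : degreeLT K (N + m + 1) × degreeLT K N) :
      Φ p = aeval x (p.1 : K[X]) + aeval x (p.2 : K[X]) * y := rfl
  have hinj : Function.Injective Φ := by
    rw [← LinearMap.ker_eq_bot, LinearMap.ker_eq_bot']
    rintro ⟨A, B⟩ h
    rw [hΦ] at h
    obtain ⟨hA, hB⟩ := M.eq_zero_of_add_mul_eq_zero h2 h
    exact Prod.ext (Subtype.ext hA) (Subtype.ext hB)
  have hdeg (A : K[X]) (n : ℕ) : A ∈ degreeLT K n ↔ A = 0 ∨ A.natDegree < n := by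
    rw [mem_degreeLT]
    by_cases h : A = 0
    · simp [h]
    · rw [natDegree_lt_iff_degree_lt h]; simp [h]
  have hrange : riemannRochSpace (Finsupp.single O (2 * (N + m) : ℤ)) = LinearMap.range Φ := by
    ext h
    have := M.mem_riemannRochSpace_single_iff h2 (2 * (N + m)) h
    push_cast at this
    rw [this, LinearMap.mem_range]
    constructor
    · rintro ⟨A, B, hA, hB, rfl⟩
      exact ⟨(⟨A, (hdeg _ _).2 (hA.imp_right (by omega))⟩,
        ⟨B, (hdeg _ _).2 (hB.imp_right (by omega))⟩), rfl⟩
    · rintro ⟨⟨⟨A, hA⟩, ⟨B, hB⟩⟩, rfl⟩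
      rw [hdeg] at hA hB
      exact ⟨A, B, hA.imp_right (by omega), hB.imp_right (by omega), rfl⟩
  have hfin (n : ℕ) : FiniteDimensional K (degreeLT K n) :=
    Module.Finite.equiv (degreeLTEquiv K n).symm
  have hrank (n : ℕ) : Module.finrank K (degreeLT K n) = n := by
    rw [(degreeLTEquiv K n).finrank_eq, Module.finrank_fin_fun]
  refine ⟨?_, ?_⟩
  · rw [hrange]; infer_instance
  · rw [hrange, LinearMap.finrank_range_of_inj hinj, Module.finrank_prod, hrank, hrank,
      degree_single]
    push_cast
    linarith

/-- Riemann's inequality: the genus is at most `m`. -/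
theorem riemannBound [IsAlgClosed K] (M : OddModel ι x y f m O) (h2 : (2 : K) ≠ 0)
    (D : Divisor K F) : RiemannBound m D := by
  have h0 : ∀ N : ℤ, RiemannBound m (0 + Finsupp.single O N : Divisor K F) := by
    intro N
    refine M.riemannBound_of_le ?_ (M.riemannBound_infinity h2 N.toNat)
    rw [zero_add, Finsupp.single_le_single]
    omega
  have key : ∃ E : Divisor K F, (∀ N : ℤ, RiemannBound m (E + Finsupp.single O N)) ∧
      ∀ Q ≠ O, D Q ≤ E Q := by
    induction D using Finsupp.induction with
    | zero => exact ⟨0, h0, fun Q _ => le_rfl⟩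
    | single_add P n D _ _ ih =>
      obtain ⟨E, hE, hDE⟩ := ih
      by_cases hP : P = O
      · refine ⟨E, hE, fun Q hQ => ?_⟩
        rw [Finsupp.add_apply, hP, Finsupp.single_eq_of_ne hQ, zero_add]
        exact hDE Q hQ
      obtain ⟨T, hT0, hT1, hT⟩ := M.exists_riemannBound_add h2 hP
      have hk (k : ℕ) (N : ℤ) : RiemannBound m (E + k • T + Finsupp.single O N) := by
        induction k with
        | zero => simpa using hE N
        | succ k ih =>
          have := hT _ ih
          convert this using 1
          rw [succ_nsmul]
          abel
      refine ⟨E + n.natAbs • T, hk _, fun Q hQ => ?_⟩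
      rw [Finsupp.add_apply, Finsupp.add_apply, Finsupp.smul_apply, nsmul_eq_mul, add_comm]
      refine add_le_add (hDE Q hQ) ?_
      by_cases hQP : Q = P
      · subst hQP
        rw [Finsupp.single_eq_same]
        calc n ≤ n.natAbs := Int.le_natAbs
          _ = n.natAbs * 1 := (mul_one _).symm
          _ ≤ _ := mul_le_mul_of_nonneg_left hT1 (by positivity)
      · rw [Finsupp.single_eq_of_ne hQP]
        exact mul_nonneg (by positivity) (hT0 Q hQ)
  obtain ⟨E, hE, hDE⟩ := key
  refine M.riemannBound_of_le (fun Q => ?_) (hE (D O - E O))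
  by_cases hQ : Q = O
  · subst hQ
    rw [Finsupp.add_apply, Finsupp.single_eq_same]
    linarith
  · rw [Finsupp.add_apply, Finsupp.single_eq_of_ne hQ, add_zero]
    exact hDE Q hQ

theorem genus_le [IsAlgClosed K] (M : OddModel ι x y f m O) (h2 : (2 : K) ≠ 0) {g : ℕ}
    (hg : HasGenus K F g) : g ≤ m := by
  obtain ⟨D, hD⟩ := hg.1
  have := (M.riemannBound h2 D).2
  rw [← hD] at this
  exact_mod_cast this

end OddModel

end Genus

/-! ### Torsion points and the equation of a marked curve -/

section Torsion

variable {K F : Type*} [Field K] [Field F] [Algebra K F]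

/-- At a torsion point `P` of order `n`, there is a function with divisor `n (P) - n (O)`. -/
theorem exists_ord_eq_of_mem_torsionPoints {O P : Point K F} {n : ℕ} (hn : 1 < n)
    (hP : P ∈ torsionPoints O n) : P ≠ O ∧ ∃ h : F, h ≠ 0 ∧ P.ord h = n ∧ O.ord h = -n ∧
      ∀ Q : Point K F, Q ≠ P → Q ≠ O → Q.ord h = 0 := by
  have hord : addOrderOf (toJacobian O P) = n := hP
  have hPO : P ≠ O := by
    rintro rfl
    have h0 : toJacobian P P = 0 := by
      rw [toJacobian, QuotientAddGroup.eq_zero_iff, AddSubgroup.mem_addSubgroupOf]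
      simp only [sub_self]
      exact zero_mem _
    rw [h0, addOrderOf_zero] at hord
    omega
  refine ⟨hPO, ?_⟩
  have h1 : n • toJacobian O P = 0 := hord ▸ addOrderOf_nsmul_eq_zero _
  rw [toJacobian, ← QuotientAddGroup.mk_nsmul, QuotientAddGroup.eq_zero_iff,
    AddSubgroup.mem_addSubgroupOf] at h1
  obtain ⟨h, h0, hdiv⟩ := h1
  have hdiv' (Q : Point K F) : Q.ord h =
      n * ((Finsupp.single P 1 : Divisor K F) Q - (Finsupp.single O 1 : Divisor K F) Q) := by
    rw [← hdiv]
    simp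
  refine ⟨h, h0, ?_, ?_, fun Q hQP hQO => ?_⟩
  · rw [hdiv', Finsupp.single_eq_same, Finsupp.single_eq_of_ne hPO]
    ring
  · rw [hdiv', Finsupp.single_eq_same, Finsupp.single_eq_of_ne hPO.symm]
    ring
  · rw [hdiv', Finsupp.single_eq_of_ne hQP, Finsupp.single_eq_of_ne hQO]
    ring

theorem eq_of_valuation_sub_lt {V : ValuationSubring F} (hV : ∀ r : K, algebraMap K F r ∈ V)
    {z : F} {a b : K} (ha : V.valuation (z - algebraMap K F a) < 1)
    (hb : V.valuation (z - algebraMap K F b) < 1) : a = b := by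
  by_contra hab
  have h1 := V.valuation.map_sub_lt hb ha
  rw [sub_sub_sub_cancel_left, ← map_sub] at h1
  exact h1.ne (valuation_algebraMap_eq_one hV (sub_ne_zero.2 hab))

namespace OddModel

variable {ι : F ≃ₐ[K] F} {x y : F} {f : K[X]} {m : ℕ} {O : Point K F}

/-- A point of order `2g+1` on a curve of genus `g` yields a presentation
`f = (X - a) ^ (2g+1) + v ^ 2`: the function with divisor `(2g+1) (P - O)` is `y - v(x)` up to a
constant, and `f - v²` is its norm. -/
theorem exists_eq_pow_add_sq [IsAlgClosed K] (M : OddModel ι x y f m O) (h2 : (2 : K) ≠ 0) {g : ℕ}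
    (hg : 1 < g) (hgm : g ≤ m) {P : Point K F} (hP : P ∈ torsionPoints O (2 * g + 1)) :
    P ≠ O ∧ ∃ (a : K) (v : K[X]), P.localRing.valuation (x - algebraMap K F a) < 1 ∧
      v.natDegree ≤ g ∧ (X - C a) ^ (2 * g + 1) + v ^ 2 = f := by
  obtain ⟨hPO, h, h0, hhP, hhO, hh⟩ := exists_ord_eq_of_mem_torsionPoints (by omega) hP
  refine ⟨hPO, ?_⟩
  obtain ⟨a, ha⟩ := M.exists_sub_lt P (M.mem_of_ne h2 hPO)
  obtain ⟨A, B, hAB⟩ := M.exists_eq_of_regular h2 (h := h) (fun Q hQ => by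
    rw [← Q.ord_nonneg_iff h0]
    by_cases hQP : Q = P
    · rw [hQP, hhP]; positivity
    · rw [hh Q hQP hQ])
  have hle := M.valuation_infinity_add_le_iff h2 A B (2 * g + 1)
  have hlt := M.valuation_infinity_add_le_iff h2 A B (2 * g)
  rw [← hAB, O.valuation_eq_exp h0, hhO, WithZero.exp_le_exp] at hle hlt
  obtain ⟨hA, hB⟩ := hle.1 (by push_cast; omega)
  have hA' : A.natDegree ≤ g := by
    rcases hA with rfl | hA
    · simp
    · omega
  have hB0 : B ≠ 0 := by
    intro hB0
    have := hlt.2 ⟨Or.inr (by omega), Or.inl hB0⟩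
    push_cast at this
    omega
  have hB' := hB.resolve_left hB0
  obtain rfl : g = m := by omega
  obtain ⟨b, rfl⟩ := natDegree_eq_zero.1 (show B.natDegree = 0 by omega)
  have hb : b ≠ 0 := by rintro rfl; simp at hB0
  have hb' : algebraMap K F b ≠ 0 := (_root_.map_ne_zero _).2 hb
  let v : K[X] := C (-b⁻¹) * A
  have hv : v.natDegree ≤ g := (natDegree_C_mul_le _ _).trans hA'
  have hhv : h = algebraMap K F b * (y - aeval x v) := by
    rw [hAB, aeval_C, map_mul, aeval_C, map_neg, map_inv₀]
    field_simp
    ring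
  refine ⟨a, v, ha, hv, ?_⟩
  have hpos {Q : Point K F} (hQO : Q ≠ O) (hQ : Q.localRing.valuation (y - aeval x v) < 1) :
      Q = P := by
    by_contra hQP
    have h3 := (Q.ord_eq_zero_iff h0).1 (hh Q hQP hQO)
    rw [hhv, map_mul, valuation_algebraMap_eq_one Q.algebraMap_mem hb, one_mul] at h3
    exact hQ.ne h3
  let G := f - v ^ 2
  have hGx : aeval x G = (y - aeval x v) * (y + aeval x v) := by
    rw [map_sub, map_pow, ← M.y_sq]; ring
  have hv2 : (v ^ 2).natDegree < f.natDegree := by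
    rw [M.natDegree_eq, natDegree_pow]; omega
  have hGm : G.Monic := M.monic.sub_of_left (degree_lt_degree hv2)
  have hGdeg : G.natDegree = 2 * g + 1 := by
    rw [natDegree_sub_eq_left_of_natDegree_lt hv2, M.natDegree_eq]
  have hroots : ∀ r ∈ G.roots, r = a := by
    intro r hr
    have hr' : G.eval r = 0 := (mem_roots'.1 hr).2
    obtain ⟨Q, hQO, hQO', hQ, -⟩ := M.exists_ord_sub_eq h2 r
    have h3 := valuation_aeval_sub_lt Q.algebraMap_mem hQ G
    rw [hr', map_zero, sub_zero, hGx, map_mul] at h3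
    by_cases h4 : Q.localRing.valuation (y - aeval x v) < 1
    · rw [hpos hQO h4] at hQ
      exact eq_of_valuation_sub_lt P.algebraMap_mem hQ ha
    · have h5 : Q.localRing.valuation (y + aeval x v) < 1 := by
        by_contra h5
        exact h3.not_ge (one_le_mul (not_lt.1 h4) (not_lt.1 h5))
      have h6 : (Q.comap ι).localRing.valuation (y - aeval x v) < 1 := by
        rw [Q.comap_valuation_lt_one_iff, map_sub, M.map_y, M.map_aeval, ← Valuation.map_neg]
        convert h5 using 2
        ring
      have h7 : (Q.comap ι).localRing.valuation (x - algebraMap K F r) < 1 := by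
        rw [Q.comap_valuation_lt_one_iff, map_sub, M.map_x, AlgEquiv.commutes]
        exact hQ
      rw [hpos hQO' h6] at h7
      exact eq_of_valuation_sub_lt P.algebraMap_mem h7 ha
  have hsplit := IsAlgClosed.splits G
  have hG : G = (X - C a) ^ (2 * g + 1) := by
    have h3 := hsplit.eq_prod_roots_of_monic hGm
    have hcard : G.roots.card = 2 * g + 1 := by rw [← hsplit.natDegree_eq_card_roots, hGdeg]
    rw [Multiset.eq_replicate.2 ⟨hcard, hroots⟩] at h3
    rw [h3, Multiset.map_replicate, Multiset.prod_replicate]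
  rw [← hG]
  ring

/-- At most two points lie over each value of `x`, so more than four torsion points have at least
three different `x`-coordinates. -/
theorem exists_three_coordinates [IsAlgClosed K] (M : OddModel ι x y f m O) (h2 : (2 : K) ≠ 0)
    {S : Set (Point K F)} (hS : 4 < S.encard) (hSO : ∀ P ∈ S, P ≠ O) {p : K → Prop}
    (hp : ∀ P ∈ S, ∃ a, P.localRing.valuation (x - algebraMap K F a) < 1 ∧ p a) :
    ∃ a b c : K, a ≠ b ∧ a ≠ c ∧ b ≠ c ∧ p a ∧ p b ∧ p c := by
  classical
  obtain ⟨T, hTS, hT⟩ : ∃ T ⊆ S, T.encard = 5 :=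
    Set.exists_subset_encard_eq (by
      have := Order.add_one_le_of_lt hS
      norm_num at this
      exact this)
  have hfin : T.Finite := Set.finite_of_encard_eq_coe (k := 5) hT
  choose! α hα hpα using hp
  let s := hfin.toFinset
  have hs : s.card = 5 := by
    rw [hfin.encard_eq_coe_toFinset_card] at hT
    exact_mod_cast hT
  have hsS {P : Point K F} (hP : P ∈ s) : P ∈ S := hTS (hfin.mem_toFinset.1 hP)
  have hcard : 2 < (s.image α).card := by
    by_contra hcon
    obtain ⟨a, -, ha⟩ := Finset.exists_lt_card_fiber_of_mul_lt_card_of_maps_to (s := s)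
      (t := s.image α) (f := α) (n := 2) (fun P hP => Finset.mem_image_of_mem α hP) (by omega)
    obtain ⟨R, -, -, -, hR⟩ := M.exists_ord_sub_eq h2 a
    have hsub : s.filter (fun P => α P = a) ⊆ {R, R.comap ι} := by
      intro Q hQ
      obtain ⟨hQs, hQa⟩ := Finset.mem_filter.1 hQ
      have h3 := hα Q (hsS hQs)
      rw [hQa, ← Q.ord_pos_iff (M.sub_ne_zero a), hR] at h3
      rw [Finset.mem_insert, Finset.mem_singleton]
      by_contra! hne
      rw [if_neg hne.1, if_neg hne.2, if_neg (hSO Q (hsS hQs))] at h3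
      omega
    have := (Finset.card_le_card hsub).trans Finset.card_le_two
    omega
  obtain ⟨a, ha, b, hb, c, hc, hab, hac, hbc⟩ := Finset.two_lt_card.1 hcard
  have key {a : K} (ha : a ∈ s.image α) : p a := by
    obtain ⟨P, hP, rfl⟩ := Finset.mem_image.1 ha
    exact hpα P (hsS hP)
  exact ⟨a, b, c, hab, hac, hbc, key ha, key hb, key hc⟩

end OddModel

end Torsion

section Involution

variable {K F : Type*} [Field K] [Field F] [Algebra K F]

/-- In the situation of a hyperelliptic involution, the line below can be given a coordinate `x`
with a pole at the given fixed point `O`. -/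
theorem IsHyperellipticInvolution.exists_coordinate [IsAlgClosed K] {ι : F ≃ₐ[K] F}
    (hι : IsHyperellipticInvolution ι) (hF : IsFunctionField K F) (O : Point K F) :
    ∃ x : F, Transcendental K x ∧ ι x = x ∧ x ∉ O.localRing ∧
      ∀ z : F, ι z = z → ∃ A B : K[X], B ≠ 0 ∧ z * aeval x B = aeval x A := by
  obtain ⟨hord, x₀, hx₀⟩ := hι
  have hιι (z : F) : ι (ι z) = z := by
    have : ι ^ 2 = 1 := hord ▸ pow_orderOf_eq_one ι
    rw [pow_two] at this
    exact congrArg (fun σ : F ≃ₐ[K] F => σ z) this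
  have hmem (z : F) : ι z = z ↔ z ∈ IntermediateField.adjoin K {x₀} := by
    rw [← hx₀, IntermediateField.mem_fixedField_iff]
    constructor
    · rintro hz σ hσ
      obtain ⟨n, rfl⟩ := Subgroup.mem_zpowers_iff.1 hσ
      have : ι ∈ MulAction.stabilizer (F ≃ₐ[K] F) z := hz
      exact (Subgroup.zpow_mem _ this n : _)
    · exact fun h => h ι (Subgroup.mem_zpowers ι)
  have htr (z : F) : z + ι z ∈ IntermediateField.adjoin K {x₀} := by
    rw [← hmem, map_add, hιι, add_comm]
  have hnm (z : F) : z * ι z ∈ IntermediateField.adjoin K {x₀} := by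
    rw [← hmem, map_mul, hιι, mul_comm]
  have htrans : Transcendental K x₀ := by
    intro halg
    obtain ⟨c, rfl⟩ := exists_algebraMap_eq halg
    have hbot : IntermediateField.adjoin K {algebraMap K F c} = ⊥ := by
      rw [IntermediateField.adjoin_simple_eq_bot_iff]
      exact IntermediateField.algebraMap_mem _ c
    obtain ⟨t, ht, -⟩ := hF
    obtain ⟨r, hr⟩ := IntermediateField.mem_bot.1 (hbot ▸ htr t)
    obtain ⟨s, hs⟩ := IntermediateField.mem_bot.1 (hbot ▸ hnm t)
    refine ht ⟨X ^ 2 - C r * X + C s, ?_, ?_⟩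
    · intro h0
      have := congrArg (fun P => coeff P 2) h0
      simp at this
    · simp only [map_add, map_sub, map_mul, map_pow, aeval_X, aeval_C, hr, hs]
      ring
  -- it suffices to find a generator with a pole at `O`
  suffices ∃ x : F, x ∉ O.localRing ∧ ι x = x ∧ x₀ ∈ IntermediateField.adjoin K {x} by
    obtain ⟨x, hxO, hx, hx₀'⟩ := this
    have htx : Transcendental K x := by
      intro halg
      obtain ⟨c, rfl⟩ := exists_algebraMap_eq halg
      exact hxO (O.algebraMap_mem c)
    refine ⟨x, htx, hx, hxO, fun z hz => ?_⟩
    have hle : IntermediateField.adjoin K {x₀} ≤ IntermediateField.adjoin K {x} :=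
      IntermediateField.adjoin_simple_le_iff.2 hx₀'
    obtain ⟨A, B, rfl⟩ := (IntermediateField.mem_adjoin_simple_iff K _).1 (hle ((hmem z).1 hz))
    by_cases hB : B = 0
    · exact ⟨0, 1, one_ne_zero, by simp [hB]⟩
    · refine ⟨A, B, hB, div_mul_cancel₀ _ fun h => ?_⟩
      exact hB ((transcendental_iff.1 htx) B h)
  by_cases hO : x₀ ∈ O.localRing
  · obtain ⟨a, ha⟩ := exists_valuation_sub_lt O.localRing O.algebraMap_mem hO (fun hgen => by
      have hgen' {z : F} (hz : z ∈ IntermediateField.adjoin K {x₀}) : z ∈ O.localRing := by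
        obtain ⟨A, B, rfl⟩ := (IntermediateField.mem_adjoin_simple_iff K _).1 hz
        exact hgen A B
      rw [eq_top_iff]
      intro z _
      by_contra hz
      have hz0 : z ≠ 0 := by rintro rfl; exact hz (zero_mem _)
      have hz' := (O.localRing.mem_or_inv_mem z).resolve_left hz
      apply hz
      have e : z = (z + ι z) - (z * ι z) * z⁻¹ := by field_simp; ring
      rw [e]
      exact sub_mem (hgen' (htr z)) (mul_mem (hgen' (hnm z)) hz')) O.localRing_ne_top
    have hne : x₀ - algebraMap K F a ≠ 0 := by
      intro h
      exact htrans (sub_eq_zero.1 h ▸ isAlgebraic_algebraMap a)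
    refine ⟨(x₀ - algebraMap K F a)⁻¹, ?_, ?_, ?_⟩
    · rw [← ValuationSubring.mem_nonunits_iff, ValuationSubring.mem_nonunits_iff_or] at ha
      exact ha.resolve_left hne
    · rw [map_inv₀, map_sub, AlgEquiv.commutes,
        (hmem x₀).2 (IntermediateField.mem_adjoin_simple_self K x₀)]
    · have h1 := IntermediateField.mem_adjoin_simple_self K (x₀ - algebraMap K F a)⁻¹
      have h3 := add_mem (inv_mem h1) (IntermediateField.algebraMap_mem _ a)
      rwa [inv_inv, sub_add_cancel] at h3
  · exact ⟨x₀, hO, (hmem x₀).2 (IntermediateField.mem_adjoin_simple_self K x₀),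
      IntermediateField.mem_adjoin_simple_self K x₀⟩

/-- A marked hyperelliptic curve has an equation `y² = f(x)` with `f` squarefree of odd degree and
with the marked point at infinity. -/
theorem IsHyperellipticInvolution.exists_oddModel [IsAlgClosed K] {ι : F ≃ₐ[K] F}
    (hι : IsHyperellipticInvolution ι) (hF : IsFunctionField K F) (h2 : (2 : K) ≠ 0)
    {O : Point K F} (hO : ∀ f : F, ι f ∈ O.localRing ↔ f ∈ O.localRing) :
    ∃ (x y : F) (f : K[X]) (m : ℕ), OddModel ι x y f m O := by
  classical
  obtain ⟨x, htr, hx, hxO, hfix⟩ := hι.exists_coordinate hF O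
  have hιι (z : F) : ι (ι z) = z := by
    have : ι ^ 2 = 1 := hι.1 ▸ pow_orderOf_eq_one ι
    rw [pow_two] at this
    exact congrArg (fun σ : F ≃ₐ[K] F => σ z) this
  have hax {A : K[X]} (hA : A ≠ 0) : aeval x A ≠ 0 := fun h => hA ((transcendental_iff.1 htr) A h)
  have hmap (A : K[X]) : ι (aeval x A) = aeval x A := by
    have := (aeval_algHom_apply (ι : F →ₐ[K] F) x A).symm
    simpa [hx] using this
  have hx0 : x ≠ 0 := by rintro rfl; exact hxO (zero_mem _)
  have h2F : (2 : F) ≠ 0 := by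
    have := (_root_.map_ne_zero (algebraMap K F)).2 h2
    rwa [map_ofNat] at this
  -- choose `y` anti-invariant with `y²` a polynomial in `x` of least possible degree
  let p : ℕ → Prop := fun n => ∃ (f : K[X]) (y : F), y ≠ 0 ∧ ι y = -y ∧ y ^ 2 = aeval x f ∧
    f.natDegree = n
  have hp : ∃ n, p n := by
    obtain ⟨z, hz⟩ : ∃ z, ι z ≠ z := by
      by_contra! h
      have : ι = 1 := AlgEquiv.ext h
      have h3 := hι.1
      rw [this, orderOf_one] at h3
      omega
    have hy0 : z - ι z ≠ 0 := sub_ne_zero.2 hz.symm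
    have hιy : ι (z - ι z) = -(z - ι z) := by rw [map_sub, hιι]; ring
    obtain ⟨A, B, hB, hAB⟩ := hfix ((z - ι z) ^ 2) (by rw [map_pow, hιy, neg_sq])
    refine ⟨_, A * B, (z - ι z) * aeval x B, mul_ne_zero hy0 (hax hB), ?_, ?_, rfl⟩
    · rw [map_mul, hmap, hιy]; ring
    · rw [map_mul, ← hAB]; ring
  obtain ⟨f, y, hy0, hιy, hyf, hfn⟩ := Nat.find_spec hp
  have hf0 : f ≠ 0 := by
    rintro rfl
    rw [map_zero] at hyf
    exact hy0 (pow_eq_zero_iff two_ne_zero |>.1 hyf)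
  have hsq : Squarefree f := by
    rintro d ⟨s, rfl⟩
    have hs0 : s ≠ 0 := right_ne_zero_of_mul hf0
    have hd0 : d ≠ 0 := left_ne_zero_of_mul (left_ne_zero_of_mul hf0)
    by_contra hd
    have hdeg : 0 < d.natDegree := Nat.pos_of_ne_zero fun h =>
      hd (isUnit_iff_degree_eq_zero.2 (by rw [degree_eq_natDegree hd0, h]; rfl))
    have hlt : s.natDegree < Nat.find hp := by
      rw [← hfn, natDegree_mul (mul_ne_zero hd0 hd0) hs0, natDegree_mul hd0 hd0]
      omega
    refine Nat.find_min hp hlt ⟨s, y / aeval x d, div_ne_zero hy0 (hax hd0), ?_, ?_, rfl⟩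
    · rw [map_div₀, hιy, hmap, neg_div]
    · have := hax hd0
      rw [div_pow, hyf, map_mul, map_mul]
      field_simp
  obtain ⟨l, hl⟩ := IsAlgClosed.exists_pow_nat_eq f.leadingCoeff two_pos
  have hlc : f.leadingCoeff ≠ 0 := leadingCoeff_ne_zero.2 hf0
  have hl0 : l ≠ 0 := by rintro rfl; exact hlc (by rw [← hl]; simp)
  have hl0' : algebraMap K F l ≠ 0 := (_root_.map_ne_zero _).2 hl0
  -- make `f` monic
  obtain ⟨f, y, hy0, hιy, hyf, hsq, hmonic⟩ : ∃ (f : K[X]) (y : F), y ≠ 0 ∧ ι y = -y ∧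
      y ^ 2 = aeval x f ∧ Squarefree f ∧ f.Monic := by
    refine ⟨C f.leadingCoeff⁻¹ * f, y / algebraMap K F l, div_ne_zero hy0 hl0', ?_, ?_, ?_, ?_⟩
    · rw [map_div₀, hιy, AlgEquiv.commutes, neg_div]
    · rw [div_pow, hyf, ← map_pow, hl, map_mul, aeval_C, map_inv₀]
      ring
    · refine hsq.squarefree_of_dvd ⟨C f.leadingCoeff, ?_⟩
      rw [mul_right_comm, ← C_mul, inv_mul_cancel₀ hlc, C_1, one_mul]
    · rw [Monic, leadingCoeff_mul, leadingCoeff_C, inv_mul_cancel₀ hlc]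
  have M : HyperellipticModel ι x y f := by
    refine ⟨htr, hx, hιy, hyf, hy0, fun h => ?_⟩
    obtain ⟨A₁, B₁, hB₁, e₁⟩ := hfix (h + ι h) (by rw [map_add, hιι, add_comm])
    obtain ⟨A₂, B₂, hB₂, e₂⟩ := hfix ((h - ι h) / y) (by
      rw [map_div₀, map_sub, hιι, hιy, ← neg_sub, neg_div_neg_eq])
    refine ⟨A₁ * B₂, A₂ * B₁, C 2 * (B₁ * B₂),
      mul_ne_zero (C_ne_zero.2 h2) (mul_ne_zero hB₁ hB₂), ?_⟩
    have e₃ : (h - ι h) * aeval x B₂ = aeval x A₂ * y := by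
      rw [← e₂]; field_simp
    simp only [map_mul, map_ofNat]
    linear_combination aeval x B₂ * e₁ + aeval x B₁ * e₃
  have hOι {z : F} (hz : O.localRing.valuation z < 1) : O.localRing.valuation (ι z) < 1 := by
    rw [← O.comap_valuation_lt_one_iff]
    have : O.comap ι = O := Point.ext_localRing (by ext f; exact hO f)
    rwa [this]
  -- for even degree, `y² / x ^ (2k)` would be a square at `O`, and `ι` would exchange its roots
  rcases Nat.even_or_odd' f.natDegree with ⟨k, hk | hk⟩
  · exfalso
    let w := y * x⁻¹ ^ k
    have hιw : ι w = -w := by rw [map_mul, map_pow, map_inv₀, hx, hιy]; ring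
    have hw2 : w ^ 2 = aeval x⁻¹ f.reverse := by
      have e : aeval x f = x ^ f.natDegree * aeval x⁻¹ f.reverse :=
        aeval_eq_pow_mul_aeval_inv hx0 le_rfl
      have hs : x ^ (2 * k) * (x⁻¹ ^ k) ^ 2 = 1 := by
        rw [← pow_mul, mul_comm k 2, ← mul_pow, mul_inv_cancel₀ hx0, one_pow]
      rw [mul_pow, hyf, e, hk]
      linear_combination aeval x⁻¹ f.reverse * hs
    have h1 := valuation_aeval_sub_lt (a := (0 : K)) O.algebraMap_mem
      (by rw [map_zero, sub_zero]; exact valuation_inv_lt_one hxO) f.reverse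
    rw [← coeff_zero_eq_eval_zero, coeff_zero_reverse, hmonic.leadingCoeff, map_one, ← hw2,
      ← one_pow 2, sq_sub_sq, map_mul] at h1
    have hcontra {z : F} (hz : ι z = -z) {c : K} (hc : c ≠ 0)
        (hlt : O.localRing.valuation (z - algebraMap K F c) < 1) : False := by
      have h3 := O.localRing.valuation.map_add_lt hlt (hOι hlt)
      rw [map_sub, hz, AlgEquiv.commutes] at h3
      have e : z - algebraMap K F c + (-z - algebraMap K F c) = algebraMap K F (-(2 * c)) := by
        rw [map_neg, map_mul, map_ofNat]; ring
      rw [e] at h3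
      exact h3.ne (valuation_algebraMap_eq_one O.algebraMap_mem (neg_ne_zero.2
        (mul_ne_zero h2 hc)))
    by_cases h3 : O.localRing.valuation (w - 1) < 1
    · exact hcontra hιw one_ne_zero (by rwa [map_one])
    · refine hcontra (z := w) hιw (neg_ne_zero.2 one_ne_zero) ?_
      rw [map_neg, map_one, sub_neg_eq_add]
      by_contra h4
      exact h1.not_ge (one_le_mul (not_lt.1 h4) (not_lt.1 h3))
  · exact ⟨x, y, f, k, ⟨M, hsq, hmonic, hk, hxO⟩⟩

end Involution

/-! ### Fields of definition -/

section FieldOfDefinition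

variable {K F : Type*} [Field K] [Field F] [Algebra K F]

/-- An affine change of the coordinate `x` and a rescaling of `y`. -/
theorem HyperellipticModel.affine {ι : F ≃ₐ[K] F} {x y : F} {f : K[X]}
    (M : HyperellipticModel ι x y f) {α δ μ : K} (hδ : δ ≠ 0) (hμ : μ ≠ 0) :
    HyperellipticModel ι (algebraMap K F δ⁻¹ * (x - algebraMap K F α)) (algebraMap K F μ⁻¹ * y)
      (C (μ ^ 2)⁻¹ * f.comp (C δ * X + C α)) := by
  have hδ' : algebraMap K F δ ≠ 0 := (_root_.map_ne_zero _).2 hδ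
  have hμ' : algebraMap K F μ ≠ 0 := (_root_.map_ne_zero _).2 hμ
  set x' := algebraMap K F δ⁻¹ * (x - algebraMap K F α) with hx'
  have hx : x = aeval x' (C δ * X + C α) := by
    simp only [map_add, map_mul, aeval_C, aeval_X, hx', map_inv₀]
    field_simp
    ring
  have hcomp (A : K[X]) : aeval x' (A.comp (C δ * X + C α)) = aeval x A := by
    rw [aeval_comp, ← hx]
  refine ⟨?_, ?_, ?_, ?_, ?_, fun h => ?_⟩
  · intro halg
    refine M.transcendental ?_
    rw [hx]
    simp only [map_add, map_mul, aeval_C, aeval_X]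
    exact ((isAlgebraic_algebraMap δ).mul halg).add (isAlgebraic_algebraMap α)
  · rw [hx', map_mul, map_sub, AlgEquiv.commutes, AlgEquiv.commutes, M.map_x]
  · rw [map_mul, AlgEquiv.commutes, M.map_y, mul_neg]
  · rw [mul_pow, M.y_sq, map_mul, hcomp, aeval_C, ← map_pow, inv_pow]
  · exact mul_ne_zero ((_root_.map_ne_zero _).2 (inv_ne_zero hμ)) M.y_ne_zero
  · obtain ⟨A, B, D, hD, e⟩ := M.exists_eq h
    refine ⟨A.comp (C δ * X + C α), C μ * B.comp (C δ * X + C α), D.comp (C δ * X + C α), ?_, ?_⟩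
    · intro h0
      have := hcomp D
      rw [h0, map_zero] at this
      exact M.aeval_ne_zero hD this.symm
    · rw [map_mul, hcomp, hcomp, hcomp, aeval_C, e, map_inv₀]
      field_simp

/-- The subfield `k(x, y)` of `F = K(x, y)` for a curve `y² = f(x)` with `f` defined over `k`. -/
def rationalFunctions (k : Subfield K) {ι : F ≃ₐ[K] F} {x y : F} {f₀ : k[X]}
    (M : HyperellipticModel ι x y (f₀.map (algebraMap k K))) (h2 : (2 : K) ≠ 0) :
    IntermediateField k F where
  carrier := {h | ∃ A B D : k[X], D ≠ 0 ∧ h * aeval x D = aeval x A + aeval x B * y}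
  mul_mem' := by
    rintro h h' ⟨A, B, D, hD, e⟩ ⟨A', B', D', hD', e'⟩
    have hy : y ^ 2 = aeval x f₀ := by rw [M.y_sq, aeval_map_algebraMap]
    refine ⟨A * A' + B * B' * f₀, A * B' + B * A', D * D', mul_ne_zero hD hD', ?_⟩
    simp only [map_mul, map_add]
    rw [← hy]
    linear_combination h' * aeval x D' * e + (aeval x A + aeval x B * y) * e'
  add_mem' := by
    rintro h h' ⟨A, B, D, hD, e⟩ ⟨A', B', D', hD', e'⟩
    refine ⟨A * D' + A' * D, B * D' + B' * D, D * D', mul_ne_zero hD hD', ?_⟩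
    simp only [map_mul, map_add]
    linear_combination aeval x D' * e + aeval x D * e'
  algebraMap_mem' r := ⟨C r, 0, 1, one_ne_zero, by simp⟩
  inv_mem' := by
    rintro h ⟨A, B, D, hD, e⟩
    have hy : y ^ 2 = aeval x f₀ := by rw [M.y_sq, aeval_map_algebraMap]
    by_cases h0 : h = 0
    · exact ⟨0, 0, 1, one_ne_zero, by simp [h0]⟩
    have hN : A ^ 2 - B ^ 2 * f₀ ≠ 0 := by
      intro hN
      have h1 : (aeval x A + aeval x B * y) * (aeval x A - aeval x B * y) = 0 := by
        have := congrArg (aeval x) hN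
        simp only [map_sub, map_mul, map_pow, map_zero, ← hy] at this
        linear_combination this
      have hinj := map_injective (algebraMap k K) (algebraMap k K).injective
      have key {A B : k[X]} (h : aeval x A + aeval x B * y = 0) : A = 0 ∧ B = 0 := by
        rw [← aeval_map_algebraMap K x A, ← aeval_map_algebraMap K x B] at h
        have := M.eq_zero_of_add_mul_eq_zero h2 h
        exact ⟨hinj (by rw [this.1, Polynomial.map_zero]),
          hinj (by rw [this.2, Polynomial.map_zero])⟩
      have hAB : A = 0 ∧ B = 0 := by
        rcases mul_eq_zero.1 h1 with h1 | h1
        · exact key h1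
        · have := key (A := A) (B := -B) (by rw [map_neg]; linear_combination h1)
          exact ⟨this.1, neg_eq_zero.1 this.2⟩
      rw [hAB.1, hAB.2, map_zero, zero_mul, add_zero] at e
      rw [← aeval_map_algebraMap K] at e
      refine mul_ne_zero h0 (M.aeval_ne_zero ?_) e
      rwa [Polynomial.map_ne_zero_iff (algebraMap k K).injective]
    refine ⟨D * A, -(D * B), A ^ 2 - B ^ 2 * f₀, hN, ?_⟩
    simp only [map_sub, map_mul, map_pow, map_neg, ← hy]
    field_simp
    linear_combination -(aeval x A - aeval x B * y) * e

/-- The curve `y² = f(x)` is defined over each subfield that contains the coefficients of `f`. -/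
theorem isDefinedOver_of_coeff_mem (k : Subfield K) {ι : F ≃ₐ[K] F} {x y : F} {f : K[X]}
    (M : HyperellipticModel ι x y f) (h2 : (2 : K) ≠ 0) (hf : ∀ i, f.coeff i ∈ k) :
    IsDefinedOver F k := by
  obtain ⟨f₀, rfl⟩ : ∃ f₀ : k[X], f₀.map (algebraMap k K) = f := by
    have : f ∈ lifts (algebraMap k K) := by
      rw [lifts_iff_coeff_lifts]
      exact fun i => ⟨⟨_, hf i⟩, rfl⟩
    exact (mem_lifts _).1 this
  let F₀ := rationalFunctions k M h2
  have hxF : x ∈ F₀ := ⟨X, 0, 1, one_ne_zero, by simp⟩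
  have hyF : y ∈ F₀ := ⟨0, 1, 1, one_ne_zero, by simp⟩
  have hmapne {A : k[X]} (hA : A ≠ 0) : aeval x A ≠ 0 := by
    rw [← aeval_map_algebraMap K]
    exact M.aeval_ne_zero (by rwa [Polynomial.map_ne_zero_iff (algebraMap k K).injective])
  refine ⟨F₀, ⟨⟨x, hxF⟩, ?_, ?_⟩, ?_, ?_⟩
  · rw [transcendental_iff]
    intro A hA
    by_contra hA0
    refine hmapne hA0 ?_
    rw [show aeval x A = ((aeval (⟨x, hxF⟩ : F₀) A : F₀) : F) from
      aeval_algHom_apply F₀.val (⟨x, hxF⟩ : F₀) A, hA]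
    rfl
  · -- `F₀` is spanned by `1` and `y` over `k(x)`
    let x' : F₀ := ⟨x, hxF⟩
    let y' : F₀ := ⟨y, hyF⟩
    let E := IntermediateField.adjoin k {x'}
    have hE (A D : k[X]) : aeval x' A / aeval x' D ∈ E :=
      (IntermediateField.mem_adjoin_simple_iff k _).2 ⟨A, D, rfl⟩
    have haev (A : k[X]) : ((aeval x' A : F₀) : F) = aeval x A :=
      (aeval_algHom_apply F₀.val x' A).symm
    classical
    refine ⟨⟨{1, y'}, ?_⟩⟩
    rw [eq_top_iff]
    rintro ⟨h, A, B, D, hD, e⟩ -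
    simp only [Finset.coe_insert, Finset.coe_singleton]
    rw [Submodule.mem_span_pair]
    refine ⟨⟨_, hE A D⟩, ⟨_, hE B D⟩, ?_⟩
    apply Subtype.ext
    have hD' := hmapne hD
    simp only [IntermediateField.smul_def, smul_eq_mul, mul_one]
    push_cast
    rw [haev, haev, haev]
    field_simp
    exact e.symm.trans (mul_comm _ _)
  · let b := Module.Basis.ofVectorSpace k K
    refine IntermediateField.LinearDisjoint.of_basis_right' b ?_
    classical
    rw [linearIndependent_iff']
    intro s h hsum
    have hrep (i) : ∃ A B D : k[X], D ≠ 0 ∧ (h i : F) * aeval x D = aeval x A + aeval x B * y :=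
      (h i).2
    choose A B D hD e using hrep
    -- multiply by the common denominator
    let R (i) : k[X] := ∏ j ∈ s.erase i, D j
    have hR (i) : R i ≠ 0 := Finset.prod_ne_zero_iff.2 fun j _ => hD j
    let 𝒜 : K[X] := ∑ i ∈ s, C (b i) * (A i * R i).map (algebraMap k K)
    let ℬ : K[X] := ∑ i ∈ s, C (b i) * (B i * R i).map (algebraMap k K)
    have haev (A : k[X]) : aeval x (A.map (algebraMap k K)) = aeval x A := aeval_map_algebraMap K x A
    have hzero : aeval x 𝒜 + aeval x ℬ * y = 0 := by
      have h1 : (∑ i ∈ s, (h i : F) * algebraMap K F (b i)) = 0 := by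
        simpa [IntermediateField.smul_def] using hsum
      have h3 := congrArg (fun z => z * aeval x (∏ j ∈ s, D j)) h1
      simp only [zero_mul, Finset.sum_mul] at h3
      rw [← h3]
      simp only [𝒜, ℬ, map_sum, map_mul, aeval_C, Polynomial.map_mul, haev, Finset.sum_mul]
      rw [← Finset.sum_add_distrib]
      refine Finset.sum_congr rfl fun i hi => ?_
      have hRi : aeval x (∏ j ∈ s, D j) = aeval x (D i) * aeval x (R i) := by
        rw [← map_mul, Finset.mul_prod_erase s D hi]
      rw [hRi]
      linear_combination -algebraMap K F (b i) * aeval x (R i) * e i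
    obtain ⟨hA, hB⟩ := M.eq_zero_of_add_mul_eq_zero h2 hzero
    have key {A : _ → k[X]}
        (hA : ∑ i ∈ s, C (b i) * (A i * R i).map (algebraMap k K) = 0) :
        ∀ i ∈ s, A i = 0 := by
      intro i hi
      suffices A i * R i = 0 from (mul_eq_zero.1 this).resolve_right (hR i)
      ext n
      have h1 := congrArg (fun P => coeff P n) hA
      simp only [finsetSum_coeff, coeff_C_mul, coeff_map, coeff_zero] at h1
      have h3 := (linearIndependent_iff'.1 b.linearIndependent) s (fun i => (A i * R i).coeff n)
        (by
          rw [← h1]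
          refine Finset.sum_congr rfl fun i _ => ?_
          rw [Algebra.smul_def, mul_comm]) i hi
      rw [h3, coeff_zero]
    intro i hi
    apply Subtype.ext
    have h3 := e i
    rw [key hA i hi, key hB i hi, map_zero, zero_mul, add_zero] at h3
    exact (mul_eq_zero.1 h3).resolve_right (hmapne (hD i))
  · rw [eq_top_iff]
    intro h _
    obtain ⟨A, B, D, hD, e⟩ := M.exists_eq h
    have hx : x ∈ IntermediateField.adjoin K (F₀ : Set F) := IntermediateField.subset_adjoin K _ hxF
    have hy : y ∈ IntermediateField.adjoin K (F₀ : Set F) := IntermediateField.subset_adjoin K _ hyF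
    have haev (A : K[X]) : aeval x A ∈ IntermediateField.adjoin K (F₀ : Set F) := by
      rw [aeval_eq_sum_range]
      exact sum_mem fun i _ => IntermediateField.smul_mem _ (pow_mem hx i)
    rw [eq_div_of_mul_eq (M.aeval_ne_zero hD) e]
    exact div_mem (add_mem (haev A) (mul_mem (haev B) hy)) (haev D)

/-- Finitely many elements that are algebraic over the prime field generate a number field or a
finite field. -/
theorem exists_subfield_of_isIntegral {S : Set K} (hS : S.Finite)
    (hint : ∀ z ∈ S, IsIntegral (⊥ : Subfield K) z) :
    ∃ k : Subfield K, S ⊆ k ∧ (ringChar K = 0 → NumberField k) ∧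
      (0 < ringChar K → Finite k) := by
  have : Finite S := hS
  let E := IntermediateField.adjoin (⊥ : Subfield K) S
  have hfin : FiniteDimensional (⊥ : Subfield K) E := IntermediateField.finiteDimensional_adjoin hint
  refine ⟨E.toSubfield, IntermediateField.subset_adjoin _ S, fun h0 => ?_, fun hp => ?_⟩
  · have hK : CharZero K := by
      have := ringChar.charP K
      rw [h0] at this
      exact CharP.charP_to_charZero K
    have hE : CharZero E := inferInstance
    have hE' : CharZero E.toSubfield := hE
    have hbot : FiniteDimensional ℚ (⊥ : Subfield K) := by
      refine Module.Finite.of_surjective (Algebra.linearMap ℚ (⊥ : Subfield K)) ?_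
      rintro ⟨z, hz⟩
      have hz' := hz
      rw [Subfield.bot_eq_of_charZero] at hz'
      obtain ⟨q, rfl⟩ := hz'
      exact ⟨q, Subtype.ext (by simp)⟩
    have hfin' : FiniteDimensional ℚ E := FiniteDimensional.trans ℚ (⊥ : Subfield K) E
    exact { to_charZero := hE', to_finiteDimensional := hfin' }
  · have hprime : (ringChar K).Prime := by
      rcases CharP.char_is_prime_or_zero K (ringChar K) with h | h
      · exact h
      · omega
    have : Fact (ringChar K).Prime := ⟨hprime⟩
    have := ringChar.charP K
    let : Algebra (ZMod (ringChar K)) K := ZMod.algebra K (ringChar K)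
    have hbot : Finite (⊥ : Subfield K) := by
      rw [Subfield.bot_eq_of_zMod_algebra (ringChar K)]
      exact Set.finite_range (algebraMap (ZMod (ringChar K)) K)
    exact (Module.finite_of_finite (⊥ : Subfield K) : Finite E)

end FieldOfDefinition

end HyperellipticTorsion

theorem theorem1p3 {K F : Type*} [Field K] [IsAlgClosed K] [Field F] [Algebra K F]
    (g : ℕ) (hg : 1 < g)
    (hchar : ringChar K = 0 ∨
      (Nat.Prime (2 * g + 1) ∧ Nat.Prime (ringChar K) ∧ ringChar K ≠ 2 ∧
        orderOf ((ringChar K : ℕ) : ZMod (2 * g + 1)) = 2 * g))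
    (O : HyperellipticTorsion.Point K F)
    (hC : HyperellipticTorsion.IsMarkedHyperellipticCurve K F g O)
    (htors : 4 < (HyperellipticTorsion.torsionPoints O (2 * g + 1)).encard) :
    (ringChar K = 0 →
      ∃ k : Subfield K, NumberField k ∧
        HyperellipticTorsion.IsDefinedOver F k) ∧
      (0 < ringChar K →
      ∃ k : Subfield K, Finite k ∧
        HyperellipticTorsion.IsDefinedOver F k) := by
  have hK : HyperellipticTorsion.AdmissibleChar (ringChar K) g := hchar
  have h2 := hK.two_ne_zero
  obtain ⟨ι, hι, hO⟩ := hC.isWeierstrass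
  obtain ⟨x, y, f, m, M⟩ := hι.exists_oddModel hC.isFunctionField h2 hO
  have hgm := M.genus_le h2 hC.hasGenus
  obtain ⟨a, b, c, hab, hac, hbc, ⟨v₁, d₁, h₁⟩, ⟨v₂, d₂, h₂⟩, ⟨v₃, d₃, h₃⟩⟩ :=
    M.exists_three_coordinates h2 htors (fun P hP => (M.exists_eq_pow_add_sq h2 hg hgm hP).1)
      (p := fun a => ∃ v : Polynomial K, v.natDegree ≤ g ∧
        (Polynomial.X - Polynomial.C a) ^ (2 * g + 1) + v ^ 2 = f)
      (fun P hP => by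
        obtain ⟨-, a, v, ha, hv, h⟩ := M.exists_eq_pow_add_sq h2 hg hgm hP
        exact ⟨a, ha, v, hv, h⟩)
  obtain ⟨α, δ, hδ, hint⟩ :=
    HyperellipticTorsion.exists_affine_isIntegral hg hK hab hac hbc d₁ d₂ d₃ h₁ h₂ h₃
  obtain ⟨μ, hμ⟩ := IsAlgClosed.exists_pow_nat_eq (δ ^ (2 * g + 1)) two_pos
  have hμ0 : μ ≠ 0 := by
    rintro rfl
    exact pow_ne_zero (2 * g + 1) hδ (by rw [← hμ, zero_pow two_ne_zero])
  rw [← hμ] at hint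
  have M' := M.toHyperellipticModel.affine (α := α) hδ hμ0
  set f' := Polynomial.C (μ ^ 2)⁻¹ *
    f.comp (Polynomial.C δ * Polynomial.X + Polynomial.C α)
  obtain ⟨k, hk, hk0, hkp⟩ := HyperellipticTorsion.exists_subfield_of_isIntegral
    (S := (f'.coeffs : Set K)) f'.coeffs.finite_toSet (fun z hz => by
      obtain ⟨i, -, rfl⟩ := Polynomial.mem_coeffs_iff.1 hz
      exact hint i)
  have hdef := HyperellipticTorsion.isDefinedOver_of_coeff_mem k M' h2 fun i => by
    by_cases hi : f'.coeff i = 0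
    · rw [hi]; exact k.zero_mem
    · exact hk (Polynomial.coeff_mem_coeffs hi)
  exact ⟨fun h => ⟨k, hk0 h, hdef⟩, fun h => ⟨k, hkp h, hdef⟩⟩
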